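/- **Setting.** Let $d_z,d_w,d_x\ge 0$ be integers and let $O=(Y,Z,W,X)$ take values in $\Omega=\mathbb R\times\mathbb R^{d_z}\times\mathbb R^{d_w}\times\mathbb R^{d_x}$. Let $\mu=\mu_Y\times\mu_Z\times\mu_W\times\mu_X$ be a product of Borel measures, where $\mu_X$ and $\mu_Y$ are $\sigma$-finite, $\mu_Y$ is either atomless or the counting measure on a finite set with at least two elements, and either (1) $\mu_Z=\mu_{Z_1}\times\mu_{Z_2}$ and $\mu_W=\mu_{W_1}\times\mu_{W_2}$ with all factors $\sigma$-finite Borel measures on Euclidean spaces and $\mu_{Z_1},\mu_{W_1}$ atomless, or (2) $\mu_Z$ and $\mu_W$ are the counting measures on finite sets of the same cardinality. Let $\mathcal P(\mu)$ be the set of Borel probability measures $P\ll\mu$ on $\Omega$, and $f_P=dP/d\mu$. For a subvector $V$ of $O$, $P_V$ denotes the law of $V$ under $P$; $L^2$ functions are Borel. Let $m$ be a map assigning a real number $m(o,g)$ to each $o\in\Omega$ and each function $g:\mathbb R^{d_w}\times\mathbb R^{d_x}\to\mathbb R$. Say that $P$ is *regular* if $m(O,g)$ is $P$-integrable for every $g\in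 L^2(P_{(W,X)})$ and $g\mapsto E_P\{m(O,g)\}$ is a well-defined, linear and continuous map $L^2(P_{(W,X)})\to\mathbb R$; then $\alpha_P\in L^2(P_{(W,X)})$ denotes its Riesz representer. The parameter is $\varphi(P)=E_P\{m(O,g_P)\}$, where $g_P\in L^2(P_{(W,X)})$ is any solution of $E_P\{g(W,X)\mid Z,X\}=E_P\{Y\mid Z,X\}$. Let $S\subseteq\mathbb R$ be a non-empty Borel set, and let $\mathcal R\subseteq\mathcal P(\mu)$ be such that whenever $P\in\mathcal R$, $P_i\in\mathcal P(\mu)$ and $f_{P_i}\to f_P$ $\mu$-a.e., some subsequence of $(P_i)$ lies in $\mathcal R$. The model $\mathcal M$ is the set of regular $P\in\mathcal R$ such that $E_P|Y|<\infty$; $\alpha_P(W,X)=E_P\{h(Z,X)\mid W,X\}$ for some $h\in L^2(P_{(Z,X)})$; $E_P\{g(W,X)\mid Z,X\}=E_P(Y\mid Z,X)$ for some $g\in L^2(P_{(W,X)})$; and $\varphi(P)\in S$. (On $\mathcal M$ the value $\varphi(P)$ does not depend on the choice of the solution $g_P$.) **Assumptions.** (A) Let $P\in\mathcal P(\mu)$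 be such that, $\mu$-a.e., $f_P=\sum_{h,i,j,l}c_{h,i,j,l}\,1_{S^Y_h\times S^Z_i\times S^W_j\times S^X_l}$, a finite sum with all $c_{h,i,j,l}>0$, where for each variable $V\in\{Y,Z,W,X\}$ the sets $S^V_\cdot$ are pairwise disjoint Borel sets of positive finite $\mu_V$-measure and, if $\mu_V$ is carried by a finite set, they are singletons whose union is the set of atoms of $\mu_V$. Then $P$ is regular, and $\alpha_P(W,X)=\sum_{j,l}t_{j,l}\,1_{S^W_j\times S^X_l}(W,X)$ $P$-a.s. for some real constants $t_{j,l}$. (B) If $P,P_1,P_2,\dots\in\mathcal P(\mu)$ are regular and $f_{P_i}\to f_P$ $\mu$-a.e., then $\alpha_{P_{i_q}}(W,X)\to\alpha_P(W,X)$ $P$-a.s. along some subsequence $(i_q)$. (C) There is a regular law $P^*\in\mathcal R$ such that the density of $P^*_X$ with respect to $\mu_X$ is positive $\mu_X$-a.e., and under $P^*$: $(Y,W)$ is independent of $Z$ given $X$; $Y$ is independent of $W$ given $X$; and $\operatorname{var}_{P^*}\{\alpha_{P^*}(W,X)\mid X\}>0$ with positive probability. For $A\subseteq\mathbb R$ let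 $\operatorname{diam}(A)=\sup\{x-y:x,y\in A\}\in[-\infty,\infty]$. Let $\alpha\in\mathbb R$, and for each $n$ let $C_n=C_n(O_1,\dots,O_n)\subseteq\mathbb R$ be a random set such that $\{\theta\in C_n\}$ is measurable for every $\theta\in S$. Below, $O_1,\dots,O_n$ are i.i.d. with law $P$ (if an event about $\operatorname{diam}(C_n)$ is not measurable, its probability is the outer one). Call $(C_n)$ *asymptotically uniformly valid of level at least $1-\alpha$* if $\liminf_n\inf_{P\in\mathcal M}P\{\varphi(P)\in C_n\}\ge 1-\alpha$. **Claim.** (i) If $(C_n)$ is asymptotically uniformly valid of level at least $1-\alpha$, then $$\liminf_n\ \sup_{P\in\mathcal M}P\{\operatorname{diam}(C_n)\ge\operatorname{diam}(S)\}\ \ge\ 1-2\alpha .$$ (ii) Suppose $\alpha<1/2$ and $S$ has at least two points. If $\lim_n\sup_{P\in\mathcal M}P\{\operatorname{diam}(C_n)\ge\varepsilon\}=0$ for every $\varepsilon>0$, then $(C_n)$ is not asymptotically uniformly valid of level at least $1-\alpha$. -/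

import Mathlib

open MeasureTheory ProbabilityTheory Filter Topology
open scoped ENNReal

namespace IntegralEq

/-- `ℝ^d`. Only its Borel structure is used. -/
abbrev Vec (d : ℕ) : Type := Fin d → ℝ

/-- The sample space of one observation `O = (Y, Z, W, X)`. -/
abbrev Obs (dz dw dx : ℕ) : Type := ℝ × Vec dz × Vec dw × Vec dx

section Coordinates

variable {dz dw dx : ℕ}

/-- The coordinate `Y`. -/
def pY (o : Obs dz dw dx) : ℝ := o.1

/-- The coordinate `Z`. -/
def pZ (o : Obs dz dw dx) : Vec dz := o.2.1

/-- The coordinate `W`. -/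
def pW (o : Obs dz dw dx) : Vec dw := o.2.2.1

/-- The coordinate `X`. -/
def pX (o : Obs dz dw dx) : Vec dx := o.2.2.2

/-- The subvector `(Z, X)`. -/
def pZX (o : Obs dz dw dx) : Vec dz × Vec dx := (pZ o, pX o)

/-- The subvector `(W, X)`. -/
def pWX (o : Obs dz dw dx) : Vec dw × Vec dx := (pW o, pX o)

/-- The subvector `(Y, W)`. -/
def pYW (o : Obs dz dw dx) : ℝ × Vec dw := (pY o, pW o)

lemma measurable_pX : Measurable (pX : Obs dz dw dx → Vec dx) := by
  unfold pX; fun_prop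

/-- The σ-algebra generated by `(Z, X)`. -/
abbrev sigmaZX (dz dw dx : ℕ) : MeasurableSpace (Obs dz dw dx) :=
  MeasurableSpace.comap pZX inferInstance

/-- The σ-algebra generated by `(W, X)`. -/
abbrev sigmaWX (dz dw dx : ℕ) : MeasurableSpace (Obs dz dw dx) :=
  MeasurableSpace.comap pWX inferInstance

/-- The σ-algebra generated by `X`. -/
abbrev sigmaX (dz dw dx : ℕ) : MeasurableSpace (Obs dz dw dx) :=
  MeasurableSpace.comap pX inferInstance

lemma sigmaX_le (dz dw dx : ℕ) :
    sigmaX dz dw dx ≤ (inferInstance : MeasurableSpace (Obs dz dw dx)) :=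
  measurable_pX.comap_le

end Coordinates

/-! ### The dominating measure -/

/-- Four measures, one for each of the variables `Y, Z, W, X`. -/
structure BaseMeasures (dz dw dx : ℕ) where
  /-- the measure for `Y` -/
  muY : Measure ℝ
  /-- the measure for `Z` -/
  muZ : Measure (Vec dz)
  /-- the measure for `W` -/
  muW : Measure (Vec dw)
  /-- the measure for `X` -/
  muX : Measure (Vec dx)

/-- The product measure `μ = μ_Y × μ_Z × μ_W × μ_X`. -/
noncomputable def BaseMeasures.mu {dz dw dx : ℕ} (B : BaseMeasures dz dw dx) :
    Measure (Obs dz dw dx) :=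
  B.muY.prod (B.muZ.prod (B.muW.prod B.muX))

/-- `ν` is a counting measure on the finite set `F`. -/
def IsCountingOn {V : Type*} [MeasurableSpace V] (ν : Measure V) (F : Finset V) : Prop :=
  ν = Measure.count.restrict (F : Set V)

/-- `ν = ν₁ × ν₂` on `ℝ^d = ℝ^{d₁} × ℝ^{d₂}`, where `ν₁` is atomless and both factors are
σ-finite. -/
def HasAtomlessFactor {d : ℕ} (ν : Measure (Vec d)) : Prop :=
  ∃ (d₁ d₂ : ℕ) (h : d₁ + d₂ = d) (ν₁ : Measure (Vec d₁)) (ν₂ : Measure (Vec d₂)),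
    SigmaFinite ν₁ ∧ SigmaFinite ν₂ ∧ NullSingletonClass ν₁ ∧
    ν = (ν₁.prod ν₂).map
      (fun p : Vec d₁ × Vec d₂ => fun i : Fin d => Fin.append p.1 p.2 (Fin.cast h.symm i))

/-- The condition on the dominating measure. -/
structure BaseMeasures.Admissible {dz dw dx : ℕ} (B : BaseMeasures dz dw dx) : Prop where
  sigmaFinite_muY : SigmaFinite B.muY
  sigmaFinite_muX : SigmaFinite B.muX
  muY_cases : NullSingletonClass B.muY ∨ ∃ F : Finset ℝ, 2 ≤ F.card ∧ IsCountingOn B.muY F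
  muZ_muW_cases :
    (HasAtomlessFactor B.muZ ∧ HasAtomlessFactor B.muW) ∨
    ∃ (FZ : Finset (Vec dz)) (FW : Finset (Vec dw)),
      FZ.card = FW.card ∧ IsCountingOn B.muZ FZ ∧ IsCountingOn B.muW FW

/-! ### The parameter -/

section Parameter

variable {dz dw dx : ℕ}

/-- Borel functions of `(W, X)` in `L²(P_{(W,X)})`. -/
def IsL2WX (P : ProbabilityMeasure (Obs dz dw dx)) (g : Vec dw × Vec dx → ℝ) : Prop :=
  Measurable g ∧ MemLp g 2 ((P : Measure (Obs dz dw dx)).map pWX)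

/-- Borel functions of `(Z, X)` in `L²(P_{(Z,X)})`. -/
def IsL2ZX (P : ProbabilityMeasure (Obs dz dw dx)) (h : Vec dz × Vec dx → ℝ) : Prop :=
  Measurable h ∧ MemLp h 2 ((P : Measure (Obs dz dw dx)).map pZX)

/-- The map `g ↦ E_P{m(O, g)}` is well defined, linear and continuous as a map from
`L²(P_{(W,X)})` to `ℝ`. -/
def IsContinuousFunctional (m : Obs dz dw dx → (Vec dw × Vec dx → ℝ) → ℝ)
    (P : ProbabilityMeasure (Obs dz dw dx)) : Prop :=
  ∃ L : Lp ℝ 2 ((P : Measure (Obs dz dw dx)).map pWX) →L[ℝ] ℝ,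
    ∀ (g : Vec dw × Vec dx → ℝ) (hg : IsL2WX P g),
      Integrable (fun o => m o g) (P : Measure (Obs dz dw dx)) ∧
      ∫ o, m o g ∂(P : Measure (Obs dz dw dx)) = L (hg.2.toLp g)

/-- `a` is (a version of) the Riesz representer `α_P` of `g ↦ E_P{m(O, g)}`. -/
def IsRieszRepresenter (m : Obs dz dw dx → (Vec dw × Vec dx → ℝ) → ℝ)
    (P : ProbabilityMeasure (Obs dz dw dx)) (a : Vec dw × Vec dx → ℝ) : Prop :=
  IsL2WX P a ∧
  ∀ g : Vec dw × Vec dx → ℝ, IsL2WX P g →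
    ∫ o, m o g ∂(P : Measure (Obs dz dw dx)) =
      ∫ o, a (pWX o) * g (pWX o) ∂(P : Measure (Obs dz dw dx))

/-- `α_P` belongs to the range of `h ↦ E_P{h(Z, X) | W, X}`, from `L²(P_{(Z,X)})` to
`L²(P_{(W,X)})`. -/
def RepresenterInRange (m : Obs dz dw dx → (Vec dw × Vec dx → ℝ) → ℝ)
    (P : ProbabilityMeasure (Obs dz dw dx)) : Prop :=
  ∃ a : Vec dw × Vec dx → ℝ, IsRieszRepresenter m P a ∧
    ∃ h : Vec dz × Vec dx → ℝ, IsL2ZX P h ∧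
      (P : Measure (Obs dz dw dx))[fun o => h (pZX o) | sigmaWX dz dw dx]
        =ᵐ[(P : Measure (Obs dz dw dx))] fun o => a (pWX o)

/-- `g ∈ L²(P_{(W,X)})` solves `E_P{g(W, X) | Z, X} = E_P{Y | Z, X}`. -/
def IsSolution (P : ProbabilityMeasure (Obs dz dw dx)) (g : Vec dw × Vec dx → ℝ) : Prop :=
  IsL2WX P g ∧
    (P : Measure (Obs dz dw dx))[fun o => g (pWX o) | sigmaZX dz dw dx]
      =ᵐ[(P : Measure (Obs dz dw dx))] (P : Measure (Obs dz dw dx))[pY | sigmaZX dz dw dx]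

/-- `E_P(Y)` exists, and `r_P = E_P(Y | Z, X)` belongs to the range of
`g ↦ E_P{g(W, X) | Z, X}`, from `L²(P_{(W,X)})` to `L²(P_{(Z,X)})`. -/
def OutcomeInRange (P : ProbabilityMeasure (Obs dz dw dx)) : Prop :=
  Integrable pY (P : Measure (Obs dz dw dx)) ∧
    ∃ g : Vec dw × Vec dx → ℝ, IsSolution P g

open Classical in
/-- The parameter `φ(P) = E_P{m(O, g_P)}`, where `g_P` is a solution of the integral equation.
On the model below the value does not depend on the solution. -/
noncomputable def phi (m : Obs dz dw dx → (Vec dw × Vec dx → ℝ) → ℝ)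
    (P : ProbabilityMeasure (Obs dz dw dx)) : ℝ :=
  if h : ∃ g : Vec dw × Vec dx → ℝ, IsSolution P g then
    ∫ o, m o h.choose ∂(P : Measure (Obs dz dw dx))
  else 0

/-! ### The model -/

/-- `P ∈ 𝒫(μ)`: the law `P` is absolutely continuous with respect to `μ`. -/
def Dominated (B : BaseMeasures dz dw dx) (P : ProbabilityMeasure (Obs dz dw dx)) : Prop :=
  (P : Measure (Obs dz dw dx)) ≪ B.mu

/-- The density `f_P` of `P` with respect to `μ`. -/
noncomputable def density (B : BaseMeasures dz dw dx)
    (P : ProbabilityMeasure (Obs dz dw dx)) : Obs dz dw dx → ℝ≥0∞ :=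
  (P : Measure (Obs dz dw dx)).rnDeriv B.mu

/-- `f_{P_i} → f_P`, `μ`-almost everywhere. -/
def DensitiesConverge (B : BaseMeasures dz dw dx)
    (Ps : ℕ → ProbabilityMeasure (Obs dz dw dx)) (P : ProbabilityMeasure (Obs dz dw dx)) : Prop :=
  ∀ᵐ o ∂B.mu, Tendsto (fun i => density B (Ps i) o) atTop (𝓝 (density B P o))

/-- The condition on the set `R ⊆ 𝒫(μ)` of additional restrictions. -/
def RestrictionCondition (B : BaseMeasures dz dw dx)
    (R : Set (ProbabilityMeasure (Obs dz dw dx))) : Prop :=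
  (∀ P ∈ R, Dominated B P) ∧
  ∀ P ∈ R, ∀ Ps : ℕ → ProbabilityMeasure (Obs dz dw dx),
    (∀ i, Dominated B (Ps i)) → DensitiesConverge B Ps P →
    ∃ q : ℕ → ℕ, StrictMono q ∧ ∀ k, Ps (q k) ∈ R

/-- The model `𝓜`. -/
def model (B : BaseMeasures dz dw dx) (m : Obs dz dw dx → (Vec dw × Vec dx → ℝ) → ℝ)
    (R : Set (ProbabilityMeasure (Obs dz dw dx))) (S : Set ℝ) :
    Set (ProbabilityMeasure (Obs dz dw dx)) :=
  {P | Dominated B P ∧ P ∈ R ∧ IsContinuousFunctional m P ∧ RepresenterInRange m P ∧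
    OutcomeInRange P ∧ phi m P ∈ S}

/-! ### Rectangular simple densities and the regularity conditions -/

/-- A finite family of support sets for one variable with base measure `ν`: pairwise disjoint Borel
sets of positive finite measure; if the variable has a finite range (`ν` is carried by a finite
set), they are singletons whose union is the support of `ν`. -/
structure IsSupportFamily {V : Type*} [MeasurableSpace V] (ν : Measure V) {k : ℕ}
    (s : Fin k → Set V) : Prop where
  measurableSet : ∀ h, MeasurableSet (s h)
  pos : ∀ h, 0 < ν (s h)
  lt_top : ∀ h, ν (s h) < ∞
  disjoint : Pairwise fun h h' => Disjoint (s h) (s h')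
  finite_range : (∃ F : Set V, F.Finite ∧ ν Fᶜ = 0) →
    (∀ h, ∃ v, s h = {v}) ∧ (⋃ h, s h) = {v | ν {v} ≠ 0}

/-- The regularity condition for rectangular simple densities: if `f_P` equals `μ`-a.e. a
rectangular non-negative simple function, then `g ↦ E_P{m(O, g)}` is linear and continuous and
`α_P` is `P`-a.s. a linear combination of indicators of the corresponding sets
`S^W_j × S^X_l`. -/
def SimpleRepresenterCondition (B : BaseMeasures dz dw dx)
    (m : Obs dz dw dx → (Vec dw × Vec dx → ℝ) → ℝ) : Prop :=
  ∀ (P : ProbabilityMeasure (Obs dz dw dx)) (kY kZ kW kX : ℕ)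
    (sY : Fin kY → Set ℝ) (sZ : Fin kZ → Set (Vec dz))
    (sW : Fin kW → Set (Vec dw)) (sX : Fin kX → Set (Vec dx))
    (c : Fin kY → Fin kZ → Fin kW → Fin kX → ℝ),
    Dominated B P →
    IsSupportFamily B.muY sY → IsSupportFamily B.muZ sZ →
    IsSupportFamily B.muW sW → IsSupportFamily B.muX sX →
    (∀ h i j l, 0 < c h i j l) →
    (density B P =ᵐ[B.mu] fun o => ENNReal.ofReal
      (∑ h, ∑ i, ∑ j, ∑ l,
        (sY h ×ˢ (sZ i ×ˢ (sW j ×ˢ sX l))).indicator (fun _ => c h i j l) o)) →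
    IsContinuousFunctional m P ∧
    ∀ a : Vec dw × Vec dx → ℝ, IsRieszRepresenter m P a →
      ∃ t : Fin kW → Fin kX → ℝ,
        (fun o => a (pWX o)) =ᵐ[(P : Measure (Obs dz dw dx))]
          fun o => ∑ j, ∑ l, (sW j ×ˢ sX l).indicator (fun _ => t j l) (pWX o)

/-- The continuity condition on `P ↦ α_P`. -/
def RepresenterContinuityCondition (B : BaseMeasures dz dw dx)
    (m : Obs dz dw dx → (Vec dw × Vec dx → ℝ) → ℝ) : Prop :=
  ∀ (P : ProbabilityMeasure (Obs dz dw dx)) (Ps : ℕ → ProbabilityMeasure (Obs dz dw dx))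
    (a : Vec dw × Vec dx → ℝ) (as : ℕ → Vec dw × Vec dx → ℝ),
    Dominated B P → IsContinuousFunctional m P → IsRieszRepresenter m P a →
    (∀ i, Dominated B (Ps i)) → (∀ i, IsContinuousFunctional m (Ps i)) →
    (∀ i, IsRieszRepresenter m (Ps i) (as i)) →
    DensitiesConverge B Ps P →
    ∃ q : ℕ → ℕ, StrictMono q ∧
      ∀ᵐ o ∂(P : Measure (Obs dz dw dx)),
        Tendsto (fun k => as (q k) (pWX o)) atTop (𝓝 (a (pWX o)))

/-- The laws `P*` of which the model contains arbitrarily close approximations: `P* ∈ R`, `f_{P*,X}`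
is positive, `(Y, W)` is independent of `Z` given `X`, `Y` is independent of `W` given `X`,
`g ↦ E_{P*}{m(O, g)}` is linear and continuous, and `var_{P*}{α_{P*}(W, X) | X} > 0` with positive
probability. -/
structure IsConditionallyIndependentLaw (B : BaseMeasures dz dw dx)
    (m : Obs dz dw dx → (Vec dw × Vec dx → ℝ) → ℝ)
    (R : Set (ProbabilityMeasure (Obs dz dw dx)))
    (P : ProbabilityMeasure (Obs dz dw dx)) : Prop where
  mem : P ∈ R
  density_pos : ∀ᵐ x ∂B.muX, 0 < ((P : Measure (Obs dz dw dx)).map pX).rnDeriv B.muX x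
  condIndep_YW_Z : CondIndepFun (sigmaX dz dw dx) (sigmaX_le dz dw dx) pYW pZ
    (P : Measure (Obs dz dw dx))
  condIndep_Y_W : CondIndepFun (sigmaX dz dw dx) (sigmaX_le dz dw dx) pY pW
    (P : Measure (Obs dz dw dx))
  continuous : IsContinuousFunctional m P
  condVar_pos : ∀ a : Vec dw × Vec dx → ℝ, IsRieszRepresenter m P a →
    0 < (P : Measure (Obs dz dw dx))
      {o | 0 < condVar (sigmaX dz dw dx) (fun o' => a (pWX o')) (P : Measure (Obs dz dw dx)) o}

end Parameter

/-! ### Confidence sets -/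

/-- The diameter `sup {x - y : x, y ∈ C}` of a set of reals, as an extended real
(`+∞` if unbounded, and `-∞` for the empty set). -/
noncomputable def diameter (C : Set ℝ) : EReal :=
  ⨆ x ∈ C, ⨆ y ∈ C, ((x - y : ℝ) : EReal)

/-- The law of `n` independent observations from `P`. -/
noncomputable def sampleLaw {Ω : Type*} [MeasurableSpace Ω] (P : ProbabilityMeasure Ω) (n : ℕ) :
    Measure (Fin n → Ω) :=
  Measure.pi fun _ : Fin n => (P : Measure Ω)

/-- `C` is an asymptotically uniformly valid confidence set for `ψ(P)` over `M`, of level at least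
`1 - α`. -/
def AsympUniformlyValid {Ω : Type*} [MeasurableSpace Ω] (M : Set (ProbabilityMeasure Ω))
    (ψ : ProbabilityMeasure Ω → ℝ) (α : ℝ) (C : ∀ n : ℕ, (Fin n → Ω) → Set ℝ) : Prop :=
  ENNReal.ofReal (1 - α) ≤
    liminf (fun n : ℕ => ⨅ P ∈ M, sampleLaw P n {o | ψ P ∈ C n o}) atTop

end IntegralEq

/-! Let P be the conditionally independent law of (C). The heart of the matter is that every θ in S
is the value of φ at laws of the model whose densities converge μ-a.e. to that of P
(`exists_model_sequence`). For samples of a fixed size, Fatou's lemma carries upper bounds on the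
probability of a measurable event from such a sequence to P (`DensitiesConverge.sampleLaw_le`). If v
is the infimum of the coverage over the model, then each θ is missed under P with probability at
most 1 - v, so two points of S are both covered with probability at least 1 - 2(1 - v). Letting the
two points approach the diameter of S gives an event of at least this probability under P on which
the confidence set is as wide as S. Fatou's lemma once more, now with the supremum over the model as
the bound, moves the conclusion from P into the model (`one_sub_le_iSup_sampleLaw_diameter`).

The sequence is built on finite grids of cells. The density of P factors as f_{YX} (f_{ZX} / f_X)
(f_{WX} / f_X) (`density_eq_of_condIndep`). Approximating the three joint densities by positive step
functions on common cells yields conditionally independent laws that are uniform on cells and whose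
densities converge to that of P (`exists_base_sequence`). If their representers were eventually
functions of X alone, then by (B) so would be that of P, against the variance condition; hence they
depend on W infinitely often (`exists_representer_depends_on_W`).

On one grid everything is linear algebra (`exists_perturbed_cell_probabilities`). Under a
conditionally independent cell law the operator from functions of W to functions of Z has rank one
given the cell of X, so a solution g may be shifted by c times any γ with conditional mean zero.
Taking γ to be the centred representer, the functional grows linearly in c. Adding ε times #ι · 1 -
J, with #ι the common number of cells of Z and of W and J the all-ones matrix, makes the operator
invertible, which also puts the representer in the range; a correction of order ε in the law of Y
keeps the shifted g an exact solution. The value is continuous in (ε, c) and affine and increasing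
in c at ε = 0, so the intermediate value theorem reaches θ at arbitrarily small ε > 0. -/

set_option linter.unusedSectionVars false

/-! ### Finite-dimensional perturbation of the cell probabilities -/

/-- `ε (#ι · 1 - J) + w b dᵀ` is invertible; `J` is the all-ones matrix. -/
theorem exists_solution_rankOne_add_smul {ι : Type*} [Fintype ι] [DecidableEq ι]
    {w ε : ℝ} (hw : w ≠ 0) (hε : ε ≠ 0) {b d : ι → ℝ} (hb : ∑ i, b i = 1) (hd : ∑ j, d j = 1)
    (τ : ι → ℝ) :
    ∃ x : ι → ℝ, ∀ j,
      ∑ i, (w * b i * d j + ε * ((Fintype.card ι : ℝ) * (if i = j then 1 else 0) - 1)) * x i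
        = τ j := by
  let A : (ι → ℝ) →ₗ[ℝ] (ι → ℝ) :=
    { toFun := fun x j =>
        ∑ i, (w * b i * d j + ε * ((Fintype.card ι : ℝ) * (if i = j then 1 else 0) - 1)) * x i
      map_add' := fun x y => by
        funext j; simp only [Pi.add_apply, mul_add, Finset.sum_add_distrib]
      map_smul' := fun c x => by
        funext j
        simp only [Pi.smul_apply, smul_eq_mul, Finset.mul_sum, RingHom.id_apply]
        exact Finset.sum_congr rfl fun i _ => by ring }
  have hA : ∀ x j, A x j =
      w * (∑ i, b i * x i) * d j + ε * ((Fintype.card ι : ℝ) * x j - ∑ i, x i) := by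
    intro x j
    change ∑ i, (w * b i * d j + ε * ((Fintype.card ι : ℝ) * (if i = j then 1 else 0) - 1)) * x i
      = _
    have : ∀ i, (w * b i * d j + ε * ((Fintype.card ι : ℝ) * (if i = j then 1 else 0) - 1)) * x i
        = w * d j * (b i * x i) + ε * Fintype.card ι * (if i = j then x i else 0) - ε * x i := by
      intro i; split_ifs <;> ring
    simp only [this, Finset.sum_sub_distrib, Finset.sum_add_distrib, ← Finset.mul_sum,
      Finset.sum_ite_eq', Finset.mem_univ, if_true]
    ring
  have hinj : Function.Injective A := by
    rw [← LinearMap.ker_eq_bot, LinearMap.ker_eq_bot']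
    intro x hx
    have hx' : ∀ j, w * (∑ i, b i * x i) * d j + ε * ((Fintype.card ι : ℝ) * x j - ∑ i, x i) = 0 :=
      fun j => by rw [← hA, hx]; rfl
    -- Summing the equations over j removes the ε part, since #ι · 1 - J has zero column sums, and d
    -- sums to 1.
    have h1 : w * (∑ i, b i * x i) = 0 := by
      have := Finset.sum_congr rfl fun j (_ : j ∈ Finset.univ) => hx' j
      simp only [Finset.sum_add_distrib, ← Finset.mul_sum, Finset.sum_sub_distrib, hd,
        Finset.sum_const, Finset.card_univ, nsmul_eq_mul, mul_zero] at this
      linarith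
    have h2 : ∑ i, b i * x i = 0 := (mul_eq_zero.1 h1).resolve_left hw
    have h3 : ∀ j, (Fintype.card ι : ℝ) * x j = ∑ i, x i := by
      intro j
      have := hx' j
      rw [h1, zero_mul, zero_add] at this
      linarith [(mul_eq_zero.1 this).resolve_left hε]
    funext j
    -- By `h3` the vector x is constant; weights b that sum to 1 return this constant, while `h2`
    -- says that they return 0.
    have h4 : ∑ i, b i * ((Fintype.card ι : ℝ) * x i) = (Fintype.card ι : ℝ) * x j := by
      simp only [h3]
      rw [← Finset.sum_mul, hb, one_mul]
    have h5 : ∑ i, b i * ((Fintype.card ι : ℝ) * x i) = 0 := by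
      rw [← mul_zero (Fintype.card ι : ℝ), ← h2, Finset.mul_sum]
      exact Finset.sum_congr rfl fun i _ => by ring
    have hcard : (Fintype.card ι : ℝ) ≠ 0 := by
      have : Nonempty ι := ⟨j⟩
      exact_mod_cast Fintype.card_ne_zero
    exact (mul_eq_zero.1 (h4.symm.trans h5)).resolve_left hcard
  obtain ⟨x, hx⟩ := (LinearMap.injective_iff_surjective.1 hinj) τ
  exact ⟨x, fun j => congrFun hx j⟩

/-- A mean-zero combination along which a non-constant function increases. -/
theorem sum_mul_sq_sub_mean_pos {ι : Type*} [Fintype ι] {d t : ι → ℝ} (hdpos : ∀ j, 0 < d j)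
    (hd : ∑ j, d j = 1) {j₁ j₂ : ι} (ht : t j₁ ≠ t j₂) :
    0 < ∑ j, t j * d j * (t j - ∑ k, d k * t k) := by
  set tb := ∑ k, d k * t k
  have h0 : ∑ j, d j * (t j - tb) = 0 := by
    simp only [mul_sub, Finset.sum_sub_distrib, ← Finset.sum_mul, hd]
    simp [tb]
  -- The sum is the variance of t under the weights d, because t may be centred at no cost.
  have h1 : ∑ j, t j * d j * (t j - tb) = ∑ j, d j * (t j - tb) ^ 2 := by
    have : ∀ j, t j * d j * (t j - tb) = d j * (t j - tb) ^ 2 + tb * (d j * (t j - tb)) :=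
      fun j => by ring
    simp only [this, Finset.sum_add_distrib, ← Finset.mul_sum, h0]
    ring
  rw [h1]
  have hne : ∃ j, t j ≠ tb := by
    by_contra! h
    exact ht ((h j₁).trans (h j₂).symm)
  obtain ⟨j, hj⟩ := hne
  refine Finset.sum_pos' (fun j _ => mul_nonneg (hdpos j).le (sq_nonneg _)) ⟨j, Finset.mem_univ _, ?_⟩
  exact mul_pos (hdpos j) (by positivity [sub_ne_zero.2 hj])

/-- A continuous `F ε c` that at `ε = 0` is affine and increasing in `c` attains every value `θ` at
arbitrarily small `ε > 0`, with `c` in a bounded range. -/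
theorem exists_pos_eq_of_affine_at_zero {F : ℝ → ℝ → ℝ} (hF : Continuous fun p : ℝ × ℝ => F p.1 p.2)
    {A D : ℝ} (hD : 0 < D) (h0 : ∀ c, F 0 c = A + c * D) (θ : ℝ) {Q : ℝ → ℝ → Prop}
    (hQ : ∀ c, ∀ᶠ p in 𝓝 ((0 : ℝ), c), Q p.1 p.2) :
    ∃ ε c, 0 < ε ∧ F ε c = θ ∧ Q ε c := by
  -- At ε = 0 the value θ is taken at c₀, and a unit step to either side moves it by D. This margin
  -- survives for small ε.
  set c₀ := (θ - A) / D
  have hc₀ : A + c₀ * D = θ := by simp only [c₀]; field_simp; ring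
  have e1 : ∀ᶠ ε in 𝓝 (0 : ℝ), F ε (c₀ - 1) < θ := by
    have : Continuous fun ε => F ε (c₀ - 1) := hF.comp (by fun_prop : Continuous fun ε : ℝ => (ε, c₀ - 1))
    refine this.continuousAt.eventually_lt continuousAt_const ?_
    rw [h0]; nlinarith
  have e2 : ∀ᶠ ε in 𝓝 (0 : ℝ), θ < F ε (c₀ + 1) := by
    have : Continuous fun ε => F ε (c₀ + 1) := hF.comp (by fun_prop : Continuous fun ε : ℝ => (ε, c₀ + 1))
    refine continuousAt_const.eventually_lt this.continuousAt ?_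
    rw [h0]; nlinarith
  -- The shift c is found only after ε is fixed, so Q is needed for all c of the interval at once;
  -- compactness gives this.
  have e3 : ∀ᶠ ε in 𝓝 (0 : ℝ), ∀ c ∈ Set.Icc (c₀ - 1) (c₀ + 1), Q ε c :=
    isCompact_Icc.eventually_forall_of_forall_eventually fun c _ => hQ c
  have e4 := ((e1.and (e2.and e3)).filter_mono nhdsWithin_le_nhds).and
    (self_mem_nhdsWithin : Set.Ioi (0 : ℝ) ∈ 𝓝[>] 0)
  obtain ⟨ε, ⟨h1, h2, h3⟩, hε⟩ := e4.exists
  have hcont : ContinuousOn (fun c => F ε c) (Set.Icc (c₀ - 1) (c₀ + 1)) :=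
    (hF.comp (by fun_prop : Continuous fun c : ℝ => (ε, c))).continuousOn
  obtain ⟨c, hc, hcθ⟩ := intermediate_value_Icc (by linarith) hcont ⟨h1.le, h2.le⟩
  exact ⟨ε, c, hε, hcθ, h3 c hc⟩

/-- Cell probabilities `w_l a_{hl} b_{il} d_{jl}`, under which the first three coordinates are
independent given the last one, can be moved by an arbitrarily small amount such that the linear
systems become solvable and the value of the functional becomes `θ`. -/
theorem exists_perturbed_cell_probabilities {H ι L : Type*} [Fintype H] [Fintype ι] [Fintype L]
    {w : L → ℝ} {a : H → L → ℝ} {b d : ι → L → ℝ}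
    (hw : ∀ l, 0 < w l) (ha : ∀ h l, 0 < a h l) (hb : ∀ i l, 0 < b i l) (hd : ∀ j l, 0 < d j l)
    (hw1 : ∑ l, w l = 1) (ha1 : ∀ l, ∑ h, a h l = 1) (hb1 : ∀ l, ∑ i, b i l = 1)
    (hd1 : ∀ l, ∑ j, d j l = 1)
    {y : H → ℝ} {h₁ h₂ : H} (hy : y h₁ ≠ y h₂)
    {T : ι → L → (H → ι → ι → L → ℝ) → ℝ} (hT : ∀ j l, Continuous (T j l))
    {l₀ : L} {t : ι → ℝ} {j₁ j₂ : ι} (ht : t j₁ ≠ t j₂)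
    (hTt : ∀ j, T j l₀ (fun h i j l => w l * a h l * b i l * d j l) = t j * (w l₀ * d j l₀))
    (θ : ℝ) {δ : ℝ} (hδ : 0 < δ) :
    ∃ (π : H → ι → ι → L → ℝ) (g : ι → L → ℝ),
      (∀ h i j l, 0 < π h i j l) ∧ (∑ h, ∑ i, ∑ j, ∑ l, π h i j l = 1) ∧
      (∀ h i j l, |π h i j l - w l * a h l * b i l * d j l| ≤ δ) ∧
      (∀ i l, ∑ h, ∑ j, π h i j l * g j l = ∑ h, ∑ j, π h i j l * y h) ∧
      (∀ τ : ι → L → ℝ, ∃ x : ι → L → ℝ, ∀ j l, ∑ h, ∑ i, π h i j l * x i l = τ j l) ∧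
      ∑ j, ∑ l, T j l π * g j l = θ := by
  classical
  -- The direction in which g is moved: its d-mean is zero, so the rank-one operator at ε = 0 does
  -- not see it, but it is positively correlated with the representer t.
  set γ : ι → ℝ := fun j => t j - ∑ k, d k l₀ * t k with hγ
  have hdγ : ∑ j, d j l₀ * γ j = 0 := by
    simp only [hγ, mul_sub, Finset.sum_sub_distrib, ← Finset.sum_mul, hd1]
    simp
  set K : ℝ := (Fintype.card ι : ℝ) with hK
  set N : ι → ι → ℝ := fun i j => K * (if i = j then 1 else 0) - 1 with hN
  have hNrow : ∀ i, ∑ j, N i j = 0 := by intro i; simp [hN, hK]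
  have hNcol : ∀ j, ∑ i, N i j = 0 := by intro j; simp [hN, hK]
  set s : ι → ℝ := fun i => ∑ j, N i j * γ j with hs
  have hs0 : ∑ i, s i = 0 := by
    simp only [hs]; rw [Finset.sum_comm]
    simp only [← Finset.sum_mul, hNcol]; simp
  -- Signed weights of total mass 0 and Y-mean 1: they move the conditional mean of Y without
  -- changing the probabilities of the cells of (Z, W, X).
  set u : H → ℝ := fun h =>
    ((if h = h₁ then 1 else 0) - (if h = h₂ then 1 else 0)) / (y h₁ - y h₂) with hu
  have hyne : y h₁ - y h₂ ≠ 0 := sub_ne_zero.2 hy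
  have hu0 : ∑ h, u h = 0 := by
    simp only [hu]; rw [← Finset.sum_div]; simp
  have huy : ∑ h, u h * y h = 1 := by
    have : ∀ h, u h * y h = ((if h = h₁ then y h else 0) - (if h = h₂ then y h else 0))
        / (y h₁ - y h₂) := by
      intro h; simp only [hu]; split_ifs <;> ring
    simp only [this]; rw [← Finset.sum_div]; simp [hyne]
  set e : L → ℝ := fun l => if l = l₀ then 1 else 0 with he
  set yb : L → ℝ := fun l => ∑ h, a h l * y h with hyb
  -- The shift c γ changes the left side of the equation, at the cell l₀ of X, by ε c N γ = ε c s.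
  -- The u-term changes the right side by ε c s as well, because d sums to 1. So `g c`, which does
  -- not involve ε, solves the system exactly for every ε.
  let π : ℝ → ℝ → H → ι → ι → L → ℝ := fun ε c h i j l =>
    w l * a h l * b i l * d j l + ε * (a h l * N i j + c * e l * u h * s i * d j l)
  let g : ℝ → ι → L → ℝ := fun c j l => yb l + c * e l * γ j
  have hπcont : ∀ h i j l, Continuous fun p : ℝ × ℝ => π p.1 p.2 h i j l := by
    intro h i j l; simp only [π]; fun_prop
  let F : ℝ → ℝ → ℝ := fun ε c => ∑ j, ∑ l, T j l (π ε c) * g c j l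
  have hF : Continuous fun p : ℝ × ℝ => F p.1 p.2 := by
    refine continuous_finsetSum _ fun j _ => continuous_finsetSum _ fun l _ => ?_
    refine Continuous.mul ((hT j l).comp ?_) (by simp only [g]; fun_prop)
    refine continuous_pi fun h => continuous_pi fun i => continuous_pi fun j => continuous_pi fun l => ?_
    exact hπcont h i j l
  set p₀ : H → ι → ι → L → ℝ := fun h i j l => w l * a h l * b i l * d j l with hp₀
  have hπ0 : ∀ c, π 0 c = p₀ := by intro c; funext h i j l; simp [π, hp₀]
  have hF0 : ∀ c, F 0 c = (∑ j, ∑ l, T j l p₀ * yb l) + c * (w l₀ * ∑ j, t j * d j l₀ * γ j) := by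
    intro c
    simp only [F, hπ0, g]
    have : ∀ j, ∑ l, T j l p₀ * (yb l + c * e l * γ j)
        = ∑ l, T j l p₀ * yb l + c * (w l₀ * (t j * d j l₀ * γ j)) := by
      intro j
      have h' : ∀ l, T j l p₀ * (yb l + c * e l * γ j)
          = T j l p₀ * yb l + (if l = l₀ then c * (T j l p₀ * γ j) else 0) := by
        intro l; simp only [he]; split_ifs <;> ring
      simp only [h', Finset.sum_add_distrib, Finset.sum_ite_eq', Finset.mem_univ, if_true]
      rw [hTt]; ring
    simp only [this, Finset.sum_add_distrib, ← Finset.mul_sum]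
  have hD : 0 < w l₀ * ∑ j, t j * d j l₀ * γ j :=
    mul_pos (hw l₀) (sum_mul_sq_sub_mean_pos (fun j => hd j l₀) (hd1 l₀) ht)
  have hp₀pos : ∀ h i j l, 0 < p₀ h i j l := fun h i j l =>
    mul_pos (mul_pos (mul_pos (hw l) (ha h l)) (hb i l)) (hd j l)
  obtain ⟨ε, c, hε, hFθ, hQ⟩ := exists_pos_eq_of_affine_at_zero hF hD hF0 θ
    (Q := fun ε c => ∀ h i j l, 0 < π ε c h i j l ∧ |π ε c h i j l - p₀ h i j l| < δ) (by
      intro c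
      refine eventually_all.2 fun h => eventually_all.2 fun i => eventually_all.2 fun j =>
        eventually_all.2 fun l => ?_
      have hc := (hπcont h i j l).continuousAt (x := ((0 : ℝ), c))
      refine (continuousAt_const.eventually_lt hc ?_).and
        ((hc.sub continuousAt_const).abs.eventually_lt continuousAt_const ?_)
      · simp only [hπ0]; exact hp₀pos h i j l
      · change |π 0 c h i j l - p₀ h i j l| < δ
        rw [hπ0, sub_self, abs_zero]; exact hδ)
  have hsumh : ∀ i j l, ∑ h, π ε c h i j l = w l * b i l * d j l + ε * N i j := by
    intro i j l
    have : ∀ h, π ε c h i j l = (w l * b i l * d j l + ε * N i j) * a h l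
        + ε * c * e l * s i * d j l * u h := by intro h; simp only [π]; ring
    simp only [this, Finset.sum_add_distrib, ← Finset.mul_sum, ha1, hu0]
    ring
  have hsumhy : ∀ i j l, ∑ h, π ε c h i j l * y h
      = (w l * b i l * d j l + ε * N i j) * yb l + ε * c * e l * s i * d j l := by
    intro i j l
    have : ∀ h, π ε c h i j l * y h = (w l * b i l * d j l + ε * N i j) * (a h l * y h)
        + ε * c * e l * s i * d j l * (u h * y h) := by intro h; simp only [π]; ring
    simp only [this, Finset.sum_add_distrib, ← Finset.mul_sum, huy]
    simp [hyb]
  refine ⟨π ε c, g c, fun h i j l => (hQ h i j l).1, ?_, fun h i j l => (hQ h i j l).2.le, ?_, ?_,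
    hFθ⟩
  · have h1 : ∀ i j, ∑ h, ∑ l, π ε c h i j l
        = ∑ l, (w l * b i l * d j l + ε * N i j) := by
      intro i j; rw [Finset.sum_comm]; exact Finset.sum_congr rfl fun l _ => hsumh i j l
    have h2 : ∑ h, ∑ i, ∑ j, ∑ l, π ε c h i j l
        = ∑ i, ∑ j, ∑ l, (w l * b i l * d j l + ε * N i j) := by
      rw [Finset.sum_comm]
      refine Finset.sum_congr rfl fun i _ => ?_
      rw [Finset.sum_comm]
      exact Finset.sum_congr rfl fun j _ => h1 i j
    rw [h2]
    have h3 : ∀ i, ∑ j, ∑ l, (w l * b i l * d j l + ε * N i j) = ∑ l, w l * b i l := by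
      intro i
      rw [Finset.sum_comm]
      refine Finset.sum_congr rfl fun l _ => ?_
      rw [Finset.sum_add_distrib, ← Finset.mul_sum, ← Finset.mul_sum, hd1, hNrow]; ring
    simp only [h3]
    rw [Finset.sum_comm]
    simp only [← Finset.mul_sum, hb1, mul_one, hw1]
  · intro i l
    rw [Finset.sum_comm, Finset.sum_comm (f := fun h j => π ε c h i j l * y h)]
    simp only [← Finset.sum_mul, hsumh, hsumhy, g]
    have : ∀ j, (w l * b i l * d j l + ε * N i j) * (yb l + c * e l * γ j)
        = (w l * b i l * d j l + ε * N i j) * yb l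
          + (w l * b i l * c * (e l * (d j l * γ j)) + ε * c * e l * (N i j * γ j)) := by
      intro j; ring
    simp only [this, Finset.sum_add_distrib, ← Finset.mul_sum, hd1]
    have h0 : e l * ∑ j, d j l * γ j = 0 := by
      by_cases hl : l = l₀
      · subst hl; rw [hdγ, mul_zero]
      · simp [he, hl]
    rw [h0]
    simp only [hs]
    ring
  -- After Y is summed out, the system splits over l into the invertible matrices w b dᵀ + ε N.
  · intro τ
    have := fun l => exists_solution_rankOne_add_smul (ι := ι) (hw l).ne' hε.ne' (hb1 l) (hd1 l)
      (fun j => τ j l)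
    choose x hx using this
    refine ⟨fun i l => x l i, fun j l => ?_⟩
    rw [Finset.sum_comm, ← hx l j]
    refine Finset.sum_congr rfl fun i _ => ?_
    rw [← Finset.sum_mul, hsumh]

/-! ### The Riesz representer and the value of the parameter -/

namespace IntegralEq

variable {dz dw dx : ℕ}

lemma measurable_pY : Measurable (pY : Obs dz dw dx → ℝ) := by unfold pY; fun_prop
lemma measurable_pZ : Measurable (pZ : Obs dz dw dx → Vec dz) := by unfold pZ; fun_prop
lemma measurable_pW : Measurable (pW : Obs dz dw dx → Vec dw) := by unfold pW; fun_prop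
lemma measurable_pWX : Measurable (pWX : Obs dz dw dx → Vec dw × Vec dx) :=
  measurable_pW.prodMk measurable_pX
lemma measurable_pZX : Measurable (pZX : Obs dz dw dx → Vec dz × Vec dx) :=
  measurable_pZ.prodMk measurable_pX
lemma measurable_pYW : Measurable (pYW : Obs dz dw dx → ℝ × Vec dw) :=
  measurable_pY.prodMk measurable_pW

section Functional

variable {m : Obs dz dw dx → (Vec dw × Vec dx → ℝ) → ℝ} {P : ProbabilityMeasure (Obs dz dw dx)}

lemma IsL2WX.memLp_comp {g : Vec dw × Vec dx → ℝ} (hg : IsL2WX P g) :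
    MemLp (fun o => g (pWX o)) 2 (P : Measure (Obs dz dw dx)) :=
  hg.2.comp_of_map measurable_pWX.aemeasurable

lemma IsL2ZX.memLp_comp {g : Vec dz × Vec dx → ℝ} (hg : IsL2ZX P g) :
    MemLp (fun o => g (pZX o)) 2 (P : Measure (Obs dz dw dx)) :=
  hg.2.comp_of_map measurable_pZX.aemeasurable

/-- The Riesz representer exists. -/
theorem IsContinuousFunctional.exists_representer (h : IsContinuousFunctional m P) :
    ∃ a, IsRieszRepresenter m P a := by
  obtain ⟨L, hL⟩ := h
  set u := (InnerProductSpace.toDual ℝ _).symm L with hu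
  obtain ⟨a, ham, hae⟩ := (Lp.stronglyMeasurable u).aestronglyMeasurable (μ :=
    (P : Measure (Obs dz dw dx)).map pWX)
  have ha : IsL2WX P a := ⟨ham.measurable, (memLp_congr_ae hae).1 (Lp.memLp u)⟩
  refine ⟨a, ha, fun g hg => ?_⟩
  have hLu : L (hg.2.toLp g) = inner ℝ u (hg.2.toLp g) := by
    rw [hu, InnerProductSpace.toDual_symm_apply]
  rw [(hL g hg).2, hLu, L2.inner_def]
  have : ∫ o, a (pWX o) * g (pWX o) ∂(P : Measure (Obs dz dw dx))
      = ∫ p, a p * g p ∂((P : Measure (Obs dz dw dx)).map pWX) :=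
    (integral_map measurable_pWX.aemeasurable
      ((ham.measurable.mul hg.1).aestronglyMeasurable)).symm
  rw [this]
  refine integral_congr_ae ?_
  filter_upwards [hae, hg.2.coeFn_toLp] with p h1 h2
  rw [h1, h2]
  simp [mul_comm]

theorem IsRieszRepresenter.congr {a a' : Vec dw × Vec dx → ℝ} (h : IsRieszRepresenter m P a)
    (ha' : Measurable a')
    (hae : (fun o => a (pWX o)) =ᵐ[(P : Measure (Obs dz dw dx))] fun o => a' (pWX o)) :
    IsRieszRepresenter m P a' := by
  have hae' : a =ᵐ[(P : Measure (Obs dz dw dx)).map pWX] a' :=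
    (ae_map_iff measurable_pWX.aemeasurable (measurableSet_eq_fun h.1.1 ha')).2 hae
  refine ⟨⟨ha', (memLp_congr_ae hae').1 h.1.2⟩, fun g hg => ?_⟩
  rw [h.2 g hg]
  refine integral_congr_ae ?_
  filter_upwards [hae] with o ho
  rw [ho]

lemma stronglyMeasurable_comp_pWX {g : Vec dw × Vec dx → ℝ} (hg : Measurable g) :
    StronglyMeasurable[sigmaWX dz dw dx] fun o : Obs dz dw dx => g (pWX o) :=
  (hg.comp (comap_measurable pWX)).stronglyMeasurable

lemma stronglyMeasurable_comp_pZX {g : Vec dz × Vec dx → ℝ} (hg : Measurable g) :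
    StronglyMeasurable[sigmaZX dz dw dx] fun o : Obs dz dw dx => g (pZX o) :=
  (hg.comp (comap_measurable pZX)).stronglyMeasurable

lemma sigmaWX_le : sigmaWX dz dw dx ≤ (inferInstance : MeasurableSpace (Obs dz dw dx)) :=
  measurable_pWX.comap_le

lemma sigmaZX_le : sigmaZX dz dw dx ≤ (inferInstance : MeasurableSpace (Obs dz dw dx)) :=
  measurable_pZX.comap_le

/-- The factor that is measurable for the smaller σ-algebra can be pulled into the conditional
expectation, which then disappears under the integral. -/
theorem integral_condExp_mul {Ω : Type*} {m₀ : MeasurableSpace Ω} {μ : Measure Ω}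
    [IsFiniteMeasure μ] {m' : MeasurableSpace Ω} (hm : m' ≤ m₀) {f g : Ω → ℝ}
    (hf : MemLp f 2 μ) (hg : MemLp g 2 μ) (hgm : StronglyMeasurable[m'] g) :
    ∫ o, (μ[f | m']) o * g o ∂μ = ∫ o, f o * g o ∂μ := by
  have hfg : Integrable (f * g) μ := hf.integrable_mul hg
  have h := condExp_mul_of_stronglyMeasurable_right hgm hfg (hf.integrable (by norm_num))
  have h2 : ∫ o, (μ[f * g | m']) o ∂μ = ∫ o, (f * g) o ∂μ := integral_condExp hm
  rw [integral_congr_ae h] at h2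
  exact h2

/-- The value of the parameter does not depend on the solution of the integral equation. -/
theorem phi_eq_integral (hrange : RepresenterInRange m P)
    {g : Vec dw × Vec dx → ℝ} (hg : IsSolution P g) :
    phi m P = ∫ o, m o g ∂(P : Measure (Obs dz dw dx)) := by
  obtain ⟨a, ha, h, hh, hha⟩ := hrange
  -- E(α g) = E(E(h | W, X) g) = E(h g) = E(h E(g | Z, X)) = E(h E(Y | Z, X)), and the last
  -- expression no longer contains g.
  have key : ∀ g : Vec dw × Vec dx → ℝ, IsSolution P g →
      ∫ o, m o g ∂(P : Measure (Obs dz dw dx))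
        = ∫ o, ((P : Measure (Obs dz dw dx))[pY | sigmaZX dz dw dx]) o * h (pZX o)
          ∂(P : Measure (Obs dz dw dx)) := by
    intro g hg
    rw [ha.2 g hg.1]
    have e1 := integral_condExp_mul (μ := (P : Measure (Obs dz dw dx))) sigmaWX_le hh.memLp_comp
      hg.1.memLp_comp (stronglyMeasurable_comp_pWX hg.1.1)
    have e2 := integral_condExp_mul (μ := (P : Measure (Obs dz dw dx))) sigmaZX_le
      hg.1.memLp_comp hh.memLp_comp (stronglyMeasurable_comp_pZX hh.1)
    calc ∫ o, a (pWX o) * g (pWX o) ∂(P : Measure (Obs dz dw dx))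
        = ∫ o, ((P : Measure (Obs dz dw dx))[fun o => h (pZX o) | sigmaWX dz dw dx]) o
            * g (pWX o) ∂(P : Measure (Obs dz dw dx)) := by
          refine integral_congr_ae ?_
          filter_upwards [hha] with o ho
          rw [ho]
      _ = ∫ o, g (pWX o) * h (pZX o) ∂(P : Measure (Obs dz dw dx)) := by
          rw [e1]; simp only [mul_comm]
      _ = _ := by
          rw [← e2]
          refine integral_congr_ae ?_
          filter_upwards [hg.2] with o ho
          rw [ho]
  have hex : ∃ g : Vec dw × Vec dx → ℝ, IsSolution P g := ⟨g, hg⟩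
  rw [phi, dif_pos hex, key _ hex.choose_spec, key g hg]

end Functional

/-- Two integrable functions with the same integrals over the sets of a σ-algebra have the same
conditional expectation. -/
theorem condExp_ae_eq_of_setIntegral_eq {Ω : Type*} {m₀ : MeasurableSpace Ω} {μ : Measure Ω}
    [IsFiniteMeasure μ] {m' : MeasurableSpace Ω} (hm : m' ≤ m₀) {f g : Ω → ℝ}
    (hf : Integrable f μ) (hg : Integrable g μ)
    (h : ∀ s, MeasurableSet[m'] s → ∫ x in s, f x ∂μ = ∫ x in s, g x ∂μ) :
    μ[f | m'] =ᵐ[μ] μ[g | m'] := by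
  refine ae_eq_condExp_of_forall_setIntegral_eq hm hg
    (fun s _ _ => integrable_condExp.integrableOn) (fun s hs _ => ?_)
    stronglyMeasurable_condExp.aestronglyMeasurable
  rw [setIntegral_condExp hm hf hs, h s hs]

end IntegralEq

/-! ### Step functions and laws that are uniform on cells -/

/-- The step function with value `f j l` on `s j ×ˢ t l`. -/
noncomputable def stepFun {V X ι κ : Type*} [Fintype ι] [Fintype κ] (s : ι → Set V) (t : κ → Set X)
    (f : ι → κ → ℝ) (p : V × X) : ℝ :=
  ∑ j, ∑ l, (s j ×ˢ t l).indicator (fun _ => f j l) p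

section StepFun

variable {V X ι κ : Type*} [Fintype ι] [Fintype κ] {s : ι → Set V} {t : κ → Set X} {f : ι → κ → ℝ}

theorem stepFun_of_mem (hs : Pairwise fun i j => Disjoint (s i) (s j))
    (ht : Pairwise fun i j => Disjoint (t i) (t j)) {p : V × X} {j : ι} {l : κ}
    (hj : p.1 ∈ s j) (hl : p.2 ∈ t l) : stepFun s t f p = f j l := by
  classical
  rw [stepFun, Finset.sum_eq_single j, Finset.sum_eq_single l]
  · rw [Set.indicator_of_mem (Set.mk_mem_prod hj hl)]
  · intro l' _ hl'
    exact Set.indicator_of_notMem (fun h => (ht hl').le_bot ⟨h.2, hl⟩) _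
  · simp
  · intro j' _ hj'
    exact Finset.sum_eq_zero fun l' _ =>
      Set.indicator_of_notMem (fun h => (hs hj').le_bot ⟨h.1, hj⟩) _
  · simp

theorem stepFun_of_forall_notMem_left {p : V × X} (h : ∀ j, p.1 ∉ s j) : stepFun s t f p = 0 :=
  Finset.sum_eq_zero fun j _ => Finset.sum_eq_zero fun _ _ =>
    Set.indicator_of_notMem (fun hp => h j hp.1) _

theorem stepFun_of_forall_notMem_right {p : V × X} (h : ∀ l, p.2 ∉ t l) : stepFun s t f p = 0 :=
  Finset.sum_eq_zero fun _ _ => Finset.sum_eq_zero fun l _ =>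
    Set.indicator_of_notMem (fun hp => h l hp.2) _

theorem measurable_stepFun [MeasurableSpace V] [MeasurableSpace X] (hs : ∀ j, MeasurableSet (s j))
    (ht : ∀ l, MeasurableSet (t l)) : Measurable (stepFun s t f) :=
  Finset.measurable_fun_sum _ fun j _ => Finset.measurable_fun_sum _ fun l _ =>
    measurable_const.indicator ((hs j).prod (ht l))

theorem abs_stepFun_le (p : V × X) : |stepFun s t f p| ≤ ∑ j, ∑ l, |f j l| := by
  refine (Finset.abs_sum_le_sum_abs _ _).trans (Finset.sum_le_sum fun j _ => ?_)
  refine (Finset.abs_sum_le_sum_abs _ _).trans (Finset.sum_le_sum fun l _ => ?_)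
  by_cases h : p ∈ s j ×ˢ t l
  · rw [Set.indicator_of_mem h]
  · rw [Set.indicator_of_notMem h, abs_zero]; exact abs_nonneg _

theorem memLp_stepFun [MeasurableSpace V] [MeasurableSpace X] (hs : ∀ j, MeasurableSet (s j))
    (ht : ∀ l, MeasurableSet (t l)) {μ : Measure (V × X)} [IsFiniteMeasure μ] {p : ℝ≥0∞} :
    MemLp (stepFun s t f) p μ :=
  MemLp.of_bound (measurable_stepFun hs ht).aestronglyMeasurable _
    (Eventually.of_forall fun x => abs_stepFun_le x)

end StepFun

/-- The normalizing constants multiply. Iterated over the four factors, this exhibits each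
`Cells.part` as the dominating measure conditioned on one cell. -/
theorem prod_cond {V X : Type*} [MeasurableSpace V] [MeasurableSpace X] (μ : Measure V)
    (ν : Measure X) [SigmaFinite μ] [SigmaFinite ν] {s : Set V} {t : Set X}
    (hs0 : μ s ≠ 0) (hst : μ s ≠ ∞) :
    (μ[|s]).prod (ν[|t]) = (μ.prod ν)[|s ×ˢ t] := by
  simp only [ProbabilityTheory.cond]
  rw [Measure.prod_smul_left, Measure.prod_smul_right, Measure.prod_restrict, smul_smul,
    Measure.prod_prod, ENNReal.mul_inv (Or.inl hs0) (Or.inl hst)]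

namespace IntegralEq

variable {dz dw dx : ℕ}

/-- Support families for the four variables, with equally many sets for `Z` and for `W`. -/
structure Cells (B : BaseMeasures dz dw dx) where
  /-- the number of sets for `Y` -/
  kY : ℕ
  /-- the number of sets for `Z` and for `W` -/
  K : ℕ
  /-- the number of sets for `X` -/
  kX : ℕ
  /-- the sets for `Y` -/
  sY : Fin kY → Set ℝ
  /-- the sets for `Z` -/
  sZ : Fin K → Set (Vec dz)
  /-- the sets for `W` -/
  sW : Fin K → Set (Vec dw)
  /-- the sets for `X` -/
  sX : Fin kX → Set (Vec dx)
  hY : IsSupportFamily B.muY sY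
  hZ : IsSupportFamily B.muZ sZ
  hW : IsSupportFamily B.muW sW
  hX : IsSupportFamily B.muX sX
  integrable_id : ∀ h, Integrable id (B.muY[|sY h])

namespace Cells

variable {B : BaseMeasures dz dw dx} (E : Cells B)

/-- Indices of cells. -/
abbrev Idx : Type := Fin E.kY × Fin E.K × Fin E.K × Fin E.kX

/-- The cell with a given index. -/
def cell (c : E.Idx) : Set (Obs dz dw dx) :=
  E.sY c.1 ×ˢ (E.sZ c.2.1 ×ˢ (E.sW c.2.2.1 ×ˢ E.sX c.2.2.2))

/-- The normalized restriction of the dominating measure to a cell. -/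
noncomputable def part (c : E.Idx) : Measure (Obs dz dw dx) :=
  (B.muY[|E.sY c.1]).prod ((B.muZ[|E.sZ c.2.1]).prod ((B.muW[|E.sW c.2.2.1]).prod
    (B.muX[|E.sX c.2.2.2])))

/-- The measure that gives the cell with index `(h, i, j, l)` the mass `π h i j l`, spread
proportionally to the dominating measure. -/
noncomputable def mix (π : Fin E.kY → Fin E.K → Fin E.K → Fin E.kX → ℝ) :
    Measure (Obs dz dw dx) :=
  ∑ c : E.Idx, ENNReal.ofReal (π c.1 c.2.1 c.2.2.1 c.2.2.2) • E.part c

/-- The mean of `Y` over each of its cells. -/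
noncomputable def meanY (h : Fin E.kY) : ℝ := ∫ y, y ∂(B.muY[|E.sY h])

instance isProbabilityMeasure_condY (h) : IsProbabilityMeasure (B.muY[|E.sY h]) :=
  cond_isProbabilityMeasure_of_finite (E.hY.pos h).ne' (E.hY.lt_top h).ne

instance isProbabilityMeasure_condZ (h) : IsProbabilityMeasure (B.muZ[|E.sZ h]) :=
  cond_isProbabilityMeasure_of_finite (E.hZ.pos h).ne' (E.hZ.lt_top h).ne

instance isProbabilityMeasure_condW (h) : IsProbabilityMeasure (B.muW[|E.sW h]) :=
  cond_isProbabilityMeasure_of_finite (E.hW.pos h).ne' (E.hW.lt_top h).ne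

instance isProbabilityMeasure_condX (h) : IsProbabilityMeasure (B.muX[|E.sX h]) :=
  cond_isProbabilityMeasure_of_finite (E.hX.pos h).ne' (E.hX.lt_top h).ne

instance isProbabilityMeasure_part (c : E.Idx) : IsProbabilityMeasure (E.part c) := by
  unfold part; infer_instance

theorem measurableSet_cell (c : E.Idx) : MeasurableSet (E.cell c) :=
  (E.hY.measurableSet _).prod ((E.hZ.measurableSet _).prod
    ((E.hW.measurableSet _).prod (E.hX.measurableSet _)))

theorem map_pWX_part (c : E.Idx) :
    (E.part c).map pWX = (B.muW[|E.sW c.2.2.1]).prod (B.muX[|E.sX c.2.2.2]) := by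
  have : MeasurePreserving (pWX : Obs dz dw dx → _) (E.part c)
      ((B.muW[|E.sW c.2.2.1]).prod (B.muX[|E.sX c.2.2.2])) :=
    (measurePreserving_snd (μ := B.muZ[|E.sZ c.2.1])).comp
      (measurePreserving_snd (μ := B.muY[|E.sY c.1]))
  exact this.map_eq

theorem measurePreserving_zx (c : E.Idx) :
    MeasurePreserving (fun q : Vec dz × Vec dw × Vec dx => (q.1, q.2.2))
      ((B.muZ[|E.sZ c.2.1]).prod ((B.muW[|E.sW c.2.2.1]).prod (B.muX[|E.sX c.2.2.2])))
      ((B.muZ[|E.sZ c.2.1]).prod (B.muX[|E.sX c.2.2.2])) :=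
  (MeasurePreserving.id _).prod (measurePreserving_snd (μ := B.muW[|E.sW c.2.2.1]))

theorem map_pZX_part (c : E.Idx) :
    (E.part c).map pZX = (B.muZ[|E.sZ c.2.1]).prod (B.muX[|E.sX c.2.2.2]) := by
  have : MeasurePreserving (pZX : Obs dz dw dx → _) (E.part c)
      ((B.muZ[|E.sZ c.2.1]).prod (B.muX[|E.sX c.2.2.2])) :=
    (E.measurePreserving_zx c).comp (measurePreserving_snd (μ := B.muY[|E.sY c.1]))
  exact this.map_eq

theorem integrable_pY_part (c : E.Idx) : Integrable pY (E.part c) :=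
  (E.integrable_id c.1).comp_fst _

/-- A part is a product measure, so Y is independent of (Z, X) under it and enters only through its
mean over the cell. -/
theorem setIntegral_pY_part (c : E.Idx) {A : Set (Vec dz × Vec dx)} (hA : MeasurableSet A) :
    ∫ o in pZX ⁻¹' A, pY o ∂(E.part c)
      = E.meanY c.1 * ((B.muZ[|E.sZ c.2.1]).prod (B.muX[|E.sX c.2.2.2])).real A := by
  rw [← integral_indicator (measurable_pZX hA)]
  have h1 : ∀ o : Obs dz dw dx, (pZX ⁻¹' A).indicator pY o
      = o.1 * (A.indicator (fun _ => (1 : ℝ)) (o.2.1, o.2.2.2)) := by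
    intro o
    by_cases h : (o.2.1, o.2.2.2) ∈ A
    · rw [Set.indicator_of_mem h, Set.indicator_of_mem (show o ∈ pZX ⁻¹' A from h)]; simp [pY]
    · rw [Set.indicator_of_notMem h, Set.indicator_of_notMem (show o ∉ pZX ⁻¹' A from h)]; simp
  simp only [h1]
  unfold part
  rw [integral_prod_mul (fun y : ℝ => y)
    (fun q : Vec dz × Vec dw × Vec dx => A.indicator (fun _ => (1 : ℝ)) (q.1, q.2.2))]
  congr 1
  rw [← (E.measurePreserving_zx c).map_eq, ← integral_indicator_one hA, integral_map]
  · rfl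
  · exact (E.measurePreserving_zx c).measurable.aemeasurable
  · exact (measurable_one.indicator hA).aestronglyMeasurable

variable {π : Fin E.kY → Fin E.K → Fin E.K → Fin E.kX → ℝ}

/-- The density of `E.mix π`. -/
noncomputable def mixDensity (π : Fin E.kY → Fin E.K → Fin E.K → Fin E.kX → ℝ)
    (o : Obs dz dw dx) : ℝ :=
  ∑ h, ∑ i, ∑ j, ∑ l, (E.sY h ×ˢ (E.sZ i ×ˢ (E.sW j ×ˢ E.sX l))).indicator
    (fun _ => π h i j l / (B.mu (E.cell (h, i, j, l))).toReal) o

theorem mixDensity_eq (o : Obs dz dw dx) : E.mixDensity π o =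
    ∑ c : E.Idx, (E.cell c).indicator
      (fun _ => π c.1 c.2.1 c.2.2.1 c.2.2.2 / (B.mu (E.cell c)).toReal) o := by
  simp only [Fintype.sum_prod_type]; rfl

theorem measurable_mixDensity : Measurable (E.mixDensity π) := by
  simp only [funext E.mixDensity_eq]
  exact Finset.measurable_fun_sum _ fun c _ => measurable_const.indicator (E.measurableSet_cell c)

theorem isProbabilityMeasure_mix (hπ : ∀ h i j l, 0 < π h i j l)
    (hsum : ∑ h, ∑ i, ∑ j, ∑ l, π h i j l = 1) : IsProbabilityMeasure (E.mix π) := by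
  constructor
  rw [mix, Measure.finsetSum_apply]
  simp only [Measure.smul_apply, measure_univ, smul_eq_mul, mul_one]
  rw [← ENNReal.ofReal_sum_of_nonneg fun c _ => (hπ _ _ _ _).le]
  simp only [Fintype.sum_prod_type]
  rw [hsum, ENNReal.ofReal_one]

theorem integrable_mix {f : Obs dz dw dx → ℝ} (hf : ∀ c, Integrable f (E.part c)) :
    Integrable f (E.mix π) :=
  integrable_finsetSum_measure.2 fun c _ => (hf c).smul_measure ENNReal.ofReal_ne_top

theorem integrable_part (hπ : ∀ h i j l, 0 < π h i j l) {f : Obs dz dw dx → ℝ}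
    (hf : Integrable f (E.mix π)) (c : E.Idx) : Integrable f (E.part c) :=
  (integrable_smul_measure (ENNReal.ofReal_pos.2 (hπ _ _ _ _)).ne' ENNReal.ofReal_ne_top).1
    (integrable_finsetSum_measure.1 hf c (Finset.mem_univ c))

theorem integral_mix (hπ : ∀ h i j l, 0 < π h i j l) {f : Obs dz dw dx → ℝ}
    (hf : ∀ c, Integrable f (E.part c)) :
    ∫ o, f o ∂(E.mix π) = ∑ h, ∑ i, ∑ j, ∑ l, π h i j l * ∫ o, f o ∂(E.part (h, i, j, l)) := by
  rw [mix, integral_finsetSum_measure fun c _ => (hf c).smul_measure ENNReal.ofReal_ne_top]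
  simp only [integral_smul_measure, ENNReal.toReal_ofReal (hπ _ _ _ _).le, smul_eq_mul,
    Fintype.sum_prod_type]

theorem setIntegral_mix (hπ : ∀ h i j l, 0 < π h i j l) {f : Obs dz dw dx → ℝ}
    (hf : ∀ c, Integrable f (E.part c)) {s : Set (Obs dz dw dx)} (hs : MeasurableSet s) :
    ∫ o in s, f o ∂(E.mix π)
      = ∑ h, ∑ i, ∑ j, ∑ l, π h i j l * ∫ o in s, f o ∂(E.part (h, i, j, l)) := by
  rw [← integral_indicator hs, E.integral_mix hπ fun c => (hf c).indicator hs]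
  simp only [integral_indicator hs]

theorem ae_mix {p : Obs dz dw dx → Prop} (hp : ∀ c, ∀ᵐ o ∂(E.part c), p o) :
    ∀ᵐ o ∂(E.mix π), p o :=
  ae_finsetSum_measure_iff.2 fun c _ => Measure.ae_smul_measure (hp c) _

theorem mu_cell [SigmaFinite B.muZ] [SigmaFinite B.muW] [SigmaFinite B.muX] (c : E.Idx) :
    B.mu (E.cell c) = B.muY (E.sY c.1) * (B.muZ (E.sZ c.2.1) *
    (B.muW (E.sW c.2.2.1) * B.muX (E.sX c.2.2.2))) := by
  simp only [cell, BaseMeasures.mu, Measure.prod_prod]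

variable [SigmaFinite B.muY] [SigmaFinite B.muZ] [SigmaFinite B.muW] [SigmaFinite B.muX]

theorem part_eq_cond (c : E.Idx) : E.part c = B.mu[|E.cell c] := by
  have hWX := prod_cond B.muW B.muX (s := E.sW c.2.2.1) (t := E.sX c.2.2.2)
    (E.hW.pos _).ne' (E.hW.lt_top _).ne
  have hZWX := prod_cond B.muZ (B.muW.prod B.muX) (s := E.sZ c.2.1)
    (t := E.sW c.2.2.1 ×ˢ E.sX c.2.2.2) (E.hZ.pos _).ne' (E.hZ.lt_top _).ne
  have h := prod_cond B.muY (B.muZ.prod (B.muW.prod B.muX)) (s := E.sY c.1)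
    (t := E.sZ c.2.1 ×ˢ (E.sW c.2.2.1 ×ˢ E.sX c.2.2.2)) (E.hY.pos _).ne' (E.hY.lt_top _).ne
  unfold part cell BaseMeasures.mu
  rw [hWX, hZWX, h]

theorem ae_part_mem_cell (c : E.Idx) : ∀ᵐ o ∂(E.part c), o ∈ E.cell c := by
  rw [E.part_eq_cond]; exact ae_cond_mem (E.measurableSet_cell c)

theorem mu_cell_pos (c : E.Idx) : 0 < B.mu (E.cell c) := by
  rw [E.mu_cell]
  exact ENNReal.mul_pos (E.hY.pos _).ne' (mul_ne_zero (E.hZ.pos _).ne'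
    (mul_ne_zero (E.hW.pos _).ne' (E.hX.pos _).ne'))

theorem mu_cell_lt_top (c : E.Idx) : B.mu (E.cell c) < ∞ := by
  rw [E.mu_cell]
  exact ENNReal.mul_lt_top (E.hY.lt_top _) (ENNReal.mul_lt_top (E.hZ.lt_top _)
    (ENNReal.mul_lt_top (E.hW.lt_top _) (E.hX.lt_top _)))

/-- Each part has the constant density 1 / μ(cell) on its cell, so a mixture of parts has exactly a
rectangular simple density as in (A). -/
theorem mix_eq_withDensity (hπ : ∀ h i j l, 0 < π h i j l) :
    E.mix π = B.mu.withDensity fun o => ENNReal.ofReal (E.mixDensity π o) := by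
  ext s hs
  rw [withDensity_apply _ hs, mix, Measure.finsetSum_apply]
  have h1 : ∀ o, ENNReal.ofReal (E.mixDensity π o) = ∑ c : E.Idx, (E.cell c).indicator
      (fun _ => ENNReal.ofReal (π c.1 c.2.1 c.2.2.1 c.2.2.2 / (B.mu (E.cell c)).toReal)) o := by
    intro o
    rw [E.mixDensity_eq, ENNReal.ofReal_sum_of_nonneg]
    · refine Finset.sum_congr rfl fun c _ => ?_
      by_cases h : o ∈ E.cell c
      · rw [Set.indicator_of_mem h, Set.indicator_of_mem h]
      · rw [Set.indicator_of_notMem h, Set.indicator_of_notMem h, ENNReal.ofReal_zero]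
    · intro c _
      exact Set.indicator_nonneg (fun _ _ => div_nonneg (hπ _ _ _ _).le ENNReal.toReal_nonneg) _
  simp only [h1]
  rw [lintegral_finsetSum _ fun c _ => measurable_const.indicator (E.measurableSet_cell c)]
  refine Finset.sum_congr rfl fun c _ => ?_
  rw [lintegral_indicator (E.measurableSet_cell c), setLIntegral_const,
    Measure.restrict_apply (E.measurableSet_cell c), Measure.smul_apply, E.part_eq_cond,
    cond_apply (E.measurableSet_cell c), smul_eq_mul, ← mul_assoc,
    ENNReal.ofReal_div_of_pos (ENNReal.toReal_pos (E.mu_cell_pos c).ne' (E.mu_cell_lt_top c).ne),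
    ENNReal.ofReal_toReal (E.mu_cell_lt_top c).ne, div_eq_mul_inv]

theorem stepFun_pWX_ae (f : Fin E.K → Fin E.kX → ℝ) (c : E.Idx) :
    (fun o => stepFun E.sW E.sX f (pWX o)) =ᵐ[E.part c] fun _ => f c.2.2.1 c.2.2.2 := by
  filter_upwards [E.ae_part_mem_cell c] with o ho
  exact stepFun_of_mem E.hW.disjoint E.hX.disjoint ho.2.2.1 ho.2.2.2

theorem stepFun_pZX_ae (f : Fin E.K → Fin E.kX → ℝ) (c : E.Idx) :
    (fun o => stepFun E.sZ E.sX f (pZX o)) =ᵐ[E.part c] fun _ => f c.2.1 c.2.2.2 := by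
  filter_upwards [E.ae_part_mem_cell c] with o ho
  exact stepFun_of_mem E.hZ.disjoint E.hX.disjoint ho.2.1 ho.2.2.2

end Cells

end IntegralEq

/-! ### The conditions of the model for cell laws, as finite linear systems -/

theorem sum_comm_four_right {H I J L : Type*} [Fintype H] [Fintype I] [Fintype J] [Fintype L]
    (F : H → I → J → L → ℝ) :
    ∑ h, ∑ i, ∑ j, ∑ l, F h i j l = ∑ j, ∑ l, ∑ h, ∑ i, F h i j l := by
  have h1 : ∀ h, ∑ i, ∑ j, ∑ l, F h i j l = ∑ j, ∑ l, ∑ i, F h i j l := fun h => by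
    rw [Finset.sum_comm]
    exact Finset.sum_congr rfl fun j _ => Finset.sum_comm
  simp only [h1]
  rw [Finset.sum_comm]
  exact Finset.sum_congr rfl fun j _ => Finset.sum_comm

theorem sum_comm_four_mid {H I J L : Type*} [Fintype H] [Fintype I] [Fintype J] [Fintype L]
    (F : H → I → J → L → ℝ) :
    ∑ h, ∑ i, ∑ j, ∑ l, F h i j l = ∑ i, ∑ l, ∑ h, ∑ j, F h i j l := by
  have h1 : ∀ h i, ∑ j, ∑ l, F h i j l = ∑ l, ∑ j, F h i j l := fun h i => Finset.sum_comm
  simp only [h1]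
  rw [Finset.sum_comm]
  exact Finset.sum_congr rfl fun i _ => Finset.sum_comm

namespace IntegralEq

variable {dz dw dx : ℕ}

namespace Cells

variable {B : BaseMeasures dz dw dx} (E : Cells B)

/-- The indicator function of the set `S^W_j × S^X_l`. -/
noncomputable def unit (j : Fin E.K) (l : Fin E.kX) : Vec dw × Vec dx → ℝ :=
  stepFun E.sW E.sX fun j' l' => if j' = j ∧ l' = l then 1 else 0

/-- The value of the functional at the indicator function of `S^W_j × S^X_l`, as a function of the
cell probabilities. -/
noncomputable def moment (m : Obs dz dw dx → (Vec dw × Vec dx → ℝ) → ℝ) (j : Fin E.K)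
    (l : Fin E.kX) (π : Fin E.kY → Fin E.K → Fin E.K → Fin E.kX → ℝ) : ℝ :=
  ∑ h, ∑ i, ∑ j', ∑ l', π h i j' l' * ∫ o, m o (E.unit j l) ∂(E.part (h, i, j', l'))

theorem continuous_moment (m : Obs dz dw dx → (Vec dw × Vec dx → ℝ) → ℝ) (j : Fin E.K)
    (l : Fin E.kX) : Continuous (E.moment m j l) := by
  unfold moment; fun_prop

variable {m : Obs dz dw dx → (Vec dw × Vec dx → ℝ) → ℝ}
  {π : Fin E.kY → Fin E.K → Fin E.K → Fin E.kX → ℝ} {P : ProbabilityMeasure (Obs dz dw dx)}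

theorem isL2WX_stepFun (f : Fin E.K → Fin E.kX → ℝ) : IsL2WX P (stepFun E.sW E.sX f) :=
  ⟨measurable_stepFun E.hW.measurableSet E.hX.measurableSet,
    haveI := Measure.isProbabilityMeasure_map (μ := (P : Measure (Obs dz dw dx)))
      (measurable_pWX (dz := dz) (dw := dw) (dx := dx)).aemeasurable
    memLp_stepFun E.hW.measurableSet E.hX.measurableSet⟩

theorem isL2ZX_stepFun (f : Fin E.K → Fin E.kX → ℝ) : IsL2ZX P (stepFun E.sZ E.sX f) :=
  ⟨measurable_stepFun E.hZ.measurableSet E.hX.measurableSet,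
    haveI := Measure.isProbabilityMeasure_map (μ := (P : Measure (Obs dz dw dx)))
      (measurable_pZX (dz := dz) (dw := dw) (dx := dx)).aemeasurable
    memLp_stepFun E.hZ.measurableSet E.hX.measurableSet⟩

theorem setIntegral_part_of_ae_const {f : Obs dz dw dx → ℝ} {r : ℝ} {c : E.Idx}
    (hf : f =ᵐ[E.part c] fun _ => r) (s : Set (Obs dz dw dx)) :
    ∫ o in s, f o ∂(E.part c) = r * (E.part c).real s := by
  rw [integral_congr_ae (ae_restrict_of_ae hf), setIntegral_const, smul_eq_mul, mul_comm]

theorem real_part_pWX (c : E.Idx) {A : Set (Vec dw × Vec dx)} (hA : MeasurableSet A) :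
    (E.part c).real (pWX ⁻¹' A) = ((B.muW[|E.sW c.2.2.1]).prod (B.muX[|E.sX c.2.2.2])).real A := by
  rw [← E.map_pWX_part, map_measureReal_apply measurable_pWX hA]

theorem real_part_pZX (c : E.Idx) {A : Set (Vec dz × Vec dx)} (hA : MeasurableSet A) :
    (E.part c).real (pZX ⁻¹' A) = ((B.muZ[|E.sZ c.2.1]).prod (B.muX[|E.sX c.2.2.2])).real A := by
  rw [← E.map_pZX_part, map_measureReal_apply measurable_pZX hA]

variable [SigmaFinite B.muY] [SigmaFinite B.muZ] [SigmaFinite B.muW] [SigmaFinite B.muX]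

instance sigmaFinite_mu : SigmaFinite B.mu := by unfold BaseMeasures.mu; infer_instance

theorem dominated_mix (hπ : ∀ h i j l, 0 < π h i j l)
    (hP : (P : Measure (Obs dz dw dx)) = E.mix π) : Dominated B P := by
  rw [Dominated, hP, E.mix_eq_withDensity hπ]
  exact withDensity_absolutelyContinuous _ _

theorem density_mix (hπ : ∀ h i j l, 0 < π h i j l)
    (hP : (P : Measure (Obs dz dw dx)) = E.mix π) :
    density B P =ᵐ[B.mu] fun o => ENNReal.ofReal (E.mixDensity π o) := by
  rw [density, hP, E.mix_eq_withDensity hπ]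
  exact Measure.rnDeriv_withDensity _ E.measurable_mixDensity.ennreal_ofReal

theorem div_mu_cell_pos (hπ : ∀ h i j l, 0 < π h i j l) (h i j l) :
    0 < π h i j l / (B.mu (E.cell (h, i, j, l))).toReal :=
  div_pos (hπ h i j l) (ENNReal.toReal_pos (E.mu_cell_pos _).ne' (E.mu_cell_lt_top _).ne)

/-- Assumption (A) applies to the rectangular density with positive coefficients. It identifies a
representer only almost surely, so that representer is replaced by its step version. -/
theorem exists_step_representer (hm : SimpleRepresenterCondition B m)
    (hπ : ∀ h i j l, 0 < π h i j l) (hP : (P : Measure (Obs dz dw dx)) = E.mix π) :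
    IsContinuousFunctional m P ∧ ∃ t, IsRieszRepresenter m P (stepFun E.sW E.sX t) := by
  obtain ⟨h1, h2⟩ := hm P E.kY E.K E.K E.kX E.sY E.sZ E.sW E.sX
    (fun h i j l => π h i j l / (B.mu (E.cell (h, i, j, l))).toReal) (E.dominated_mix hπ hP)
    E.hY E.hZ E.hW E.hX (E.div_mu_cell_pos hπ) (E.density_mix hπ hP)
  obtain ⟨a, ha⟩ := h1.exists_representer
  obtain ⟨t, ht⟩ := h2 a ha
  exact ⟨h1, t, ha.congr (measurable_stepFun E.hW.measurableSet E.hX.measurableSet) ht⟩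

theorem integral_stepFun_mul_stepFun (hπ : ∀ h i j l, 0 < π h i j l)
    (hP : (P : Measure (Obs dz dw dx)) = E.mix π) (f g : Fin E.K → Fin E.kX → ℝ) :
    ∫ o, stepFun E.sW E.sX f (pWX o) * stepFun E.sW E.sX g (pWX o) ∂(P : Measure (Obs dz dw dx))
      = ∑ j, ∑ l, f j l * g j l * ∑ h, ∑ i, π h i j l := by
  have hae : ∀ c : E.Idx, (fun o => stepFun E.sW E.sX f (pWX o) * stepFun E.sW E.sX g (pWX o))
      =ᵐ[E.part c] fun _ => f c.2.2.1 c.2.2.2 * g c.2.2.1 c.2.2.2 := by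
    intro c
    filter_upwards [E.stepFun_pWX_ae f c, E.stepFun_pWX_ae g c] with o h1 h2
    rw [h1, h2]
  rw [hP, E.integral_mix hπ fun c => (integrable_const _).congr (hae c).symm]
  have : ∀ h i j l, ∫ o, stepFun E.sW E.sX f (pWX o) * stepFun E.sW E.sX g (pWX o)
      ∂(E.part (h, i, j, l)) = f j l * g j l := by
    intro h i j l
    rw [integral_congr_ae (hae (h, i, j, l))]
    simp
  simp only [this]
  rw [sum_comm_four_right]
  refine Finset.sum_congr rfl fun j _ => Finset.sum_congr rfl fun l _ => ?_
  simp only [← Finset.sum_mul]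
  ring

/-- Test the representer against the indicator of one (W, X) cell. The moments are linear in the
cell probabilities, whereas the values t are only known to exist for each law separately; this
identity lets the former stand in for the latter. -/
theorem moment_eq (hcont : IsContinuousFunctional m P) (hπ : ∀ h i j l, 0 < π h i j l)
    (hP : (P : Measure (Obs dz dw dx)) = E.mix π) {t : Fin E.K → Fin E.kX → ℝ}
    (ht : IsRieszRepresenter m P (stepFun E.sW E.sX t)) (j : Fin E.K) (l : Fin E.kX) :
    E.moment m j l π = t j l * ∑ h, ∑ i, π h i j l := by
  have h1 := ht.2 (E.unit j l) (E.isL2WX_stepFun _)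
  obtain ⟨L, hL⟩ := hcont
  have h2 := (hL (E.unit j l) (E.isL2WX_stepFun _)).1
  rw [hP] at h2
  have h3 := E.integral_mix hπ fun c => E.integrable_part hπ h2 c
  rw [← hP, h1] at h3
  rw [moment, ← h3]
  unfold unit
  rw [E.integral_stepFun_mul_stepFun hπ hP, Finset.sum_eq_single j, Finset.sum_eq_single l]
  · simp
  · intro l' _ hl'; simp [hl']
  · simp
  · intro j' _ hj'; simp [hj']
  · simp

/-- Under a part, the law of (W, X) depends on the indices j and l only. Integrating over an event
of (W, X) and summing out h and i therefore turns the conditional expectation equation into the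
finite system `hx`. -/
theorem representerInRange_mix (hπ : ∀ h i j l, 0 < π h i j l)
    (hP : (P : Measure (Obs dz dw dx)) = E.mix π) {t x : Fin E.K → Fin E.kX → ℝ}
    (ht : IsRieszRepresenter m P (stepFun E.sW E.sX t))
    (hx : ∀ j l, ∑ h, ∑ i, π h i j l * x i l = t j l * ∑ h, ∑ i, π h i j l) :
    RepresenterInRange m P := by
  refine ⟨_, ht, stepFun E.sZ E.sX x, E.isL2ZX_stepFun x, ?_⟩
  symm
  refine ae_eq_condExp_of_forall_setIntegral_eq sigmaWX_le
    ((E.isL2ZX_stepFun x).memLp_comp.integrable (by norm_num))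
    (fun s _ _ => ((E.isL2WX_stepFun t).memLp_comp.integrable (by norm_num)).integrableOn) ?_
    (stronglyMeasurable_comp_pWX (E.isL2WX_stepFun (P := P) t).1).aestronglyMeasurable
  rintro _ ⟨A, hA, rfl⟩ -
  rw [hP, E.setIntegral_mix hπ (fun c => (integrable_const _).congr (E.stepFun_pWX_ae t c).symm)
    (measurable_pWX hA),
    E.setIntegral_mix hπ (fun c => (integrable_const _).congr (E.stepFun_pZX_ae x c).symm)
    (measurable_pWX hA)]
  simp only [E.setIntegral_part_of_ae_const (E.stepFun_pWX_ae t _),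
    E.setIntegral_part_of_ae_const (E.stepFun_pZX_ae x _), E.real_part_pWX _ hA]
  refine (sum_comm_four_right _).trans (Eq.trans ?_ (sum_comm_four_right _).symm)
  refine Finset.sum_congr rfl fun j _ => Finset.sum_congr rfl fun l _ => ?_
  simp only [← mul_assoc, ← Finset.sum_mul, hx]
  ring

/-- The same reduction with the roles of Z and W exchanged: the law of (Z, X) under a part depends
on i and l only, and Y contributes its cell means. -/
theorem isSolution_mix (hπ : ∀ h i j l, 0 < π h i j l)
    (hP : (P : Measure (Obs dz dw dx)) = E.mix π) {g : Fin E.K → Fin E.kX → ℝ}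
    (hg : ∀ i l, ∑ h, ∑ j, π h i j l * g j l = ∑ h, ∑ j, π h i j l * E.meanY h) :
    Integrable pY (P : Measure (Obs dz dw dx)) ∧ IsSolution P (stepFun E.sW E.sX g) := by
  have hY : Integrable pY (P : Measure (Obs dz dw dx)) := by
    rw [hP]; exact E.integrable_mix E.integrable_pY_part
  refine ⟨hY, E.isL2WX_stepFun g, condExp_ae_eq_of_setIntegral_eq sigmaZX_le
    ((E.isL2WX_stepFun g).memLp_comp.integrable (by norm_num)) hY ?_⟩
  rintro _ ⟨A, hA, rfl⟩
  rw [hP, E.setIntegral_mix hπ (fun c => (integrable_const _).congr (E.stepFun_pWX_ae g c).symm)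
    (measurable_pZX hA), E.setIntegral_mix hπ E.integrable_pY_part (measurable_pZX hA)]
  simp only [E.setIntegral_part_of_ae_const (E.stepFun_pWX_ae g _), E.setIntegral_pY_part _ hA,
    E.real_part_pZX _ hA]
  refine (sum_comm_four_mid _).trans (Eq.trans ?_ (sum_comm_four_mid _).symm)
  refine Finset.sum_congr rfl fun i _ => Finset.sum_congr rfl fun l _ => ?_
  simp only [← mul_assoc, ← Finset.sum_mul, hg]

theorem phi_mix (hπ : ∀ h i j l, 0 < π h i j l)
    (hP : (P : Measure (Obs dz dw dx)) = E.mix π) (hcont : IsContinuousFunctional m P)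
    {t g : Fin E.K → Fin E.kX → ℝ}
    (ht : IsRieszRepresenter m P (stepFun E.sW E.sX t)) (hrange : RepresenterInRange m P)
    (hg : IsSolution P (stepFun E.sW E.sX g)) :
    phi m P = ∑ j, ∑ l, E.moment m j l π * g j l := by
  rw [phi_eq_integral hrange hg, ht.2 _ hg.1, E.integral_stepFun_mul_stepFun hπ hP]
  refine Finset.sum_congr rfl fun j _ => Finset.sum_congr rfl fun l _ => ?_
  rw [E.moment_eq hcont hπ hP ht]
  ring

/-- Near a conditionally independent law that is uniform on the cells and whose representer depends
on `W`, there are laws with any given value of the parameter that satisfy all the conditions of the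
model. -/
theorem exists_near_with_phi_eq (hm : SimpleRepresenterCondition B m)
    {w : Fin E.kX → ℝ} {a : Fin E.kY → Fin E.kX → ℝ} {b d : Fin E.K → Fin E.kX → ℝ}
    (hw : ∀ l, 0 < w l) (ha : ∀ h l, 0 < a h l) (hb : ∀ i l, 0 < b i l) (hd : ∀ j l, 0 < d j l)
    (hw1 : ∑ l, w l = 1) (ha1 : ∀ l, ∑ h, a h l = 1) (hb1 : ∀ l, ∑ i, b i l = 1)
    (hd1 : ∀ l, ∑ j, d j l = 1) {h₁ h₂ : Fin E.kY} (hy : E.meanY h₁ ≠ E.meanY h₂)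
    (hP : (P : Measure (Obs dz dw dx)) = E.mix fun h i j l => w l * a h l * b i l * d j l)
    {t : Fin E.K → Fin E.kX → ℝ} (ht : IsRieszRepresenter m P (stepFun E.sW E.sX t))
    {l₀ : Fin E.kX} {j₁ j₂ : Fin E.K} (hne : t j₁ l₀ ≠ t j₂ l₀) (θ : ℝ) {δ : ℝ} (hδ : 0 < δ) :
    ∃ (π : Fin E.kY → Fin E.K → Fin E.K → Fin E.kX → ℝ) (Q : ProbabilityMeasure (Obs dz dw dx)),
      (∀ h i j l, 0 < π h i j l) ∧ (∀ h i j l, |π h i j l - w l * a h l * b i l * d j l| ≤ δ) ∧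
      (Q : Measure (Obs dz dw dx)) = E.mix π ∧ IsContinuousFunctional m Q ∧
      RepresenterInRange m Q ∧ OutcomeInRange Q ∧ phi m Q = θ := by
  have hp : ∀ h i j l, 0 < w l * a h l * b i l * d j l := fun h i j l =>
    mul_pos (mul_pos (mul_pos (hw l) (ha h l)) (hb i l)) (hd j l)
  have hcontP := (E.exists_step_representer hm hp hP).1
  have hTt : ∀ j, E.moment m j l₀ (fun h i j l => w l * a h l * b i l * d j l)
      = t j l₀ * (w l₀ * d j l₀) := by
    intro j
    rw [E.moment_eq hcontP hp hP ht]
    congr 1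
    have : ∀ h, ∑ i, w l₀ * a h l₀ * b i l₀ * d j l₀ = (w l₀ * d j l₀) * a h l₀ := by
      intro h
      rw [← Finset.sum_mul, ← Finset.mul_sum, hb1]; ring
    simp only [this]
    rw [← Finset.mul_sum, ha1, mul_one]
  obtain ⟨π, g, hπ, hsum, hclose, hg, hsurj, hθ⟩ := exists_perturbed_cell_probabilities hw ha hb hd
    hw1 ha1 hb1 hd1 hy (T := E.moment m) (E.continuous_moment m) hne hTt θ hδ
  let Q : ProbabilityMeasure (Obs dz dw dx) := ⟨E.mix π, E.isProbabilityMeasure_mix hπ hsum⟩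
  have hQ : (Q : Measure (Obs dz dw dx)) = E.mix π := rfl
  obtain ⟨hcont, t', ht'⟩ := E.exists_step_representer (P := Q) hm hπ hQ
  -- The representer t' of the perturbed law is known only once π has been chosen, which is why the
  -- system was made solvable for every right-hand side.
  obtain ⟨x, hx⟩ := hsurj fun j l => t' j l * ∑ h, ∑ i, π h i j l
  have hr := E.representerInRange_mix hπ hQ ht' hx
  have hs := E.isSolution_mix hπ hQ hg
  exact ⟨π, Q, hπ, hclose, hQ, hcont, hr, ⟨hs.1, _, hs.2⟩,
    (E.phi_mix hπ hQ hcont ht' hr hs.2).trans hθ⟩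

end Cells

end IntegralEq

/-! ### The density of a conditionally independent law -/

section Generic

variable {Y Z W X : Type*} [MeasurableSpace Y] [MeasurableSpace Z] [MeasurableSpace W]
  [MeasurableSpace X]

/-- Tonelli's theorem for four factors, with the last variable outermost. -/
theorem lintegral_prod_four (μ : Measure Y) (ν : Measure Z) (ξ : Measure W) (ζ : Measure X)
    [SFinite μ] [SFinite ν] [SFinite ξ] [SFinite ζ] {F : Y × Z × W × X → ℝ≥0∞}
    (hF : Measurable F) :
    ∫⁻ o, F o ∂(μ.prod (ν.prod (ξ.prod ζ)))
      = ∫⁻ x, ∫⁻ y, ∫⁻ z, ∫⁻ w, F (y, z, w, x) ∂ξ ∂ν ∂μ ∂ζ := by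
  rw [lintegral_prod _ hF.aemeasurable]
  have h1 : ∀ y, ∫⁻ q, F (y, q) ∂(ν.prod (ξ.prod ζ))
      = ∫⁻ x, ∫⁻ z, ∫⁻ w, F (y, z, w, x) ∂ξ ∂ν ∂ζ := by
    intro y
    rw [lintegral_prod _ (by fun_prop)]
    have h2 : ∀ z, ∫⁻ q, F (y, z, q) ∂(ξ.prod ζ) = ∫⁻ x, ∫⁻ w, F (y, z, w, x) ∂ξ ∂ζ := fun z =>
      lintegral_prod_symm _ (by fun_prop)
    simp only [h2]
    refine lintegral_lintegral_swap (Measurable.aemeasurable ?_)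
    exact Measurable.lintegral_prod_right' (f := fun p : (Z × X) × W => F (y, p.1.1, p.2, p.1.2))
      (by fun_prop)
  simp only [h1]
  refine lintegral_lintegral_swap (Measurable.aemeasurable ?_)
  refine Measurable.lintegral_prod_right'
    (f := fun p : (Y × X) × Z => ∫⁻ w, F (p.1.1, p.2, w, p.1.2) ∂ξ) ?_
  exact Measurable.lintegral_prod_right'
    (f := fun p : ((Y × X) × Z) × W => F (p.1.1.1, p.1.2, p.2, p.1.1.2)) (by fun_prop)

/-- Finite measures on a product of four spaces are equal if they agree on boxes. -/
theorem ext_prod_four {μ ν : Measure (Y × Z × W × X)} [IsFiniteMeasure μ]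
    (h : ∀ (A : Set Y) (C : Set Z) (D : Set W) (E : Set X), MeasurableSet A → MeasurableSet C →
      MeasurableSet D → MeasurableSet E → μ (A ×ˢ (C ×ˢ (D ×ˢ E))) = ν (A ×ˢ (C ×ˢ (D ×ˢ E)))) :
    μ = ν := by
  refine Measure.ext_prod fun {A T} hA hT => ?_
  -- With the first factor frozen at A, the traces on the other three factors are finite measures
  -- that agree on boxes.
  have key : (μ.restrict (A ×ˢ Set.univ)).map Prod.snd = (ν.restrict (A ×ˢ Set.univ)).map Prod.snd := by
    refine Measure.ext_prod₃ fun {C D E} hC hD hE => ?_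
    have hm := hC.prod (hD.prod hE)
    rw [Measure.map_apply measurable_snd hm, Measure.map_apply measurable_snd hm,
      Measure.restrict_apply (measurable_snd hm), Measure.restrict_apply (measurable_snd hm)]
    have : (Prod.snd ⁻¹' (C ×ˢ D ×ˢ E) ∩ A ×ˢ Set.univ : Set (Y × Z × W × X))
        = A ×ˢ (C ×ˢ (D ×ˢ E)) := by
      ext ⟨y, z, w, x⟩; simp; tauto
    rw [this]
    exact h A C D E hA hC hD hE
  have h2 := congrArg (fun ρ : Measure (Z × W × X) => ρ T) key
  simp only [Measure.map_apply measurable_snd hT, Measure.restrict_apply (measurable_snd hT)] at h2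
  have : (Prod.snd ⁻¹' T ∩ A ×ˢ Set.univ : Set (Y × Z × W × X)) = A ×ˢ T := by
    ext ⟨y, q⟩; simp; tauto
  rwa [this] at h2

/-- A conditional distribution integrates the joint density divided by the marginal density. -/
theorem rnDeriv_mul_condDistrib {Ω : Type*} [MeasurableSpace Ω] {P : Measure Ω}
    [IsProbabilityMeasure P] [StandardBorelSpace Y] [Nonempty Y] {f : Ω → Y} {k : Ω → X}
    (hf : Measurable f) (hk : Measurable k) (μ : Measure Y) (ζ : Measure X) [SigmaFinite μ]
    [SigmaFinite ζ] (hPk : P.map k ≪ ζ) (hPfk : P.map (fun o => (f o, k o)) ≪ μ.prod ζ)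
    {A : Set Y} (hA : MeasurableSet A) :
    (fun x => (P.map k).rnDeriv ζ x * condDistrib f k P x A)
      =ᵐ[ζ] fun x => ∫⁻ y in A, (P.map fun o => (f o, k o)).rnDeriv (μ.prod ζ) (y, x) ∂μ := by
  have hP' := Measure.isProbabilityMeasure_map (μ := P) hk.aemeasurable
  have hP'' := Measure.isProbabilityMeasure_map (μ := P) (hf.prodMk hk).aemeasurable
  have hcd : Measurable fun x => condDistrib f k P x A := Kernel.measurable_coe _ hA
  -- Both functions of x integrate over D to the probability of {f ∈ A, k ∈ D}.
  refine ae_eq_of_forall_setLIntegral_eq_of_sigmaFinite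
    ((Measure.measurable_rnDeriv _ _).mul hcd) ?_ fun D hD _ => ?_
  · exact Measurable.lintegral_prod_left' (μ := μ.restrict A) (Measure.measurable_rnDeriv _ _)
  · have h1 : ∫⁻ x in D, condDistrib f k P x A ∂(P.map k) = P (k ⁻¹' D ∩ f ⁻¹' A) := by
      rw [setLIntegral_map hD hcd hk]
      exact setLIntegral_preimage_condDistrib hk hf.aemeasurable hA hD
    have h2 : ∫⁻ x in D, condDistrib f k P x A ∂(P.map k)
        = ∫⁻ x in D, (P.map k).rnDeriv ζ x * condDistrib f k P x A ∂ζ := by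
      conv_lhs => rw [← Measure.withDensity_rnDeriv_eq _ _ hPk]
      exact setLIntegral_withDensity_eq_setLIntegral_mul _ (Measure.measurable_rnDeriv _ _) hcd hD
    rw [← h2, h1]
    have h3 : P (k ⁻¹' D ∩ f ⁻¹' A) = (P.map fun o => (f o, k o)) (A ×ˢ D) := by
      rw [Measure.map_apply (hf.prodMk hk) (hA.prod hD), Set.inter_comm]
      rfl
    rw [h3]
    conv_lhs => rw [← Measure.withDensity_rnDeriv_eq _ _ hPfk]
    rw [withDensity_apply _ (hA.prod hD), ← Measure.prod_restrict]
    exact lintegral_prod_symm _ (Measure.measurable_rnDeriv _ _).aemeasurable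

end Generic

namespace IntegralEq

variable {dz dw dx : ℕ} {B : BaseMeasures dz dw dx}

section Projections

variable [SigmaFinite B.muY] [SigmaFinite B.muZ] [SigmaFinite B.muW] [SigmaFinite B.muX]

/-- The factors of μ may be infinite, so projections need not preserve measure. They do pull null
sets back to null sets, which is all that is used to transport a.e. statements and absolute
continuity. -/
theorem quasiMeasurePreserving_pWX :
    Measure.QuasiMeasurePreserving pWX B.mu (B.muW.prod B.muX) :=
  (Measure.quasiMeasurePreserving_snd (μ := B.muZ)).comp
    (Measure.quasiMeasurePreserving_snd (μ := B.muY))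

theorem quasiMeasurePreserving_pX : Measure.QuasiMeasurePreserving pX B.mu B.muX :=
  (Measure.quasiMeasurePreserving_snd (μ := B.muW)).comp quasiMeasurePreserving_pWX

theorem quasiMeasurePreserving_prod_left {V X' X : Type*} [MeasurableSpace V] [MeasurableSpace X']
    [MeasurableSpace X] {μ : Measure V} {ν : Measure X'} {ζ : Measure X} [SigmaFinite μ]
    [SigmaFinite ν] [SigmaFinite ζ] {f : X' → X} (hf : Measure.QuasiMeasurePreserving f ν ζ) :
    Measure.QuasiMeasurePreserving (fun p : V × X' => (p.1, f p.2)) (μ.prod ν) (μ.prod ζ) := by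
  refine ⟨by have := hf.measurable; fun_prop, ?_⟩
  have := Measure.map_prod_map μ ν measurable_id hf.measurable
  rw [Measure.map_id] at this
  change (μ.prod ν).map (Prod.map id f) ≪ _
  rw [← this]
  exact Measure.AbsolutelyContinuous.rfl.prod hf.absolutelyContinuous

theorem quasiMeasurePreserving_pZX :
    Measure.QuasiMeasurePreserving pZX B.mu (B.muZ.prod B.muX) :=
  (quasiMeasurePreserving_prod_left (μ := B.muZ)
    (Measure.quasiMeasurePreserving_snd (μ := B.muW) (ν := B.muX))).comp
    (Measure.quasiMeasurePreserving_snd (μ := B.muY))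

theorem quasiMeasurePreserving_pYX :
    Measure.QuasiMeasurePreserving (fun o : Obs dz dw dx => (pY o, pX o)) B.mu
      (B.muY.prod B.muX) :=
  quasiMeasurePreserving_prod_left (μ := B.muY)
    ((Measure.quasiMeasurePreserving_snd (μ := B.muW) (ν := B.muX)).comp
      (Measure.quasiMeasurePreserving_snd (μ := B.muZ)))

end Projections

/-- Under conditional independence, the probability of a box is an integral of the product of the
conditional distributions. -/
theorem measure_box_of_condIndep {P : Measure (Obs dz dw dx)} [IsProbabilityMeasure P]
    (h1 : CondIndepFun (sigmaX dz dw dx) (sigmaX_le dz dw dx) pYW pZ P)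
    (h2 : CondIndepFun (sigmaX dz dw dx) (sigmaX_le dz dw dx) pY pW P)
    {A : Set ℝ} {C : Set (Vec dz)} {D : Set (Vec dw)} {E : Set (Vec dx)} (hA : MeasurableSet A)
    (hC : MeasurableSet C) (hD : MeasurableSet D) (hE : MeasurableSet E) :
    P (A ×ˢ (C ×ˢ (D ×ˢ E))) = ∫⁻ x in E, condDistrib pY pX P x A *
      condDistrib pZ pX P x C * condDistrib pW pX P x D ∂(P.map pX) := by
  have e1 := (condIndepFun_iff_map_prod_eq_prod_condDistrib_prod_condDistrib measurable_pYW
    measurable_pZ measurable_pX).1 h1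
  have e2 := (condIndepFun_iff_map_prod_eq_prod_condDistrib_prod_condDistrib measurable_pY
    measurable_pW measurable_pX).1 h2
  rw [← Measure.compProd_eq_comp_prod] at e1 e2
  -- Independence of Y and W given X splits the conditional law of (Y, W) into a product kernel; the
  -- independence of (Y, W) and Z splits off the third factor.
  have e3 : condDistrib pYW pX P =ᵐ[P.map pX] condDistrib pY pX P ×ₖ condDistrib pW pX P :=
    (condDistrib_ae_eq_iff_measure_eq_compProd pX measurable_pYW.aemeasurable _).2 e2
  have e4 : P (A ×ˢ (C ×ˢ (D ×ˢ E)))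
      = P.map (fun o => (pX o, pYW o, pZ o)) (E ×ˢ ((A ×ˢ D) ×ˢ C)) := by
    rw [Measure.map_apply (measurable_pX.prodMk (measurable_pYW.prodMk measurable_pZ))
      (hE.prod ((hA.prod hD).prod hC))]
    congr 1
    ext ⟨y, z, w, x⟩
    simp [pX, pYW, pY, pW, pZ]
    tauto
  rw [e4, e1, Measure.compProd_apply_prod hE ((hA.prod hD).prod hC)]
  refine lintegral_congr_ae (ae_restrict_of_ae ?_)
  filter_upwards [e3] with x hx
  rw [Kernel.prod_apply_prod, hx, Kernel.prod_apply_prod]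
  ring

variable [SigmaFinite B.muY] [SigmaFinite B.muZ] [SigmaFinite B.muW] [SigmaFinite B.muX]

/-- The density of a law under which `Y`, `Z`, `W` are independent given `X`. -/
theorem density_eq_of_condIndep {P : ProbabilityMeasure (Obs dz dw dx)} (hdom : Dominated B P)
    (hpos : ∀ᵐ x ∂B.muX, 0 < ((P : Measure (Obs dz dw dx)).map pX).rnDeriv B.muX x)
    (h1 : CondIndepFun (sigmaX dz dw dx) (sigmaX_le dz dw dx) pYW pZ
      (P : Measure (Obs dz dw dx)))
    (h2 : CondIndepFun (sigmaX dz dw dx) (sigmaX_le dz dw dx) pY pW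
      (P : Measure (Obs dz dw dx))) :
    density B P =ᵐ[B.mu] fun o =>
      ((P : Measure (Obs dz dw dx)).map fun o => (pY o, pX o)).rnDeriv (B.muY.prod B.muX)
          (pY o, pX o) *
        (((P : Measure (Obs dz dw dx)).map pZX).rnDeriv (B.muZ.prod B.muX) (pZX o) /
          ((P : Measure (Obs dz dw dx)).map pX).rnDeriv B.muX (pX o)) *
        (((P : Measure (Obs dz dw dx)).map pWX).rnDeriv (B.muW.prod B.muX) (pWX o) /
          ((P : Measure (Obs dz dw dx)).map pX).rnDeriv B.muX (pX o)) := by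
  set rY := ((P : Measure (Obs dz dw dx)).map fun o => (pY o, pX o)).rnDeriv (B.muY.prod B.muX)
  set rZ := ((P : Measure (Obs dz dw dx)).map pZX).rnDeriv (B.muZ.prod B.muX)
  set rW := ((P : Measure (Obs dz dw dx)).map pWX).rnDeriv (B.muW.prod B.muX)
  set rX := ((P : Measure (Obs dz dw dx)).map pX).rnDeriv B.muX
  have mY : Measurable rY := Measure.measurable_rnDeriv _ _
  have mZ : Measurable rZ := Measure.measurable_rnDeriv _ _
  have mW : Measurable rW := Measure.measurable_rnDeriv _ _
  have mX : Measurable rX := Measure.measurable_rnDeriv _ _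
  have mF : Measurable fun o : Obs dz dw dx =>
      rY (pY o, pX o) * (rZ (pZX o) / rX (pX o)) * (rW (pWX o) / rX (pX o)) :=
    ((mY.comp (measurable_pY.prodMk measurable_pX)).mul
      ((mZ.comp measurable_pZX).div (mX.comp measurable_pX))).mul
      ((mW.comp measurable_pWX).div (mX.comp measurable_pX))
  suffices h : (P : Measure (Obs dz dw dx)) = B.mu.withDensity fun o : Obs dz dw dx =>
      rY (pY o, pX o) * (rZ (pZX o) / rX (pX o)) * (rW (pWX o) / rX (pX o)) by
    rw [density, h]
    exact Measure.rnDeriv_withDensity _ mF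
  have acX : (P : Measure (Obs dz dw dx)).map pX ≪ B.muX :=
    (hdom.map measurable_pX).trans quasiMeasurePreserving_pX.absolutelyContinuous
  have acY : (P : Measure (Obs dz dw dx)).map (fun o => (pY o, pX o)) ≪ B.muY.prod B.muX :=
    (hdom.map (measurable_pY.prodMk measurable_pX)).trans
      quasiMeasurePreserving_pYX.absolutelyContinuous
  have acZ : (P : Measure (Obs dz dw dx)).map pZX ≪ B.muZ.prod B.muX :=
    (hdom.map measurable_pZX).trans quasiMeasurePreserving_pZX.absolutelyContinuous
  have acW : (P : Measure (Obs dz dw dx)).map pWX ≪ B.muW.prod B.muX :=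
    (hdom.map measurable_pWX).trans quasiMeasurePreserving_pWX.absolutelyContinuous
  have hPX := Measure.isProbabilityMeasure_map (μ := (P : Measure (Obs dz dw dx)))
    (measurable_pX (dz := dz) (dw := dw) (dx := dx)).aemeasurable
  refine ext_prod_four fun A C D E hA hC hD hE => ?_
  rw [measure_box_of_condIndep h1 h2 hA hC hD hE]
  have hcd : Measurable fun x => condDistrib pY pX (P : Measure (Obs dz dw dx)) x A *
      condDistrib pZ pX (P : Measure (Obs dz dw dx)) x C *
      condDistrib pW pX (P : Measure (Obs dz dw dx)) x D :=
    ((Kernel.measurable_coe _ hA).mul (Kernel.measurable_coe _ hC)).mul (Kernel.measurable_coe _ hD)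
  conv_lhs => rw [← Measure.withDensity_rnDeriv_eq _ _ acX]
  rw [setLIntegral_withDensity_eq_setLIntegral_mul _ mX hcd hE,
    withDensity_apply _ (hA.prod (hC.prod (hD.prod hE)))]
  unfold BaseMeasures.mu
  rw [← Measure.prod_restrict, ← Measure.prod_restrict, ← Measure.prod_restrict,
    lintegral_prod_four _ _ _ _ mF]
  refine lintegral_congr_ae (ae_restrict_of_ae ?_)
  filter_upwards [hpos, Measure.rnDeriv_lt_top ((P : Measure (Obs dz dw dx)).map pX) B.muX,
    rnDeriv_mul_condDistrib measurable_pY measurable_pX B.muY B.muX acX acY hA,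
    rnDeriv_mul_condDistrib measurable_pZ measurable_pX B.muZ B.muX acX acZ hC,
    rnDeriv_mul_condDistrib measurable_pW measurable_pX B.muW B.muX acX acW hD]
    with x hx0 hxt hY hZ hW
  change rX x * _ = ∫⁻ y in A, rY (y, x) ∂B.muY at hY
  change rX x * _ = ∫⁻ y in C, rZ (y, x) ∂B.muZ at hZ
  change rX x * _ = ∫⁻ y in D, rW (y, x) ∂B.muW at hW
  change rX x * _ = ∫⁻ y in A, ∫⁻ z in C, ∫⁻ w in D,
    rY (y, x) * (rZ (z, x) / rX x) * (rW (w, x) / rX x) ∂B.muW ∂B.muZ ∂B.muY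
  have mZ' : Measurable fun z => rZ (z, x) := by fun_prop
  have mW' : Measurable fun w => rW (w, x) := by fun_prop
  have mY' : Measurable fun y => rY (y, x) := by fun_prop
  have e1 : ∀ y z, ∫⁻ w in D, rY (y, x) * (rZ (z, x) / rX x) * (rW (w, x) / rX x) ∂B.muW
      = rY (y, x) * ((rZ (z, x) / rX x) * ((∫⁻ w in D, rW (w, x) ∂B.muW) / rX x)) := by
    intro y z
    rw [lintegral_const_mul _ (mW'.div_const _)]
    simp only [div_eq_mul_inv]
    rw [lintegral_mul_const _ mW']
    ring
  have e2 : ∀ y, ∫⁻ z in C, rY (y, x) *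
      ((rZ (z, x) / rX x) * ((∫⁻ w in D, rW (w, x) ∂B.muW) / rX x)) ∂B.muZ
      = rY (y, x) * (((∫⁻ z in C, rZ (z, x) ∂B.muZ) / rX x) *
        ((∫⁻ w in D, rW (w, x) ∂B.muW) / rX x)) := by
    intro y
    rw [lintegral_const_mul _ ((mZ'.div_const _).mul_const _),
      lintegral_mul_const _ (mZ'.div_const _)]
    simp only [div_eq_mul_inv]
    rw [lintegral_mul_const _ mZ']
  simp only [e1, e2]
  rw [lintegral_mul_const _ mY', ← hY, ← hZ, ← hW]
  -- The cancellation in [0, ∞] needs 0 < f_X < ∞; the positivity of f_X enters here.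
  have hdiv : ∀ u : ℝ≥0∞, rX x * u / rX x = u := fun u => by
    rw [mul_comm, ENNReal.mul_div_cancel_right hx0.ne' hxt.ne]
  rw [hdiv, hdiv]
  ring

end IntegralEq

/-! ### Density in L¹ of combinations of rectangles -/

/-- A sequence of measurable sets of finite measure that increases to the whole space. -/
structure IsExhaustion {V : Type*} [MeasurableSpace V] (ν : Measure V) (T : ℕ → Set V) : Prop where
  measurableSet : ∀ n, MeasurableSet (T n)
  lt_top : ∀ n, ν (T n) < ∞
  mono : Monotone T
  iUnion : ⋃ n, T n = Set.univ

theorem isExhaustion_spanningSets {V : Type*} [MeasurableSpace V] (ν : Measure V) [SigmaFinite ν] :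
    IsExhaustion ν (spanningSets ν) :=
  ⟨measurableSet_spanningSets ν, measure_spanningSets_lt_top ν, monotone_spanningSets ν,
    iUnion_spanningSets ν⟩

section RectSpan

variable {V X : Type*} [MeasurableSpace V] [MeasurableSpace X]

/-- Linear combinations of indicator functions of measurable rectangles inside `T n ×ˢ T' n`. -/
def rectSpan (T : ℕ → Set V) (T' : ℕ → Set X) : Submodule ℝ (V × X → ℝ) :=
  Submodule.span ℝ {f | ∃ (n : ℕ) (A : Set V) (A' : Set X), MeasurableSet A ∧ MeasurableSet A' ∧
    A ⊆ T n ∧ A' ⊆ T' n ∧ f = (A ×ˢ A').indicator fun _ => 1}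

variable {T : ℕ → Set V} {T' : ℕ → Set X} {ν : Measure V} {ζ : Measure X}

theorem measurable_of_mem_rectSpan {f : V × X → ℝ} (hf : f ∈ rectSpan T T') : Measurable f := by
  induction hf using Submodule.span_induction with
  | mem f hf =>
    obtain ⟨n, A, A', hA, hA', -, -, rfl⟩ := hf
    exact measurable_const.indicator (hA.prod hA')
  | zero => exact measurable_zero
  | add f g _ _ hf hg => exact hf.add hg
  | smul c f _ hf => exact hf.const_smul c

/-- `f` is a limit in `L¹` of elements of `rectSpan T T'`. -/
def RectApprox (T : ℕ → Set V) (T' : ℕ → Set X) (μ : Measure (V × X)) (f : V × X → ℝ) : Prop :=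
  ∀ ε : ℝ≥0∞, ε ≠ 0 → ∃ g ∈ rectSpan T T', eLpNorm (g - f) 1 μ ≤ ε

variable {μ : Measure (V × X)}

theorem RectApprox.of_mem {f : V × X → ℝ} (hf : f ∈ rectSpan T T') : RectApprox T T' μ f :=
  fun ε _ => ⟨f, hf, by simp⟩

theorem RectApprox.add {f g : V × X → ℝ} (hfm : Measurable f) (hgm : Measurable g)
    (hf : RectApprox T T' μ f) (hg : RectApprox T T' μ g) : RectApprox T T' μ (f + g) := by
  intro ε hε
  obtain ⟨f', hf', h1⟩ := hf (ε / 2) (by simpa using hε)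
  obtain ⟨g', hg', h2⟩ := hg (ε / 2) (by simpa using hε)
  refine ⟨f' + g', add_mem hf' hg', ?_⟩
  have : f' + g' - (f + g) = (f' - f) + (g' - g) := by ring
  rw [this]
  refine (eLpNorm_add_le ((measurable_of_mem_rectSpan hf').sub hfm).aestronglyMeasurable
    ((measurable_of_mem_rectSpan hg').sub hgm).aestronglyMeasurable le_rfl).trans ?_
  exact (add_le_add h1 h2).trans (ENNReal.add_halves ε).le

theorem RectApprox.const_smul {f : V × X → ℝ} (c : ℝ) (hf : RectApprox T T' μ f) :
    RectApprox T T' μ (c • f) := by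
  intro ε hε
  obtain ⟨g, hg, h⟩ := hf (ε / (‖c‖ₑ + 1)) (ENNReal.div_ne_zero.2 ⟨hε, by simp⟩)
  refine ⟨c • g, Submodule.smul_mem _ c hg, ?_⟩
  rw [← smul_sub, eLpNorm_const_smul]
  calc ‖c‖ₑ * eLpNorm (g - f) 1 μ ≤ (‖c‖ₑ + 1) * (ε / (‖c‖ₑ + 1)) := by
        gcongr; exact le_self_add
    _ = ε := ENNReal.mul_div_cancel (by simp) (by simp)

theorem RectApprox.of_approx {f : V × X → ℝ} (hfm : Measurable f)
    (h : ∀ ε : ℝ≥0∞, ε ≠ 0 → ∃ g, Measurable g ∧ RectApprox T T' μ g ∧ eLpNorm (g - f) 1 μ ≤ ε) :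
    RectApprox T T' μ f := by
  intro ε hε
  obtain ⟨g, hgm, hg, h1⟩ := h (ε / 2) (by simpa using hε)
  obtain ⟨g', hg', h2⟩ := hg (ε / 2) (by simpa using hε)
  refine ⟨g', hg', ?_⟩
  have : g' - f = (g' - g) + (g - f) := by ring
  rw [this]
  refine (eLpNorm_add_le ((measurable_of_mem_rectSpan hg').sub hgm).aestronglyMeasurable
    (hgm.sub hfm).aestronglyMeasurable le_rfl).trans ?_
  exact (add_le_add h2 h1).trans (ENNReal.add_halves ε).le

/-- The L¹ distance between the two indicators is the measure of the part of the union not yet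
covered, which decreases to zero by finiteness. -/
theorem RectApprox.indicator_iUnion {s : ℕ → Set (V × X)} (hs : ∀ n, MeasurableSet (s n))
    (hmono : Monotone s) (hfin : μ (⋃ n, s n) ≠ ∞)
    (h : ∀ n, RectApprox T T' μ ((s n).indicator fun _ => 1)) :
    RectApprox T T' μ ((⋃ n, s n).indicator fun _ => 1) := by
  refine RectApprox.of_approx (measurable_const.indicator (.iUnion hs)) fun ε hε => ?_
  have hlim : Tendsto (fun n => μ ((⋃ n, s n) \ s n)) atTop (𝓝 0) := by
    have h1 := tendsto_measure_iInter_atTop (μ := μ) (s := fun n => (⋃ n, s n) \ s n)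
      (fun n => ((MeasurableSet.iUnion hs).diff (hs n)).nullMeasurableSet)
      (fun i j hij => Set.sdiff_subset_sdiff_right (hmono hij))
      ⟨0, measure_ne_top_of_subset Set.sdiff_subset hfin⟩
    have h2 : ⋂ n, ((⋃ n, s n) \ s n) = ∅ := by
      rw [← Set.sdiff_iUnion, Set.sdiff_self]
    rwa [h2, measure_empty] at h1
  obtain ⟨n, hn⟩ := (hlim.eventually_lt_const (pos_iff_ne_zero.2 hε)).exists
  refine ⟨_, measurable_const.indicator (hs n), h n, ?_⟩
  rw [← neg_sub, eLpNorm_neg, ← Set.indicator_sdiff (Set.subset_iUnion s n),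
    eLpNorm_indicator_const ((MeasurableSet.iUnion hs).diff (hs n)) one_ne_zero ENNReal.one_ne_top]
  simpa using hn.le

/-- A π-λ argument from the rectangles. Intersecting with T n ×ˢ T' n keeps all measures finite, so
that complements and disjoint unions stay approximable. -/
theorem rectApprox_indicator_inter [SigmaFinite ν] [SigmaFinite ζ] (hT : IsExhaustion ν T) (hT' : IsExhaustion ζ T') (n : ℕ)
    {s : Set (V × X)} (hs : MeasurableSet s) :
    RectApprox T T' (ν.prod ζ) ((s ∩ T n ×ˢ T' n).indicator fun _ => 1) := by
  have hR : MeasurableSet (T n ×ˢ T' n) := (hT.measurableSet n).prod (hT'.measurableSet n)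
  have hRfin : ν.prod ζ (T n ×ˢ T' n) ≠ ∞ := by
    rw [Measure.prod_prod]; exact (ENNReal.mul_lt_top (hT.lt_top n) (hT'.lt_top n)).ne
  have hmem : (T n ×ˢ T' n).indicator (fun _ => (1 : ℝ)) ∈ rectSpan T T' :=
    Submodule.subset_span ⟨n, T n, T' n, hT.measurableSet n, hT'.measurableSet n, subset_rfl,
      subset_rfl, rfl⟩
  induction s, hs using MeasurableSpace.induction_on_inter generateFrom_prod.symm isPiSystem_prod with
  | empty => simpa using! RectApprox.of_mem (rectSpan T T').zero_mem
  | basic s hs =>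
    obtain ⟨A, hA, A', hA', rfl⟩ := hs
    refine RectApprox.of_mem (Submodule.subset_span ⟨n, A ∩ T n, A' ∩ T' n,
      MeasurableSet.inter hA (hT.measurableSet n), MeasurableSet.inter hA' (hT'.measurableSet n),
      Set.inter_subset_right, Set.inter_subset_right, ?_⟩)
    rw [Set.prod_inter_prod]
  | compl s hs ih =>
    have : ((sᶜ ∩ T n ×ˢ T' n).indicator fun _ => (1 : ℝ))
        = (T n ×ˢ T' n).indicator (fun _ => (1 : ℝ))
          + (-1 : ℝ) • (s ∩ T n ×ˢ T' n).indicator fun _ => (1 : ℝ) := by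
      funext p
      by_cases h1 : p ∈ s <;> by_cases h2 : p ∈ T n ×ˢ T' n <;> simp [Set.indicator, h1, h2]
    rw [this]
    exact (RectApprox.of_mem hmem).add (measurable_const.indicator hR)
      ((measurable_const.indicator (hs.inter hR)).const_smul _) (ih.const_smul _)
  | iUnion f hd hf ih =>
    have hacc : ∀ N, RectApprox T T' (ν.prod ζ)
        (((⋃ k ∈ Finset.range N, f k) ∩ T n ×ˢ T' n).indicator fun _ => 1) := by
      intro N
      induction N with
      | zero => simpa using! RectApprox.of_mem (rectSpan T T').zero_mem
      | succ N ihN =>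
        have hdisj : Disjoint ((⋃ k ∈ Finset.range N, f k) ∩ T n ×ˢ T' n) (f N ∩ T n ×ˢ T' n) := by
          refine Disjoint.mono Set.inter_subset_left Set.inter_subset_left ?_
          simp only [Set.disjoint_iUnion_left, Finset.mem_range]
          exact fun k hk => hd hk.ne
        rw [Finset.range_add_one, Finset.set_biUnion_insert, Set.union_comm, Set.union_inter_distrib_right,
          Set.indicator_union_of_disjoint hdisj]
        refine ihN.add (measurable_const.indicator ?_)
          (measurable_const.indicator ((hf N).inter hR)) (ih N)
        exact (Finset.measurableSet_biUnion _ fun k _ => hf k).inter hR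
    have hU : (⋃ k, f k) ∩ T n ×ˢ T' n
        = ⋃ N, ((⋃ k ∈ Finset.range N, f k) ∩ T n ×ˢ T' n) := by
      rw [← Set.iUnion_inter]
      congr 1
      ext p
      simp only [Set.mem_iUnion, Finset.mem_range, exists_prop]
      exact ⟨fun ⟨k, hk⟩ => ⟨k + 1, k, Nat.lt_succ_self k, hk⟩, fun ⟨_, k, _, hk⟩ => ⟨k, hk⟩⟩
    rw [hU]
    refine RectApprox.indicator_iUnion
      (fun N => (Finset.measurableSet_biUnion _ fun k _ => hf k).inter hR) ?_ ?_ hacc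
    · intro N M hNM
      refine Set.inter_subset_inter_left _ (Set.biUnion_subset_biUnion_left ?_)
      intro k hk
      exact Finset.mem_coe.2 (Finset.mem_range.2 ((Finset.mem_range.1 hk).trans_le hNM))
    · rw [← hU]
      exact measure_ne_top_of_subset Set.inter_subset_right hRfin

/-- Linear combinations of indicators of rectangles are dense in `L¹`. -/
theorem exists_mem_rectSpan_eLpNorm_le [SigmaFinite ν] [SigmaFinite ζ] (hT : IsExhaustion ν T)
    (hT' : IsExhaustion ζ T') {f : V × X → ℝ} (hf : Integrable f (ν.prod ζ)) {ε : ℝ≥0∞}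
    (hε : ε ≠ 0) : ∃ g ∈ rectSpan T T', eLpNorm (f - g) 1 (ν.prod ζ) ≤ ε := by
  have key : ∀ s : Set (V × X), MeasurableSet s → ν.prod ζ s < ∞ →
      RectApprox T T' (ν.prod ζ) (s.indicator fun _ => 1) := by
    intro s hs hfin
    have hU : s = ⋃ n, (s ∩ T n ×ˢ T' n) := by
      rw [← Set.inter_iUnion]
      symm
      rw [Set.inter_eq_left]
      rintro ⟨v, x⟩ -
      obtain ⟨i, hi⟩ := Set.mem_iUnion.1 (hT.iUnion.symm ▸ Set.mem_univ v)
      obtain ⟨j, hj⟩ := Set.mem_iUnion.1 (hT'.iUnion.symm ▸ Set.mem_univ x)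
      exact Set.mem_iUnion.2 ⟨max i j, hT.mono (le_max_left i j) hi, hT'.mono (le_max_right i j) hj⟩
    have hfin' := hfin.ne
    rw [hU] at hfin' ⊢
    refine RectApprox.indicator_iUnion
      (fun n => hs.inter ((hT.measurableSet n).prod (hT'.measurableSet n))) ?_ hfin'
      fun n => rectApprox_indicator_inter hT hT' n hs
    exact fun i j hij => Set.inter_subset_inter_right _ (Set.prod_mono (hT.mono hij) (hT'.mono hij))
  obtain ⟨g, h1, h2⟩ := MemLp.induction_dense ENNReal.one_ne_top (· ∈ rectSpan T T')
    (fun c s hs hfin ε hε => by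
      obtain ⟨g, hg, h⟩ := (key s hs hfin).const_smul c ε hε
      refine ⟨g, ?_, hg⟩
      convert! h using 3
      funext p
      by_cases hp : p ∈ s <;> simp [hp])
    (fun f g hf hg => add_mem hf hg)
    (fun f hf => (measurable_of_mem_rectSpan hf).aestronglyMeasurable)
    (memLp_one_iff_integrable.2 hf) hε
  exact ⟨g, h2, h1⟩

end RectSpan

/-! ### Support families adapted to finitely many sets -/

section Adapted

variable {V : Type*} [MeasurableSpace V] {ν : Measure V}

/-- Up to a null set, `A` is a union of sets of the family `s`. -/
def IsAdapted (ν : Measure V) {k : ℕ} (s : Fin k → Set V) (A : Set V) : Prop :=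
  (∀ i, s i ⊆ A ∨ Disjoint (s i) A) ∧ ν (A \ ⋃ i, s i) = 0

theorem IsAdapted.refine {k k' : ℕ} {s : Fin k → Set V} {s' : Fin k' → Set V} {A : Set V}
    (h : IsAdapted ν s A) (h₁ : ∀ i, ∃ j, s' i ⊆ s j) (h₂ : ⋃ i, s' i = ⋃ i, s i) :
    IsAdapted ν s' A := by
  refine ⟨fun i => ?_, by rw [h₂]; exact h.2⟩
  obtain ⟨j, hj⟩ := h₁ i
  exact (h.1 j).imp hj.trans fun hd => hd.mono_left hj

theorem IsAdapted.exists_subset {k : ℕ} {s : Fin k → Set V} {A : Set V}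
    (h : IsAdapted ν s A) (hA : ν A ≠ 0) : ∃ i, s i ⊆ A := by
  by_contra! hc
  refine hA ?_
  rw [← h.2]
  congr 1
  symm
  rw [sdiff_eq_left]
  simp only [Set.disjoint_iUnion_right]
  exact fun i => ((h.1 i).resolve_left (hc i)).symm

theorem iUnion_atoms [MeasurableSingletonClass V] {F : Finset V} (hF : ∀ v ∈ F, ν {v} ≠ 0)
    (hFc : ν (F : Set V)ᶜ = 0) {k : ℕ} (e : Fin k ≃ F) :
    ⋃ i, {(e i : V)} = {v | ν {v} ≠ 0} := by
  ext v
  simp only [Set.mem_iUnion, Set.mem_singleton_iff, Set.mem_ofPred_eq]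
  constructor
  · rintro ⟨i, rfl⟩
    exact hF _ (e i).2
  · intro hv
    by_cases h : v ∈ F
    · exact ⟨e.symm ⟨v, h⟩, by simp⟩
    · exact absurd (measure_mono_null (Set.singleton_subset_iff.2 (by simpa using h)) hFc) hv

theorem isSupportFamily_atoms [MeasurableSingletonClass V] [SigmaFinite ν] {F : Finset V}
    (hF : ∀ v ∈ F, ν {v} ≠ 0) (hFc : ν (F : Set V)ᶜ = 0) {k : ℕ} (e : Fin k ≃ F) :
    IntegralEq.IsSupportFamily ν fun i => {(e i : V)} where
  measurableSet i := measurableSet_singleton _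
  pos i := pos_iff_ne_zero.2 (hF _ (e i).2)
  lt_top i := measure_singleton_lt_top
  disjoint i j hij := by
    exact Set.disjoint_singleton.2 fun h => hij (e.injective (Subtype.ext h))
  finite_range _ := ⟨fun i => ⟨_, rfl⟩, iUnion_atoms hF hFc e⟩

theorem isAdapted_atoms {F : Finset V} (hFc : ν (F : Set V)ᶜ = 0) {k : ℕ} (e : Fin k ≃ F)
    (A : Set V) : IsAdapted ν (fun i => {(e i : V)}) A := by
  refine ⟨fun i => ?_, measure_mono_null ?_ hFc⟩
  · by_cases h : (e i : V) ∈ A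
    · exact Or.inl (Set.singleton_subset_iff.2 h)
    · exact Or.inr (Set.disjoint_singleton_left.2 h)
  · rintro v ⟨-, hv⟩ hvF
    exact hv (Set.mem_iUnion.2 ⟨e.symm ⟨v, hvF⟩, by simp⟩)

/-- A measure carried by a finite set leaves no choice: its atoms are taken, and every set is
adapted to them. Otherwise the non-null atoms of the Boolean algebra generated by 𝒜 serve. The last
clause transfers boundedness from 𝒜 to the family, which is needed for Y. -/
theorem exists_isSupportFamily_isAdapted [MeasurableSingletonClass V] [SigmaFinite ν]
    (𝒜 : Finset (Set V)) (hm : ∀ A ∈ 𝒜, MeasurableSet A) (hfin : ∀ A ∈ 𝒜, ν A < ∞) :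
    ∃ (k : ℕ) (s : Fin k → Set V), IntegralEq.IsSupportFamily ν s ∧ (∀ A ∈ 𝒜, IsAdapted ν s A) ∧
      ∀ i, (∃ A ∈ 𝒜, s i ⊆ A) ∨ ∃ v, s i = {v} := by
  classical
  by_cases hrange : ∃ F : Set V, F.Finite ∧ ν Fᶜ = 0
  · obtain ⟨F, hF, hFc⟩ := hrange
    let G : Finset V := hF.toFinset.filter fun v => ν {v} ≠ 0
    have hG : ∀ v ∈ G, ν {v} ≠ 0 := fun v hv => (Finset.mem_filter.1 hv).2
    have hGc : ν (G : Set V)ᶜ = 0 := by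
      have hsub : (G : Set V)ᶜ ⊆ Fᶜ ∪ ⋃ v ∈ {v ∈ F | ν {v} = 0}, {v} := by
        intro v hv
        by_cases hvF : v ∈ F
        · right
          simp only [G, Finset.coe_filter, Set.mem_compl_iff, Set.mem_ofPred_eq, not_and, not_not,
            Set.Finite.mem_toFinset] at hv
          simpa using ⟨hvF, hv hvF⟩
        · exact Or.inl hvF
      refine measure_mono_null hsub (measure_union_null hFc ?_)
      exact (measure_biUnion_null_iff (hF.subset (Set.sep_subset _ _)).countable).2 fun v hv => hv.2
    exact ⟨G.card, _, isSupportFamily_atoms hG hGc G.equivFin.symm,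
      fun A _ => isAdapted_atoms hGc _ A, fun i => Or.inr ⟨_, rfl⟩⟩
  · let cell : Finset (Set V) → Set V := fun S => {v | ∀ A ∈ 𝒜, v ∈ A ↔ A ∈ S}
    have hcellm : ∀ S, MeasurableSet (cell S) := by
      intro S
      have : cell S = ⋂ A ∈ 𝒜, if A ∈ S then A else Aᶜ := by
        ext v
        simp only [cell, Set.mem_ofPred_eq, Set.mem_iInter]
        refine forall₂_congr fun A _ => ?_
        split_ifs with h <;> simp [h]
      rw [this]
      refine Finset.measurableSet_biInter _ fun A hA => ?_
      split_ifs
      exacts [hm A hA, (hm A hA).compl]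
    -- The empty S is excluded because its cell is the complement of the union of 𝒜, possibly of
    -- infinite measure.
    let I : Finset (Finset (Set V)) := 𝒜.powerset.filter fun S => S.Nonempty ∧ ν (cell S) ≠ 0
    let e := I.equivFin.symm
    have hI : ∀ i, ∃ A ∈ 𝒜, A ∈ (e i : Finset (Set V)) := by
      intro i
      have := Finset.mem_filter.1 (e i).2
      obtain ⟨A, hA⟩ := this.2.1
      exact ⟨A, Finset.mem_powerset.1 this.1 hA, hA⟩
    have hsub : ∀ {S A}, A ∈ 𝒜 → A ∈ S → cell S ⊆ A := fun hA hAS v hv => (hv _ hA).2 hAS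
    refine ⟨I.card, fun i => cell (e i), ⟨fun i => hcellm _, fun i => ?_, fun i => ?_, ?_,
      fun h => absurd h hrange⟩, fun A hA => ⟨fun i => ?_, ?_⟩, fun i => ?_⟩
    · exact pos_iff_ne_zero.2 (Finset.mem_filter.1 (e i).2).2.2
    · obtain ⟨A, hA, hAi⟩ := hI i
      exact (measure_mono (hsub hA hAi)).trans_lt (hfin A hA)
    · intro i j hij
      refine Set.disjoint_left.2 fun v hi hj => hij (e.injective (Subtype.ext ?_))
      have hi' := Finset.mem_powerset.1 (Finset.mem_filter.1 (e i).2).1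
      have hj' := Finset.mem_powerset.1 (Finset.mem_filter.1 (e j).2).1
      ext A
      constructor
      · exact fun h => (hj A (hi' h)).1 ((hi A (hi' h)).2 h)
      · exact fun h => (hi A (hj' h)).1 ((hj A (hj' h)).2 h)
    · by_cases h : A ∈ (e i : Finset (Set V))
      · exact Or.inl (hsub hA h)
      · exact Or.inr (Set.disjoint_left.2 fun v hv hvA => h ((hv A hA).1 hvA))
    · have hcov : A \ ⋃ i, cell (e i) ⊆ ⋃ S ∈ 𝒜.powerset.filter (fun S => ν (cell S) = 0), cell S := by
        rintro v ⟨hvA, hv⟩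
        let S := 𝒜.filter fun A => v ∈ A
        have hvS : v ∈ cell S := fun A' hA' => by simp [S, hA']
        have hS : S ∈ 𝒜.powerset := Finset.mem_powerset.2 (Finset.filter_subset _ _)
        refine Set.mem_biUnion (Finset.mem_filter.2 ⟨hS, ?_⟩ : S ∈ 𝒜.powerset.filter _) hvS
        by_contra hne
        have hSI : S ∈ I := Finset.mem_filter.2 ⟨hS, ⟨A, Finset.mem_filter.2 ⟨hA, hvA⟩⟩, hne⟩
        exact hv (Set.mem_iUnion.2 ⟨e.symm ⟨S, hSI⟩, by simpa using hvS⟩)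
      refine measure_mono_null hcov ((measure_biUnion_null_iff (Finset.countable_toSet _)).2 ?_)
      exact fun S hS => (Finset.mem_filter.1 hS).2
    · obtain ⟨A, hA, hAi⟩ := hI i
      exact Or.inl ⟨A, hA, hsub hA hAi⟩

/-- A measure for which no set of a countable separating family splits the mass is carried by a
point. -/
theorem exists_measure_compl_singleton_eq_zero {ι : Type*} [Countable ι] (hν : ν Set.univ ≠ 0)
    {D : ι → Set V} (hsep : ∀ v v', (∀ i, v ∈ D i ↔ v' ∈ D i) → v = v')
    (h : ∀ i, ν (D i) = 0 ∨ ν (D i)ᶜ = 0) : ∃ v, ν {v}ᶜ = 0 := by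
  classical
  let E : Set V := ⋂ i, if ν (D i) = 0 then (D i)ᶜ else D i
  have hE : ν Eᶜ = 0 := by
    simp only [E, Set.compl_iInter]
    refine measure_iUnion_null fun i => ?_
    split_ifs with hi
    · rwa [compl_compl]
    · exact (h i).resolve_left hi
  have hne : E.Nonempty := by
    by_contra hc
    rw [Set.not_nonempty_iff_eq_empty.1 hc, Set.compl_empty] at hE
    exact hν hE
  obtain ⟨v, hv⟩ := hne
  refine ⟨v, measure_mono_null (Set.compl_subset_compl.2 ?_) hE⟩
  intro v' hv'
  refine hsep _ _ fun i => ?_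
  have h1 := Set.mem_iInter.1 hv i
  have h2 := Set.mem_iInter.1 hv' i
  split_ifs at h1 h2 with hi
  · exact ⟨fun h => absurd h h2, fun h => absurd h h1⟩
  · exact ⟨fun _ => h1, fun _ => h2⟩

/-- If no measurable D splits A, then no set of a countable separating family does, and the
restriction of ν to A is carried by one point. That point is null. -/
theorem exists_split [MeasurableSpace.CountablySeparated V] [MeasurableSingletonClass V]
    [NullSingletonClass ν] {A : Set V}
    (hA : ν A ≠ 0) : ∃ D, MeasurableSet D ∧ ν (A ∩ D) ≠ 0 ∧ ν (A \ D) ≠ 0 := by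
  by_contra! hc
  obtain ⟨D, hD, hsep⟩ := exists_seq_separating V (p := MeasurableSet) MeasurableSet.empty Set.univ
  obtain ⟨v, hv⟩ := exists_measure_compl_singleton_eq_zero (ν := ν.restrict A) (D := D)
    (by simpa using hA) (fun v v' h => hsep v trivial v' trivial h) (fun n => by
      rw [Measure.restrict_apply (hD n), Measure.restrict_apply (hD n).compl]
      by_cases h : ν (A ∩ D n) = 0
      · left; rwa [Set.inter_comm]
      · right
        have := hc (D n) (hD n) h
        rwa [Set.sdiff_eq, Set.inter_comm] at this)
  rw [Measure.restrict_apply (measurableSet_singleton v).compl] at hv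
  refine hA (measure_mono_null (fun u hu => ?_) (measure_union_null (measure_singleton (μ := ν) v) hv))
  by_cases h : u = v
  exacts [Or.inl h, Or.inr ⟨h, hu⟩]

theorem measure_compl_ne_zero_of_finite [NullSingletonClass ν] (hν : ν ≠ 0) {F : Set V}
    (hF : F.Finite) : ν Fᶜ ≠ 0 := by
  intro h
  refine hν (Measure.measure_univ_eq_zero.1 ?_)
  rw [← Set.union_compl_self F]
  exact measure_union_null (hF.countable.measure_zero ν) h

/-- One set is cut in two. Repeating this raises the size of a family at will, so that Z and W can
be given equally many cells. -/
theorem exists_isSupportFamily_succ [MeasurableSpace.CountablySeparated V]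
    [MeasurableSingletonClass V] [NullSingletonClass ν] {k : ℕ} {s : Fin (k + 1) → Set V}
    (hs : IntegralEq.IsSupportFamily ν s) :
    ∃ s' : Fin (k + 2) → Set V, IntegralEq.IsSupportFamily ν s' ∧ (∀ i, ∃ j, s' i ⊆ s j) ∧
      ⋃ i, s' i = ⋃ i, s i := by
  obtain ⟨D, hD, h1, h2⟩ := exists_split (hs.pos 0).ne'
  have hν : ν ≠ 0 := by
    rintro rfl
    exact (hs.pos 0).ne' rfl
  let u : Fin (k + 1) → Set V := Function.update s 0 (s 0 \ D)
  have hu0 : u 0 = s 0 \ D := Function.update_self ..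
  have hu : ∀ i, i ≠ 0 → u i = s i := fun i hi => Function.update_of_ne hi _ _
  have husub : ∀ i, u i ⊆ s i := by
    intro i
    by_cases hi : i = 0
    · subst hi; rw [hu0]; exact Set.sdiff_subset
    · rw [hu i hi]
  have hd0 : ∀ i, Disjoint (s 0 ∩ D) (u i) := by
    intro i
    by_cases hi : i = 0
    · subst hi; rw [hu0]
      exact Set.disjoint_left.2 fun v hv hv' => hv'.2 hv.2
    · rw [hu i hi]
      exact (hs.disjoint (Ne.symm hi)).mono_left Set.inter_subset_left
  refine ⟨Fin.cons (s 0 ∩ D) u, ⟨?_, ?_, ?_, ?_, ?_⟩, ?_, ?_⟩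
  · refine Fin.cases ((hs.measurableSet 0).inter hD) fun i => ?_
    rw [Fin.cons_succ]
    by_cases hi : i = 0
    · subst hi; rw [hu0]; exact (hs.measurableSet 0).diff hD
    · rw [hu i hi]; exact hs.measurableSet i
  · refine Fin.cases (pos_iff_ne_zero.2 h1) fun i => ?_
    rw [Fin.cons_succ]
    by_cases hi : i = 0
    · subst hi; rw [hu0]; exact pos_iff_ne_zero.2 h2
    · rw [hu i hi]; exact hs.pos i
  · refine Fin.cases ((measure_mono Set.inter_subset_left).trans_lt (hs.lt_top 0)) fun i => ?_
    rw [Fin.cons_succ]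
    exact (measure_mono (husub i)).trans_lt (hs.lt_top i)
  · intro i j
    refine Fin.cases (fun hij => ?_) (fun i => ?_) i
    · refine Fin.cases (fun h => absurd rfl h) (fun j _ => ?_) j hij
      exact hd0 j
    · refine Fin.cases (fun _ => (hd0 i).symm) (fun j hij => ?_) j
      simp only [Fin.cons_succ]
      exact (hs.disjoint fun h => hij (congrArg _ h)).mono (husub i) (husub j)
  · rintro ⟨F, hF, hFc⟩
    exact absurd hFc (measure_compl_ne_zero_of_finite hν hF)
  · refine Fin.cases ⟨0, Set.inter_subset_left⟩ fun i => ⟨i, ?_⟩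
    rw [Fin.cons_succ]
    exact husub i
  · ext v
    simp only [Set.mem_iUnion]
    constructor
    · rintro ⟨i, hi⟩
      revert hi
      refine Fin.cases (fun hi => ⟨0, hi.1⟩) (fun i hi => ⟨i, husub i hi⟩) i
    · rintro ⟨i, hi⟩
      by_cases hi0 : i = 0
      · subst hi0
        by_cases hv : v ∈ D
        · exact ⟨0, hi, hv⟩
        · refine ⟨Fin.succ 0, ?_⟩
          rw [Fin.cons_succ, hu0]; exact ⟨hi, hv⟩
      · refine ⟨i.succ, ?_⟩
        rw [Fin.cons_succ, hu i hi0]; exact hi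

theorem exists_isSupportFamily_of_le [MeasurableSpace.CountablySeparated V]
    [MeasurableSingletonClass V] [NullSingletonClass ν] {k k' : ℕ} {s : Fin k → Set V}
    (hs : IntegralEq.IsSupportFamily ν s) (hk : 1 ≤ k) (hkk' : k ≤ k') :
    ∃ s' : Fin k' → Set V, IntegralEq.IsSupportFamily ν s' ∧ (∀ i, ∃ j, s' i ⊆ s j) ∧
      ⋃ i, s' i = ⋃ i, s i := by
  induction k', hkk' using Nat.le_induction with
  | base => exact ⟨s, hs, fun i => ⟨i, subset_rfl⟩, rfl⟩
  | succ n hn ih =>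
    obtain ⟨s', h1, h2, h3⟩ := ih
    obtain ⟨p, rfl⟩ : ∃ p, n = p + 1 := ⟨n - 1, by omega⟩
    obtain ⟨s'', h1', h2', h3'⟩ := exists_isSupportFamily_succ h1
    refine ⟨s'', h1', fun i => ?_, h3'.trans h3⟩
    obtain ⟨j, hj⟩ := h2' i
    obtain ⟨j', hj'⟩ := h2 j
    exact ⟨j', hj.trans hj'⟩

/-- In an atomless space, adapted support families exist for all large numbers of sets. -/
theorem exists_isSupportFamily_card [MeasurableSpace.CountablySeparated V]
    [MeasurableSingletonClass V] [SigmaFinite ν] [NullSingletonClass ν] (hν : ν ≠ 0)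
    (𝒜 : Finset (Set V)) (hm : ∀ A ∈ 𝒜, MeasurableSet A) (hfin : ∀ A ∈ 𝒜, ν A < ∞) :
    ∃ k₀, ∀ k, k₀ ≤ k → ∃ s : Fin k → Set V, IntegralEq.IsSupportFamily ν s ∧
      ∀ A ∈ 𝒜, IsAdapted ν s A := by
  classical
  obtain ⟨n, hn⟩ : ∃ n, ν (spanningSets ν n) ≠ 0 := by
    by_contra! hc
    refine hν (Measure.measure_univ_eq_zero.1 ?_)
    rw [← iUnion_spanningSets ν]
    exact measure_iUnion_null hc
  -- The spanning set of positive measure is added so that the family is non-empty: there must be a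
  -- set to split.
  obtain ⟨k, s, hs, had, -⟩ := exists_isSupportFamily_isAdapted (ν := ν)
    (insert (spanningSets ν n) 𝒜)
    (by simpa using ⟨measurableSet_spanningSets ν n, hm⟩)
    (by simpa using ⟨measure_spanningSets_lt_top ν n, hfin⟩)
  obtain ⟨i, -⟩ := (had _ (Finset.mem_insert_self _ _)).exists_subset hn
  have hk : 1 ≤ k := i.pos
  refine ⟨k, fun k' hk' => ?_⟩
  obtain ⟨s', h1, h2, h3⟩ := exists_isSupportFamily_of_le hs hk hk'
  exact ⟨s', h1, fun A hA => (had A (Finset.mem_insert_of_mem hA)).refine h2 h3⟩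

end Adapted

namespace IntegralEq

/-- A singleton of a product is a product of singletons, and one null factor is enough. Of case (1)
only this and σ-finiteness are used. -/
theorem HasAtomlessFactor.sigmaFinite_and_nullSingletonClass {d : ℕ} {ν : Measure (Vec d)}
    (h : HasAtomlessFactor ν) : SigmaFinite ν ∧ NullSingletonClass ν := by
  obtain ⟨d₁, d₂, rfl, ν₁, ν₂, h1, h2, h3, rfl⟩ := h
  let e : (Vec d₁ × Vec d₂) ≃ᵐ Vec (d₁ + d₂) :=
    { toFun := fun p i => Fin.append p.1 p.2 (Fin.cast rfl i)
      invFun := fun v => (fun i => v (Fin.castAdd d₂ i), fun j => v (Fin.natAdd d₁ j))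
      left_inv := fun p => by ext i <;> simp
      right_inv := fun v => by
        funext i
        refine Fin.addCases (fun i => ?_) (fun j => ?_) i <;> simp
      measurable_toFun := by
        refine measurable_pi_lambda _ fun i => ?_
        refine Fin.addCases (fun i => ?_) (fun j => ?_) i
        · simp only [Equiv.coe_fn_mk, Fin.cast_eq_self, Fin.append_left]; fun_prop
        · simp only [Equiv.coe_fn_mk, Fin.cast_eq_self, Fin.append_right]; fun_prop
      measurable_invFun := by
        change Measurable fun v : Vec (d₁ + d₂) =>
          ((fun i => v (Fin.castAdd d₂ i) : Vec d₁), (fun j => v (Fin.natAdd d₁ j) : Vec d₂))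
        fun_prop }
  change SigmaFinite ((ν₁.prod ν₂).map e) ∧ NullSingletonClass ((ν₁.prod ν₂).map e)
  refine ⟨e.sigmaFinite_map, ⟨fun v => ?_⟩⟩
  rw [Measure.map_apply e.measurable (measurableSet_singleton v)]
  have : e ⁻¹' {v} = {e.symm v} := by
    ext p
    simp only [Set.mem_preimage, Set.mem_singleton_iff]
    exact ⟨fun h => by rw [← h, e.symm_apply_apply], fun h => by rw [h, e.apply_symm_apply]⟩
  rw [this]
  exact measure_singleton _

theorem IsCountingOn.sigmaFinite {V : Type*} [MeasurableSpace V] [MeasurableSingletonClass V]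
    {ν : Measure V} {F : Finset V} (h : IsCountingOn ν F) : SigmaFinite ν := by
  have : IsFiniteMeasure ν := by
    refine ⟨?_⟩
    rw [h, Measure.restrict_apply_univ, Measure.count_apply_finset]
    exact ENNReal.natCast_lt_top _
  infer_instance

theorem IsCountingOn.measure_singleton {V : Type*} [MeasurableSpace V] [MeasurableSingletonClass V]
    {ν : Measure V} {F : Finset V} (h : IsCountingOn ν F) {v : V} (hv : v ∈ F) : ν {v} ≠ 0 := by
  rw [h, Measure.restrict_apply (measurableSet_singleton v),
    Set.inter_eq_left.2 (Set.singleton_subset_iff.2 (Finset.mem_coe.2 hv)), Measure.count_singleton]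
  exact one_ne_zero

theorem IsCountingOn.measure_compl {V : Type*} [MeasurableSpace V] [MeasurableSingletonClass V]
    {ν : Measure V} {F : Finset V} (h : IsCountingOn ν F) : ν (F : Set V)ᶜ = 0 := by
  rw [h, Measure.restrict_apply F.measurableSet.compl, Set.compl_inter_self, measure_empty]

variable {dz dw dx : ℕ} {B : BaseMeasures dz dw dx}

theorem BaseMeasures.Admissible.sigmaFinite_muZ (hB : B.Admissible) : SigmaFinite B.muZ := by
  obtain ⟨h, -⟩ | ⟨F, F', -, h, -⟩ := hB.muZ_muW_cases
  exacts [h.sigmaFinite_and_nullSingletonClass.1, h.sigmaFinite]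

theorem BaseMeasures.Admissible.sigmaFinite_muW (hB : B.Admissible) : SigmaFinite B.muW := by
  obtain ⟨-, h⟩ | ⟨F, F', -, -, h⟩ := hB.muZ_muW_cases
  exacts [h.sigmaFinite_and_nullSingletonClass.1, h.sigmaFinite]

/-- Adapted support families for `Z` and `W` with equally many sets. -/
theorem BaseMeasures.Admissible.exists_families_ZW (hB : B.Admissible) (hZ : B.muZ ≠ 0)
    (hW : B.muW ≠ 0) (𝒜 : Finset (Set (Vec dz))) (𝒜' : Finset (Set (Vec dw)))
    (hm : ∀ A ∈ 𝒜, MeasurableSet A) (hfin : ∀ A ∈ 𝒜, B.muZ A < ∞)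
    (hm' : ∀ A ∈ 𝒜', MeasurableSet A) (hfin' : ∀ A ∈ 𝒜', B.muW A < ∞) :
    ∃ (K : ℕ) (s : Fin K → Set (Vec dz)) (s' : Fin K → Set (Vec dw)),
      IsSupportFamily B.muZ s ∧ IsSupportFamily B.muW s' ∧ (∀ A ∈ 𝒜, IsAdapted B.muZ s A) ∧
      ∀ A ∈ 𝒜', IsAdapted B.muW s' A := by
  have := hB.sigmaFinite_muZ
  have := hB.sigmaFinite_muW
  obtain ⟨h, h'⟩ | ⟨F, F', hcard, h, h'⟩ := hB.muZ_muW_cases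
  · have := h.sigmaFinite_and_nullSingletonClass.2
    have := h'.sigmaFinite_and_nullSingletonClass.2
    obtain ⟨k, hk⟩ := exists_isSupportFamily_card hZ 𝒜 hm hfin
    obtain ⟨k', hk'⟩ := exists_isSupportFamily_card hW 𝒜' hm' hfin'
    -- Equal numbers of sets make the linear systems square. In the counting case the equality of
    -- the two cardinalities is assumed.
    obtain ⟨s, h1, h2⟩ := hk (max k k') (le_max_left _ _)
    obtain ⟨s', h1', h2'⟩ := hk' (max k k') (le_max_right _ _)
    exact ⟨_, s, s', h1, h1', h2, h2'⟩
  · let e := F.equivFin.symm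
    let e' : Fin F.card ≃ F' := (finCongr hcard).trans F'.equivFin.symm
    exact ⟨F.card, _, _, isSupportFamily_atoms (fun v => h.measure_singleton) h.measure_compl e,
      isSupportFamily_atoms (fun v => h'.measure_singleton) h'.measure_compl e',
      fun A _ => isAdapted_atoms h.measure_compl e A,
      fun A _ => isAdapted_atoms h'.measure_compl e' A⟩

/-- The rational half-lines separate points, so if none of them splits the mass, it sits at one
point. The threshold q will produce two cells of Y with different means. -/
theorem exists_Iio_Ici_ne_zero {ν : Measure ℝ} (hν : ν ≠ 0) (h : ∀ v, ν {v}ᶜ ≠ 0) :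
    ∃ q : ℝ, ν (Set.Iio q) ≠ 0 ∧ ν (Set.Ici q) ≠ 0 := by
  by_contra! hc
  have hsep : ∀ v v' : ℝ, (∀ q : ℚ, v ∈ Set.Iio (q : ℝ) ↔ v' ∈ Set.Iio (q : ℝ)) → v = v' := by
    intro v v' hvv'
    by_contra hne
    obtain hlt | hlt := lt_or_gt_of_ne hne
    · obtain ⟨q, h1, h2⟩ := exists_rat_btwn hlt
      exact absurd ((hvv' q).1 h1) (not_lt.2 h2.le)
    · obtain ⟨q, h1, h2⟩ := exists_rat_btwn hlt
      exact absurd ((hvv' q).2 h1) (not_lt.2 h2.le)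
  obtain ⟨v, hv⟩ := exists_measure_compl_singleton_eq_zero (by simpa using hν) hsep fun q => by
    by_cases h0 : ν (Set.Iio (q : ℝ)) = 0
    · exact Or.inl h0
    · right
      rw [Set.compl_Iio]
      exact hc q h0
  exact h v hv

theorem BaseMeasures.Admissible.muY_compl_singleton (hB : B.Admissible) (hY : B.muY ≠ 0) (v : ℝ) :
    B.muY {v}ᶜ ≠ 0 := by
  obtain h | ⟨F, hF, h⟩ := hB.muY_cases
  · exact measure_compl_ne_zero_of_finite hY (Set.finite_singleton v)
  · intro h0
    obtain ⟨a, ha, b, hb, hab⟩ := Finset.one_lt_card.1 hF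
    by_cases hav : a = v
    · exact h.measure_singleton hb (measure_mono_null
        (Set.singleton_subset_iff.2
        (Set.mem_compl_singleton_iff.2 fun hbv => hab (hav.trans hbv.symm))) h0)
    · exact h.measure_singleton ha (measure_mono_null (Set.singleton_subset_iff.2
        (Set.mem_compl_singleton_iff.2 hav)) h0)

theorem integrable_id_cond {ν : Measure ℝ} {A : Set ℝ} (hm : MeasurableSet A)
    (hb : Bornology.IsBounded A) : Integrable id (ν[|A]) := by
  obtain ⟨R, hR⟩ := hb.exists_norm_le
  refine Integrable.of_bound measurable_id.aestronglyMeasurable R ?_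
  filter_upwards [ae_cond_mem hm] with y hy using hR y hy

/-- Adapted support families for `Y` on which `Y` has finite means that are not all equal. -/
theorem BaseMeasures.Admissible.exists_family_Y (hB : B.Admissible) (hY : B.muY ≠ 0)
    (𝒜 : Finset (Set ℝ)) (hm : ∀ A ∈ 𝒜, MeasurableSet A) (hfin : ∀ A ∈ 𝒜, B.muY A < ∞)
    (hb : ∀ A ∈ 𝒜, Bornology.IsBounded A) :
    ∃ (k : ℕ) (s : Fin k → Set ℝ), IsSupportFamily B.muY s ∧ (∀ A ∈ 𝒜, IsAdapted B.muY s A) ∧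
      (∀ h, Integrable id (B.muY[|s h])) ∧
      ∃ h₁ h₂, ∫ y, y ∂(B.muY[|s h₁]) ≠ ∫ y, y ∂(B.muY[|s h₂]) := by
  classical
  have := hB.sigmaFinite_muY
  obtain ⟨q, hq1, hq2⟩ := exists_Iio_Ici_ne_zero hY (hB.muY_compl_singleton hY)
  -- Bounded as well as of finite measure, so that Y is integrable over the cells inside.
  let T : ℕ → Set ℝ := fun n => spanningSets B.muY n ∩ Metric.closedBall 0 n
  have hTm : ∀ n, MeasurableSet (T n) := fun n =>
    (measurableSet_spanningSets _ n).inter Metric.isClosed_closedBall.measurableSet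
  have hTU : ∀ y, ∃ n, y ∈ T n := by
    intro y
    obtain ⟨i, hi⟩ := Set.mem_iUnion.1 ((iUnion_spanningSets B.muY).symm ▸ Set.mem_univ y)
    obtain ⟨j, hj⟩ := exists_nat_ge ‖y‖
    refine ⟨max i j, monotone_spanningSets _ (le_max_left i j) hi, ?_⟩
    rw [mem_closedBall_zero_iff]
    exact hj.trans (by exact_mod_cast le_max_right i j)
  have hex : ∀ D : Set ℝ, B.muY D ≠ 0 → ∃ n, B.muY (T n ∩ D) ≠ 0 := by
    intro D hD
    by_contra! hc
    refine hD (measure_mono_null (fun y hy => ?_) (measure_iUnion_null hc))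
    obtain ⟨n, hn⟩ := hTU y
    exact Set.mem_iUnion.2 ⟨n, hn, hy⟩
  obtain ⟨n₁, hn₁⟩ := hex _ hq1
  obtain ⟨n₂, hn₂⟩ := hex _ hq2
  have hTlt : ∀ n D, B.muY (T n ∩ D) < ∞ := fun n D =>
    (measure_mono (Set.inter_subset_left.trans Set.inter_subset_left)).trans_lt
      (measure_spanningSets_lt_top B.muY n)
  have hTb : ∀ n D, Bornology.IsBounded (T n ∩ D) := fun n D =>
    Metric.isBounded_closedBall.subset (Set.inter_subset_left.trans Set.inter_subset_right)
  -- The two extra sets force one cell entirely below q and another entirely at or above q.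
  obtain ⟨k, s, hs, had, hsb⟩ := exists_isSupportFamily_isAdapted (ν := B.muY)
    (insert (T n₁ ∩ Set.Iio q) (insert (T n₂ ∩ Set.Ici q) 𝒜))
    (by simpa using ⟨(hTm n₁).inter measurableSet_Iio, (hTm n₂).inter measurableSet_Ici, hm⟩)
    (by simpa using ⟨hTlt _ _, hTlt _ _, hfin⟩)
  have hbd : ∀ A ∈ insert (T n₁ ∩ Set.Iio q) (insert (T n₂ ∩ Set.Ici q) 𝒜),
      Bornology.IsBounded A := by
    simpa using ⟨hTb _ _, hTb _ _, hb⟩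
  have hint : ∀ h, Integrable id (B.muY[|s h]) := by
    intro h
    refine integrable_id_cond (hs.measurableSet h) ?_
    obtain ⟨A, hA, hsA⟩ | ⟨v, hv⟩ := hsb h
    · exact (hbd A hA).subset hsA
    · rw [hv]; exact Bornology.isBounded_singleton
  obtain ⟨h₁, hh₁⟩ := (had _ (Finset.mem_insert_self _ _)).exists_subset hn₁
  obtain ⟨h₂, hh₂⟩ := (had _ (Finset.mem_insert_of_mem (Finset.mem_insert_self _ _))).exists_subset hn₂
  refine ⟨k, s, hs, fun A hA => had A (Finset.mem_insert_of_mem (Finset.mem_insert_of_mem hA)), hint,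
    h₁, h₂, ne_of_lt ?_⟩
  have hp : ∀ h, IsProbabilityMeasure (B.muY[|s h]) := fun h =>
    cond_isProbabilityMeasure_of_finite (hs.pos h).ne' (hs.lt_top h).ne
  have hlt : ∀ᵐ y ∂(B.muY[|s h₁]), y < q := by
    filter_upwards [ae_cond_mem (hs.measurableSet h₁)] with y hy using (hh₁ hy).2
  have hge : ∀ᵐ y ∂(B.muY[|s h₂]), q ≤ y := by
    filter_upwards [ae_cond_mem (hs.measurableSet h₂)] with y hy using (hh₂ hy).2
  have e2 : q ≤ ∫ y, y ∂(B.muY[|s h₂]) := by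
    have := integral_mono_ae (integrable_const q) (hint h₂) hge
    simpa using this
  have e1 : ∫ y, y ∂(B.muY[|s h₁]) < q := by
    have hnn : 0 ≤ᵐ[B.muY[|s h₁]] fun y => q - y := by
      filter_upwards [hlt] with y hy using sub_nonneg.2 hy.le
    have hi : Integrable (fun y => q - y) (B.muY[|s h₁]) := (integrable_const q).sub (hint h₁)
    have h0 : 0 < ∫ y, (q - y) ∂(B.muY[|s h₁]) := by
      refine lt_of_le_of_ne (integral_nonneg_of_ae hnn) fun h => ?_
      have hz := (integral_eq_zero_iff_of_nonneg_ae hnn hi).1 h.symm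
      obtain ⟨y, hy1, hy2⟩ := (hlt.and hz).exists
      simp only [Pi.zero_apply] at hy2
      linarith
    rw [integral_sub (g := fun y => y) (integrable_const q) (hint h₁)] at h0
    simpa using h0
  exact e1.trans_le e2

end IntegralEq

/-! ### Approximation by positive step functions -/

section StepApprox

variable {V X : Type*} [MeasurableSpace V] [MeasurableSpace X] {ν : Measure V} {ζ : Measure X}
  {T : ℕ → Set V} {T' : ℕ → Set X}

theorem stepFun_add {ι κ : Type*} [Fintype ι] [Fintype κ] (s : ι → Set V) (t : κ → Set X)
    (c c' : ι → κ → ℝ) : stepFun s t (c + c') = stepFun s t c + stepFun s t c' := by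
  funext p
  simp only [stepFun, Pi.add_apply, ← Finset.sum_add_distrib]
  refine Finset.sum_congr rfl fun j _ => Finset.sum_congr rfl fun l _ => ?_
  by_cases h : p ∈ s j ×ˢ t l
  · simp only [Set.indicator_of_mem h]
  · simp only [Set.indicator_of_notMem h, add_zero]

theorem stepFun_smul {ι κ : Type*} [Fintype ι] [Fintype κ] (s : ι → Set V) (t : κ → Set X)
    (r : ℝ) (c : ι → κ → ℝ) : stepFun s t (r • c) = r • stepFun s t c := by
  funext p
  simp only [stepFun, Pi.smul_apply, smul_eq_mul, Finset.mul_sum]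
  refine Finset.sum_congr rfl fun j _ => Finset.sum_congr rfl fun l _ => ?_
  by_cases h : p ∈ s j ×ˢ t l
  · simp only [Set.indicator_of_mem h]
  · simp only [Set.indicator_of_notMem h, mul_zero]

/-- Elements of `rectSpan T T'` are step functions for all support families that are adapted to
suitable finite collections of sets. -/
theorem exists_stepFun_ae_eq [SigmaFinite ν] [SigmaFinite ζ] {g : V × X → ℝ}
    (hg : g ∈ rectSpan T T') :
    ∃ (𝒜 : Finset (Set V)) (𝒜' : Finset (Set X)),
      (∀ A ∈ 𝒜, MeasurableSet A ∧ ∃ n, A ⊆ T n) ∧ (∀ A ∈ 𝒜', MeasurableSet A ∧ ∃ n, A ⊆ T' n) ∧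
      ∀ (k k' : ℕ) (s : Fin k → Set V) (t : Fin k' → Set X),
        (Pairwise fun i j => Disjoint (s i) (s j)) → (Pairwise fun i j => Disjoint (t i) (t j)) →
        (∀ A ∈ 𝒜, IsAdapted ν s A) → (∀ A ∈ 𝒜', IsAdapted ζ t A) →
        ∃ c, g =ᵐ[ν.prod ζ] stepFun s t c := by
  classical
  induction hg using Submodule.span_induction with
  | mem f hf =>
    obtain ⟨n, A, A', hA, hA', hn, hn', rfl⟩ := hf
    refine ⟨{A}, {A'}, by simpa using ⟨hA, n, hn⟩, by simpa using ⟨hA', n, hn'⟩, ?_⟩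
    intro k k' s t hs ht hadA hadA'
    have had := hadA A (Finset.mem_singleton_self A)
    have had' := hadA' A' (Finset.mem_singleton_self A')
    refine ⟨fun j l => if s j ⊆ A ∧ t l ⊆ A' then 1 else 0, ?_⟩
    have e1 : ∀ᵐ p ∂(ν.prod ζ), p.1 ∉ A \ ⋃ i, s i :=
      Measure.quasiMeasurePreserving_fst.ae (measure_eq_zero_iff_ae_notMem.1 had.2)
    have e2 : ∀ᵐ p ∂(ν.prod ζ), p.2 ∉ A' \ ⋃ i, t i :=
      Measure.quasiMeasurePreserving_snd.ae (measure_eq_zero_iff_ae_notMem.1 had'.2)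
    filter_upwards [e1, e2] with p h1 h2
    by_cases hp : p ∈ A ×ˢ A'
    · rw [Set.indicator_of_mem hp]
      obtain ⟨j, hj⟩ : ∃ j, p.1 ∈ s j := by
        by_contra hc
        exact h1 ⟨hp.1, fun h => hc (Set.mem_iUnion.1 h)⟩
      obtain ⟨l, hl⟩ : ∃ l, p.2 ∈ t l := by
        by_contra hc
        exact h2 ⟨hp.2, fun h => hc (Set.mem_iUnion.1 h)⟩
      rw [stepFun_of_mem hs ht hj hl, if_pos]
      exact ⟨(had.1 j).resolve_right fun hd => hd.le_bot ⟨hj, hp.1⟩,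
        (had'.1 l).resolve_right fun hd => hd.le_bot ⟨hl, hp.2⟩⟩
    · rw [Set.indicator_of_notMem hp]
      by_cases hj : ∃ j, p.1 ∈ s j
      · obtain ⟨j, hj⟩ := hj
        by_cases hl : ∃ l, p.2 ∈ t l
        · obtain ⟨l, hl⟩ := hl
          rw [stepFun_of_mem hs ht hj hl, if_neg]
          exact fun h => hp ⟨h.1 hj, h.2 hl⟩
        · exact (stepFun_of_forall_notMem_right fun l h => hl ⟨l, h⟩).symm
      · exact (stepFun_of_forall_notMem_left fun j h => hj ⟨j, h⟩).symm
  | zero =>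
    refine ⟨∅, ∅, by simp, by simp, fun k k' s t _ _ _ _ => ⟨0, Eventually.of_forall fun p => ?_⟩⟩
    simp [stepFun]
  | add f g _ _ hf hg =>
    obtain ⟨𝒜, 𝒜', h1, h2, h3⟩ := hf
    obtain ⟨ℬ, ℬ', h1', h2', h3'⟩ := hg
    refine ⟨𝒜 ∪ ℬ, 𝒜' ∪ ℬ', fun A hA => ?_, fun A hA => ?_, fun k k' s t hs ht hA hA' => ?_⟩
    · exact (Finset.mem_union.1 hA).elim (h1 A) (h1' A)
    · exact (Finset.mem_union.1 hA).elim (h2 A) (h2' A)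
    · obtain ⟨c, hc⟩ := h3 k k' s t hs ht (fun A h => hA A (Finset.mem_union_left _ h))
        fun A h => hA' A (Finset.mem_union_left _ h)
      obtain ⟨c', hc'⟩ := h3' k k' s t hs ht (fun A h => hA A (Finset.mem_union_right _ h))
        fun A h => hA' A (Finset.mem_union_right _ h)
      exact ⟨c + c', by rw [stepFun_add]; exact hc.add hc'⟩
  | smul r f _ hf =>
    obtain ⟨𝒜, 𝒜', h1, h2, h3⟩ := hf
    refine ⟨𝒜, 𝒜', h1, h2, fun k k' s t hs ht hA hA' => ?_⟩
    obtain ⟨c, hc⟩ := h3 k k' s t hs ht hA hA'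
    exact ⟨r • c, by rw [stepFun_smul]; exact hc.const_smul r⟩

variable {k k' : ℕ} {s : Fin k → Set V} {t : Fin k' → Set X}

theorem integrable_stepFun [SigmaFinite ν] [SigmaFinite ζ] (hs : IntegralEq.IsSupportFamily ν s)
    (ht : IntegralEq.IsSupportFamily ζ t) (c : Fin k → Fin k' → ℝ) :
    Integrable (stepFun s t c) (ν.prod ζ) := by
  refine integrable_finsetSum _ fun j _ => integrable_finsetSum _ fun l _ => ?_
  refine (integrable_indicator_iff ((hs.measurableSet j).prod (ht.measurableSet l))).2 ?_
  refine integrableOn_const ?_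
  rw [Measure.prod_prod]
  exact (ENNReal.mul_lt_top (hs.lt_top j) (ht.lt_top l)).ne

/-- A step function that approximates a nonnegative function can be made positive. -/
theorem exists_pos_stepFun [SigmaFinite ν] [SigmaFinite ζ] (hs : IntegralEq.IsSupportFamily ν s)
    (ht : IntegralEq.IsSupportFamily ζ t) {f : V × X → ℝ} (hf : Measurable f) (hf0 : 0 ≤ f)
    {c : Fin k → Fin k' → ℝ} {ε : ℝ≥0∞} (hε : ε ≠ 0)
    (hfc : eLpNorm (f - stepFun s t c) 1 (ν.prod ζ) ≤ ε / 2) :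
    ∃ c' : Fin k → Fin k' → ℝ, (∀ j l, 0 < c' j l) ∧
      eLpNorm (f - stepFun s t c') 1 (ν.prod ζ) ≤ ε := by
  set u : V × X → ℝ := stepFun s t fun _ _ => 1
  have hu : eLpNorm u 1 (ν.prod ζ) ≠ ∞ :=
    (memLp_one_iff_integrable.2 (integrable_stepFun hs ht _)).2.ne
  obtain ⟨η, hη, hηε⟩ := ENNReal.exists_nnreal_pos_mul_lt hu (by simpa using hε : ε / 2 ≠ 0)
  -- Truncation at 0 brings the values no further from f, as f ≥ 0. The constant η, which costs less
  -- than ε / 2 in L¹, gives the strict positivity required by (A).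
  refine ⟨fun j l => max (c j l) 0 + η, fun j l => by positivity, ?_⟩
  have hpt : ∀ p, ‖(f - stepFun s t fun j l => max (c j l) 0 + η) p‖
      ≤ ‖(f - stepFun s t c) p‖ + ‖((η : ℝ) • u) p‖ := by
    intro p
    have key : ∀ x y e : ℝ, 0 ≤ x → |x - (max y 0 + e)| ≤ |x - y| + |e * 1| := by
      intro x y e hx
      have h1 : |x - max y 0| ≤ |x - y| := by
        have := abs_max_sub_max_le_abs x y 0
        rwa [max_eq_left hx] at this
      calc |x - (max y 0 + e)| = |(x - max y 0) - e| := by ring_nf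
        _ ≤ |x - max y 0| + |e| := abs_sub _ _
        _ ≤ |x - y| + |e * 1| := by rw [mul_one]; gcongr
    simp only [Pi.sub_apply, Pi.smul_apply, smul_eq_mul, Real.norm_eq_abs, u]
    by_cases hj : ∃ j, p.1 ∈ s j
    · obtain ⟨j, hj⟩ := hj
      by_cases hl : ∃ l, p.2 ∈ t l
      · obtain ⟨l, hl⟩ := hl
        simp only [stepFun_of_mem hs.disjoint ht.disjoint hj hl]
        exact key _ _ _ (hf0 p)
      · simp [stepFun_of_forall_notMem_right (fun l h => hl ⟨l, h⟩)]
    · simp [stepFun_of_forall_notMem_left (fun j h => hj ⟨j, h⟩)]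
  have hm : ∀ c, Measurable (stepFun s t c) := fun c =>
    measurable_stepFun hs.measurableSet ht.measurableSet
  calc eLpNorm (f - stepFun s t fun j l => max (c j l) 0 + η) 1 (ν.prod ζ)
      ≤ eLpNorm ((fun p => ‖(f - stepFun s t c) p‖) + fun p => ‖((η : ℝ) • u) p‖) 1 (ν.prod ζ) :=
        eLpNorm_mono_real hpt
    _ ≤ eLpNorm (fun p => ‖(f - stepFun s t c) p‖) 1 (ν.prod ζ)
        + eLpNorm (fun p => ‖((η : ℝ) • u) p‖) 1 (ν.prod ζ) :=
        eLpNorm_add_le (hf.sub (hm c)).norm.aestronglyMeasurable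
          ((hm _).const_smul (η : ℝ)).norm.aestronglyMeasurable le_rfl
    _ ≤ ε / 2 + ε / 2 := by
        rw [eLpNorm_norm, eLpNorm_norm, eLpNorm_const_smul]
        refine add_le_add hfc ?_
        refine le_trans (le_of_eq ?_) hηε.le
        simp [Real.enorm_eq_ofReal]
    _ = ε := ENNReal.add_halves ε

/-- Approximation by positive step functions, once the support families are adapted. -/
theorem exists_collections_stepFun [SigmaFinite ν] [SigmaFinite ζ] (hT : IsExhaustion ν T)
    (hT' : IsExhaustion ζ T') {f : V × X → ℝ} (hfm : Measurable f) (hf0 : 0 ≤ f)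
    (hf : Integrable f (ν.prod ζ)) {ε : ℝ≥0∞} (hε : ε ≠ 0) :
    ∃ (𝒜 : Finset (Set V)) (𝒜' : Finset (Set X)),
      (∀ A ∈ 𝒜, MeasurableSet A ∧ ∃ n, A ⊆ T n) ∧ (∀ A ∈ 𝒜', MeasurableSet A ∧ ∃ n, A ⊆ T' n) ∧
      ∀ (k k' : ℕ) (s : Fin k → Set V) (t : Fin k' → Set X),
        IntegralEq.IsSupportFamily ν s → IntegralEq.IsSupportFamily ζ t →
        (∀ A ∈ 𝒜, IsAdapted ν s A) → (∀ A ∈ 𝒜', IsAdapted ζ t A) →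
        ∃ c : Fin k → Fin k' → ℝ, (∀ j l, 0 < c j l) ∧
          eLpNorm (f - stepFun s t c) 1 (ν.prod ζ) ≤ ε := by
  obtain ⟨g, hg, hfg⟩ := exists_mem_rectSpan_eLpNorm_le hT hT' hf
    (by simpa using hε : ε / 2 ≠ 0)
  obtain ⟨𝒜, 𝒜', h1, h2, h3⟩ := exists_stepFun_ae_eq (ν := ν) (ζ := ζ) hg
  refine ⟨𝒜, 𝒜', h1, h2, fun k k' s t hs ht hA hA' => ?_⟩
  obtain ⟨c, hc⟩ := h3 k k' s t hs.disjoint ht.disjoint hA hA'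
  refine exists_pos_stepFun hs ht hfm hf0 (c := c) hε ?_
  rwa [← eLpNorm_congr_ae ((EventuallyEq.refl _ f).sub hc)]

/-- Convergence in `L¹` at a geometric rate implies almost everywhere convergence. -/
theorem ae_tendsto_of_eLpNorm_sub_le {Ω : Type*} [MeasurableSpace Ω] {μ : Measure Ω} {f : Ω → ℝ}
    {g : ℕ → Ω → ℝ} (hf : AEStronglyMeasurable f μ) (hg : ∀ n, AEStronglyMeasurable (g n) μ)
    (h : ∀ n, eLpNorm (f - g n) 1 μ ≤ 2⁻¹ ^ n) :
    ∀ᵐ o ∂μ, Tendsto (fun n => g n o) atTop (𝓝 (f o)) := by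
  -- The geometric rate makes the sum of the errors integrable, so it is finite a.e. and its terms
  -- tend to zero; no subsequence is needed.
  have hsum : ∫⁻ o, ∑' n, ‖(f - g n) o‖ₑ ∂μ ≠ ∞ := by
    rw [lintegral_tsum fun n => (hf.sub (hg n)).enorm]
    refine ne_top_of_le_ne_top (b := ∑' n : ℕ, (2⁻¹ : ℝ≥0∞) ^ n) ?_ (ENNReal.tsum_le_tsum fun n => ?_)
    · rw [ENNReal.tsum_geometric, ENNReal.one_sub_inv_two, inv_inv]; exact ENNReal.ofNat_ne_top
    · rw [← eLpNorm_one_eq_lintegral_enorm]; exact h n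
  filter_upwards [ae_lt_top' (AEMeasurable.tsum fun n => (hf.sub (hg n)).enorm) hsum] with o ho
  have h0 := ENNReal.tendsto_atTop_zero_of_tsum_ne_top ho.ne
  rw [tendsto_iff_edist_tendsto_0]
  refine h0.congr fun n => ?_
  rw [edist_comm, edist_eq_enorm_sub]
  rfl

/-- Integrating out one variable is a contraction in `L¹`. -/
theorem eLpNorm_integral_sub_le [SigmaFinite ν] [SigmaFinite ζ] {f g : V × X → ℝ}
    (hf : Integrable f (ν.prod ζ)) (hg : Integrable g (ν.prod ζ)) :
    eLpNorm ((fun x => ∫ v, f (v, x) ∂ν) - fun x => ∫ v, g (v, x) ∂ν) 1 ζ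
      ≤ eLpNorm (f - g) 1 (ν.prod ζ) := by
  rw [eLpNorm_one_eq_lintegral_enorm, eLpNorm_one_eq_lintegral_enorm,
    lintegral_prod_symm _ (hf.sub hg).1.enorm]
  refine lintegral_mono_ae ?_
  filter_upwards [hf.prod_left_ae, hg.prod_left_ae] with x h1 h2
  simp only [Pi.sub_apply]
  rw [← integral_sub h1 h2]
  exact enorm_integral_le_lintegral_enorm _

end StepApprox

section StepIntegral

variable {V X : Type*} [MeasurableSpace V] [MeasurableSpace X] {ν : Measure V} {ζ : Measure X}
  {k k' : ℕ} {s : Fin k → Set V} {t : Fin k' → Set X}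

theorem integral_stepFun_left (hs : IntegralEq.IsSupportFamily ν s)
    (ht : Pairwise fun i j => Disjoint (t i) (t j)) (c : Fin k → Fin k' → ℝ) {x : X} {l : Fin k'}
    (hx : x ∈ t l) : ∫ v, stepFun s t c (v, x) ∂ν = ∑ j, c j l * ν.real (s j) := by
  have h1 : ∀ v, stepFun s t c (v, x) = ∑ j, (s j).indicator (fun _ => c j l) v := by
    intro v
    refine Finset.sum_congr rfl fun j _ => ?_
    rw [Finset.sum_eq_single l]
    · by_cases hv : v ∈ s j
      · rw [Set.indicator_of_mem (Set.mk_mem_prod hv hx), Set.indicator_of_mem hv]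
      · rw [Set.indicator_of_notMem (fun h => hv h.1), Set.indicator_of_notMem hv]
    · exact fun l' _ hl' => Set.indicator_of_notMem (fun h => (ht hl').le_bot ⟨h.2, hx⟩) _
    · simp
  simp only [h1]
  rw [integral_finsetSum]
  · refine Finset.sum_congr rfl fun j _ => ?_
    rw [integral_indicator_const _ (hs.measurableSet j), smul_eq_mul, mul_comm]
  · exact fun j _ => (integrable_indicator_iff (hs.measurableSet j)).2
      (integrableOn_const (hs.lt_top j).ne)

theorem integral_stepFun [SigmaFinite ν] [SigmaFinite ζ] (hs : IntegralEq.IsSupportFamily ν s)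
    (ht : IntegralEq.IsSupportFamily ζ t) (c : Fin k → Fin k' → ℝ) :
    ∫ p, stepFun s t c p ∂(ν.prod ζ) = ∑ j, ∑ l, c j l * (ν.real (s j) * ζ.real (t l)) := by
  have hi : ∀ j l, Integrable ((s j ×ˢ t l).indicator fun _ => c j l) (ν.prod ζ) := by
    intro j l
    refine (integrable_indicator_iff ((hs.measurableSet j).prod (ht.measurableSet l))).2 ?_
    refine integrableOn_const ?_
    rw [Measure.prod_prod]
    exact (ENNReal.mul_lt_top (hs.lt_top j) (ht.lt_top l)).ne
  unfold stepFun
  rw [integral_finsetSum _ fun j _ => integrable_finsetSum _ fun l _ => hi j l]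
  refine Finset.sum_congr rfl fun j _ => ?_
  rw [integral_finsetSum _ fun l _ => hi j l]
  refine Finset.sum_congr rfl fun l _ => ?_
  rw [integral_indicator_const _ ((hs.measurableSet j).prod (ht.measurableSet l)), smul_eq_mul,
    mul_comm, measureReal_prod_prod]

end StepIntegral

/-- The marginal density is the integral of the joint density. -/
theorem integral_toReal_rnDeriv_prod {Ω Y X : Type*} [MeasurableSpace Ω] [MeasurableSpace Y]
    [MeasurableSpace X] {P : Measure Ω}
    [IsProbabilityMeasure P] [StandardBorelSpace Y] [Nonempty Y] {f : Ω → Y} {k : Ω → X}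
    (hf : Measurable f) (hk : Measurable k) (μ : Measure Y) (ζ : Measure X) [SigmaFinite μ]
    [SigmaFinite ζ] (hPk : P.map k ≪ ζ) (hPfk : P.map (fun o => (f o, k o)) ≪ μ.prod ζ) :
    (fun x => ∫ y, ((P.map fun o => (f o, k o)).rnDeriv (μ.prod ζ) (y, x)).toReal ∂μ)
      =ᵐ[ζ] fun x => ((P.map k).rnDeriv ζ x).toReal := by
  have hP' := Measure.isProbabilityMeasure_map (μ := P) hk.aemeasurable
  have hP'' := Measure.isProbabilityMeasure_map (μ := P) (hf.prodMk hk).aemeasurable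
  filter_upwards [rnDeriv_mul_condDistrib hf hk μ ζ hPk hPfk MeasurableSet.univ,
    Measure.rnDeriv_lt_top (P.map k) ζ] with x h1 h2
  simp only [measure_univ, mul_one, Measure.restrict_univ] at h1
  have hm : Measurable fun y => (P.map fun o => (f o, k o)).rnDeriv (μ.prod ζ) (y, x) :=
    (Measure.measurable_rnDeriv _ _).comp (by fun_prop)
  rw [integral_toReal hm.aemeasurable (ae_lt_top hm (by rw [← h1]; exact h2.ne)), h1]

/-! ### Laws with prescribed parameter values near a conditionally independent law -/

namespace IntegralEq

variable {dz dw dx : ℕ} {B : BaseMeasures dz dw dx}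

/-- Positive step functions on common cells that approximate three given functions. -/
theorem BaseMeasures.Admissible.exists_cells (hB : B.Admissible) (hY : B.muY ≠ 0) (hZ : B.muZ ≠ 0)
    (hW : B.muW ≠ 0) {fY : ℝ × Vec dx → ℝ} {fZ : Vec dz × Vec dx → ℝ} {fW : Vec dw × Vec dx → ℝ}
    (mY : Measurable fY) (mZ : Measurable fZ) (mW : Measurable fW)
    (fY0 : 0 ≤ fY) (fZ0 : 0 ≤ fZ) (fW0 : 0 ≤ fW)
    (iY : Integrable fY (B.muY.prod B.muX)) (iZ : Integrable fZ (B.muZ.prod B.muX))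
    (iW : Integrable fW (B.muW.prod B.muX)) {ε : ℝ≥0∞} (hε : ε ≠ 0) :
    ∃ (E : Cells B) (cY : Fin E.kY → Fin E.kX → ℝ) (cZ cW : Fin E.K → Fin E.kX → ℝ),
      (∀ h l, 0 < cY h l) ∧ (∀ i l, 0 < cZ i l) ∧ (∀ j l, 0 < cW j l) ∧
      eLpNorm (fY - stepFun E.sY E.sX cY) 1 (B.muY.prod B.muX) ≤ ε ∧
      eLpNorm (fZ - stepFun E.sZ E.sX cZ) 1 (B.muZ.prod B.muX) ≤ ε ∧
      eLpNorm (fW - stepFun E.sW E.sX cW) 1 (B.muW.prod B.muX) ≤ ε ∧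
      ∃ h₁ h₂, E.meanY h₁ ≠ E.meanY h₂ := by
  classical
  have := hB.sigmaFinite_muY
  have := hB.sigmaFinite_muX
  have := hB.sigmaFinite_muZ
  have := hB.sigmaFinite_muW
  let T : ℕ → Set ℝ := fun n => spanningSets B.muY n ∩ Metric.closedBall 0 n
  have hT : IsExhaustion B.muY T := by
    refine ⟨fun n => (measurableSet_spanningSets _ n).inter Metric.isClosed_closedBall.measurableSet,
      fun n => (measure_mono Set.inter_subset_left).trans_lt (measure_spanningSets_lt_top _ n),
      fun i j hij => Set.inter_subset_inter (monotone_spanningSets _ hij)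
        (Metric.closedBall_subset_closedBall (by exact_mod_cast hij)), ?_⟩
    refine Set.eq_univ_of_forall fun y => ?_
    obtain ⟨i, hi⟩ := Set.mem_iUnion.1 ((iUnion_spanningSets B.muY).symm ▸ Set.mem_univ y)
    obtain ⟨j, hj⟩ := exists_nat_ge ‖y‖
    refine Set.mem_iUnion.2 ⟨max i j, monotone_spanningSets _ (le_max_left i j) hi, ?_⟩
    rw [mem_closedBall_zero_iff]
    exact hj.trans (by exact_mod_cast le_max_right i j)
  have hTX := isExhaustion_spanningSets B.muX
  obtain ⟨𝒜, 𝒳, hA, hX, happ⟩ := exists_collections_stepFun hT hTX mY fY0 iY hε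
  obtain ⟨𝒜', 𝒳', hA', hX', happ'⟩ := exists_collections_stepFun
    (isExhaustion_spanningSets B.muZ) hTX mZ fZ0 iZ hε
  obtain ⟨𝒜'', 𝒳'', hA'', hX'', happ''⟩ := exists_collections_stepFun
    (isExhaustion_spanningSets B.muW) hTX mW fW0 iW hε
  obtain ⟨kY, sY, hsY, adY, hint, hmean⟩ := hB.exists_family_Y hY 𝒜 (fun A h => (hA A h).1)
    (fun A h => by
      obtain ⟨n, hn⟩ := (hA A h).2
      exact (measure_mono hn).trans_lt (hT.lt_top n))
    (fun A h => by
      obtain ⟨n, hn⟩ := (hA A h).2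
      exact Metric.isBounded_closedBall.subset (hn.trans Set.inter_subset_right))
  obtain ⟨K, sZ, sW, hsZ, hsW, adZ, adW⟩ := hB.exists_families_ZW hZ hW 𝒜' 𝒜''
    (fun A h => (hA' A h).1)
    (fun A h => by
      obtain ⟨n, hn⟩ := (hA' A h).2
      exact (measure_mono hn).trans_lt (measure_spanningSets_lt_top _ n))
    (fun A h => (hA'' A h).1)
    (fun A h => by
      obtain ⟨n, hn⟩ := (hA'' A h).2
      exact (measure_mono hn).trans_lt (measure_spanningSets_lt_top _ n))
  have hXall : ∀ A ∈ 𝒳 ∪ (𝒳' ∪ 𝒳''), MeasurableSet A ∧ ∃ n, A ⊆ spanningSets B.muX n := by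
    intro A h
    simp only [Finset.mem_union] at h
    obtain h | h | h := h
    exacts [hX A h, hX' A h, hX'' A h]
  -- One family for X adapted to the sets from all three approximations, so that the three step
  -- functions live on common cells.
  obtain ⟨kX, sX, hsX, adX, -⟩ := exists_isSupportFamily_isAdapted (ν := B.muX)
    (𝒳 ∪ (𝒳' ∪ 𝒳'')) (fun A h => (hXall A h).1) (fun A h => by
      obtain ⟨n, hn⟩ := (hXall A h).2
      exact (measure_mono hn).trans_lt (measure_spanningSets_lt_top _ n))
  obtain ⟨cY, pY, eY⟩ := happ kY kX sY sX hsY hsX adY fun A h => adX A (by simp [h])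
  obtain ⟨cZ, pZ, eZ⟩ := happ' K kX sZ sX hsZ hsX adZ fun A h => adX A (by simp [h])
  obtain ⟨cW, pW, eW⟩ := happ'' K kX sW sX hsW hsX adW fun A h => adX A (by simp [h])
  exact ⟨⟨kY, K, kX, sY, sZ, sW, sX, hsY, hsZ, hsW, hsX, hint⟩, cY, cZ, cW, pY, pZ, pW, eY, eZ, eW,
    hmean⟩

namespace Cells

variable (E : Cells B) [SigmaFinite B.muY] [SigmaFinite B.muZ] [SigmaFinite B.muW]
  [SigmaFinite B.muX]

/-- A conditionally independent law that is uniform on the cells, from positive step functions. -/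
theorem exists_base_law {cY : Fin E.kY → Fin E.kX → ℝ} {cZ cW : Fin E.K → Fin E.kX → ℝ}
    (posY : ∀ h l, 0 < cY h l) (posZ : ∀ i l, 0 < cZ i l) (posW : ∀ j l, 0 < cW j l)
    (hY : 0 < E.kY) (hK : 0 < E.K) (hX : 0 < E.kX) :
    ∃ (w : Fin E.kX → ℝ) (a : Fin E.kY → Fin E.kX → ℝ) (b d : Fin E.K → Fin E.kX → ℝ),
      (∀ l, 0 < w l) ∧ (∀ h l, 0 < a h l) ∧ (∀ i l, 0 < b i l) ∧ (∀ j l, 0 < d j l) ∧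
      (∑ l, w l = 1) ∧ (∀ l, ∑ h, a h l = 1) ∧ (∀ l, ∑ i, b i l = 1) ∧ (∀ l, ∑ j, d j l = 1) ∧
      ∀ o, E.mixDensity (fun h i j l => w l * a h l * b i l * d j l) o =
        stepFun E.sY E.sX cY (pY o, pX o)
            / (∫ p, stepFun E.sY E.sX cY p ∂(B.muY.prod B.muX)) *
          (stepFun E.sZ E.sX cZ (pZX o) / ∫ z, stepFun E.sZ E.sX cZ (z, pX o) ∂B.muZ) *
          (stepFun E.sW E.sX cW (pWX o) / ∫ w, stepFun E.sW E.sX cW (w, pX o) ∂B.muW) := by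
  have : Nonempty (Fin E.kY) := ⟨⟨0, hY⟩⟩
  have : Nonempty (Fin E.K) := ⟨⟨0, hK⟩⟩
  have : Nonempty (Fin E.kX) := ⟨⟨0, hX⟩⟩
  have nY : ∀ h, 0 < B.muY.real (E.sY h) := fun h =>
    ENNReal.toReal_pos (E.hY.pos h).ne' (E.hY.lt_top h).ne
  have nZ : ∀ h, 0 < B.muZ.real (E.sZ h) := fun h =>
    ENNReal.toReal_pos (E.hZ.pos h).ne' (E.hZ.lt_top h).ne
  have nW : ∀ h, 0 < B.muW.real (E.sW h) := fun h =>
    ENNReal.toReal_pos (E.hW.pos h).ne' (E.hW.lt_top h).ne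
  have nX : ∀ h, 0 < B.muX.real (E.sX h) := fun h =>
    ENNReal.toReal_pos (E.hX.pos h).ne' (E.hX.lt_top h).ne
  set MY : Fin E.kX → ℝ := fun l => ∑ h, cY h l * B.muY.real (E.sY h) with hMY
  set MZ : Fin E.kX → ℝ := fun l => ∑ h, cZ h l * B.muZ.real (E.sZ h) with hMZ
  set MW : Fin E.kX → ℝ := fun l => ∑ h, cW h l * B.muW.real (E.sW h) with hMW
  have MY0 : ∀ l, 0 < MY l := fun l =>
    Finset.sum_pos (fun h _ => mul_pos (posY h l) (nY h)) Finset.univ_nonempty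
  have MZ0 : ∀ l, 0 < MZ l := fun l =>
    Finset.sum_pos (fun h _ => mul_pos (posZ h l) (nZ h)) Finset.univ_nonempty
  have MW0 : ∀ l, 0 < MW l := fun l =>
    Finset.sum_pos (fun h _ => mul_pos (posW h l) (nW h)) Finset.univ_nonempty
  set M : ℝ := ∑ l, MY l * B.muX.real (E.sX l) with hM
  have M0 : 0 < M := Finset.sum_pos (fun l _ => mul_pos (MY0 l) (nX l)) Finset.univ_nonempty
  have hMint : ∫ p, stepFun E.sY E.sX cY p ∂(B.muY.prod B.muX) = M := by
    rw [integral_stepFun E.hY E.hX, hM, Finset.sum_comm]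
    refine Finset.sum_congr rfl fun l _ => ?_
    rw [hMY, Finset.sum_mul]
    exact Finset.sum_congr rfl fun h _ => by ring
  -- The law of the X cell and that of Y given X come from `cY`, normalized by its total mass M. The
  -- functions `cZ` and `cW` supply only conditional laws, each normalized by its own integral at
  -- fixed x; this makes the mass exactly 1.
  refine ⟨fun l => MY l * B.muX.real (E.sX l) / M, fun h l => cY h l * B.muY.real (E.sY h) / MY l,
    fun i l => cZ i l * B.muZ.real (E.sZ i) / MZ l, fun j l => cW j l * B.muW.real (E.sW j) / MW l,
    fun l => div_pos (mul_pos (MY0 l) (nX l)) M0,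
    fun h l => div_pos (mul_pos (posY h l) (nY h)) (MY0 l),
    fun i l => div_pos (mul_pos (posZ i l) (nZ i)) (MZ0 l),
    fun j l => div_pos (mul_pos (posW j l) (nW j)) (MW0 l), ?_, fun l => ?_, fun l => ?_, fun l => ?_,
    fun o => ?_⟩
  · rw [← Finset.sum_div, div_self M0.ne']
  · rw [← Finset.sum_div, div_self (MY0 l).ne']
  · rw [← Finset.sum_div, div_self (MZ0 l).ne']
  · rw [← Finset.sum_div, div_self (MW0 l).ne']
  rw [hMint, E.mixDensity_eq]
  by_cases hc : ∃ c, o ∈ E.cell c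
  · obtain ⟨⟨h, i, j, l⟩, hc⟩ := hc
    have ho := hc
    obtain ⟨h1, h2, h3, h4⟩ := hc
    change o.1 ∈ E.sY h at h1
    change o.2.1 ∈ E.sZ i at h2
    change o.2.2.1 ∈ E.sW j at h3
    change o.2.2.2 ∈ E.sX l at h4
    rw [Finset.sum_eq_single (h, i, j, l), Set.indicator_of_mem ho,
      stepFun_of_mem (p := (pY o, pX o)) E.hY.disjoint E.hX.disjoint h1 h4,
      stepFun_of_mem (p := pZX o) E.hZ.disjoint E.hX.disjoint h2 h4,
      stepFun_of_mem (p := pWX o) E.hW.disjoint E.hX.disjoint h3 h4,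
      integral_stepFun_left (x := pX o) E.hZ E.hX.disjoint cZ h4,
      integral_stepFun_left (x := pX o) E.hW E.hX.disjoint cW h4, E.mu_cell]
    · simp only [ENNReal.toReal_mul]
      change MY l * B.muX.real (E.sX l) / M * (cY h l * B.muY.real (E.sY h) / MY l) *
          (cZ i l * B.muZ.real (E.sZ i) / MZ l) * (cW j l * B.muW.real (E.sW j) / MW l) /
          (B.muY.real (E.sY h) * (B.muZ.real (E.sZ i) * (B.muW.real (E.sW j) * B.muX.real (E.sX l))))
        = cY h l / M * (cZ i l / MZ l) * (cW j l / MW l)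
      have := (nY h).ne'
      have := (nZ i).ne'
      have := (nW j).ne'
      have := (nX l).ne'
      have := (MY0 l).ne'
      have := (MZ0 l).ne'
      have := (MW0 l).ne'
      field_simp
    · rintro ⟨h', i', j', l'⟩ - hne
      refine Set.indicator_of_notMem (fun ho' => hne ?_) _
      obtain ⟨h1', h2', h3', h4'⟩ := ho'
      have q1 : h' = h := by
        by_contra hq; exact (E.hY.disjoint hq).le_bot ⟨h1', h1⟩
      have q2 : i' = i := by
        by_contra hq; exact (E.hZ.disjoint hq).le_bot ⟨h2', h2⟩
      have q3 : j' = j := by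
        by_contra hq; exact (E.hW.disjoint hq).le_bot ⟨h3', h3⟩
      have q4 : l' = l := by
        by_contra hq; exact (E.hX.disjoint hq).le_bot ⟨h4', h4⟩
      rw [q1, q2, q3, q4]
    · simp
  · rw [Finset.sum_eq_zero fun c _ => Set.indicator_of_notMem (fun h => hc ⟨c, h⟩) _]
    symm
    by_cases h4 : ∃ l, pX o ∈ E.sX l
    · obtain ⟨l, h4⟩ := h4
      by_cases h1 : ∃ h, pY o ∈ E.sY h
      · obtain ⟨h, h1⟩ := h1
        by_cases h2 : ∃ i, pZ o ∈ E.sZ i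
        · obtain ⟨i, h2⟩ := h2
          have h3 : ∀ j, pW o ∉ E.sW j := fun j h3 => hc ⟨(h, i, j, l), h1, h2, h3, h4⟩
          rw [stepFun_of_forall_notMem_left (p := pWX o) h3, zero_div, mul_zero]
        · rw [stepFun_of_forall_notMem_left (p := pZX o) fun i hi => h2 ⟨i, hi⟩, zero_div, mul_zero,
            zero_mul]
      · rw [stepFun_of_forall_notMem_left (p := (pY o, pX o)) fun i hi => h1 ⟨i, hi⟩,
          zero_div, zero_mul, zero_mul]
    · rw [stepFun_of_forall_notMem_right (p := (pY o, pX o)) fun i hi => h4 ⟨i, hi⟩,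
        zero_div, zero_mul, zero_mul]

/-- The density depends continuously on the cell probabilities, uniformly in the observation. -/
theorem exists_forall_abs_mixDensity_sub_le {r : ℝ} (hr : 0 < r) :
    ∃ δ : ℝ, 0 < δ ∧ ∀ π π' : Fin E.kY → Fin E.K → Fin E.K → Fin E.kX → ℝ,
      (∀ h i j l, |π h i j l - π' h i j l| ≤ δ) →
      ∀ o, |E.mixDensity π o - E.mixDensity π' o| ≤ r := by
  set N : ℝ := ∑ c : E.Idx, ((B.mu (E.cell c)).toReal)⁻¹ with hN
  have hN0 : 0 ≤ N := Finset.sum_nonneg fun c _ => inv_nonneg.2 ENNReal.toReal_nonneg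
  refine ⟨r / (N + 1), by positivity, fun π π' h o => ?_⟩
  rw [E.mixDensity_eq, E.mixDensity_eq, ← Finset.sum_sub_distrib]
  refine (Finset.abs_sum_le_sum_abs _ _).trans ?_
  have hc : ∀ c ∈ (Finset.univ : Finset E.Idx),
      |(E.cell c).indicator (fun _ => π c.1 c.2.1 c.2.2.1 c.2.2.2 / (B.mu (E.cell c)).toReal) o -
        (E.cell c).indicator (fun _ => π' c.1 c.2.1 c.2.2.1 c.2.2.2 / (B.mu (E.cell c)).toReal) o|
      ≤ r / (N + 1) * ((B.mu (E.cell c)).toReal)⁻¹ := by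
    intro c _
    by_cases ho : o ∈ E.cell c
    · rw [Set.indicator_of_mem ho, Set.indicator_of_mem ho, ← sub_div, abs_div,
        abs_of_nonneg (ENNReal.toReal_nonneg (a := B.mu (E.cell c))), div_eq_mul_inv]
      exact mul_le_mul_of_nonneg_right (h _ _ _ _) (inv_nonneg.2 ENNReal.toReal_nonneg)
    · rw [Set.indicator_of_notMem ho, Set.indicator_of_notMem ho, sub_zero, abs_zero]
      positivity
  refine (Finset.sum_le_sum hc).trans ?_
  rw [← Finset.mul_sum, ← hN, div_mul_eq_mul_div, div_le_iff₀ (by positivity)]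
  nlinarith

end Cells

variable {dz dw dx : ℕ} {B : BaseMeasures dz dw dx}

/-- Cell probabilities under which the cells of `Y`, `Z`, `W` are independent given that of `X`. -/
structure BaseLaw (E : Cells B) where
  /-- the probabilities of the cells of `X` -/
  w : Fin E.kX → ℝ
  /-- the conditional probabilities of the cells of `Y` -/
  a : Fin E.kY → Fin E.kX → ℝ
  /-- the conditional probabilities of the cells of `Z` -/
  b : Fin E.K → Fin E.kX → ℝ
  /-- the conditional probabilities of the cells of `W` -/
  d : Fin E.K → Fin E.kX → ℝ
  w_pos : ∀ l, 0 < w l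
  a_pos : ∀ h l, 0 < a h l
  b_pos : ∀ i l, 0 < b i l
  d_pos : ∀ j l, 0 < d j l
  sum_w : ∑ l, w l = 1
  sum_a : ∀ l, ∑ h, a h l = 1
  sum_b : ∀ l, ∑ i, b i l = 1
  sum_d : ∀ l, ∑ j, d j l = 1

namespace BaseLaw

variable {E : Cells B} (L : BaseLaw E)

/-- The probabilities of the cells. -/
def prob (h : Fin E.kY) (i j : Fin E.K) (l : Fin E.kX) : ℝ := L.w l * L.a h l * L.b i l * L.d j l

theorem prob_pos (h i j l) : 0 < L.prob h i j l :=
  mul_pos (mul_pos (mul_pos (L.w_pos l) (L.a_pos h l)) (L.b_pos i l)) (L.d_pos j l)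

theorem sum_prob : ∑ h, ∑ i, ∑ j, ∑ l, L.prob h i j l = 1 := by
  rw [sum_comm_four_right]
  have : ∀ j l, ∑ h, ∑ i, L.prob h i j l = L.w l * L.d j l := by
    intro j l
    have h1 : ∀ h, ∑ i, L.prob h i j l = L.w l * L.d j l * L.a h l := by
      intro h
      simp only [prob]
      rw [← Finset.sum_mul, ← Finset.mul_sum, L.sum_b]; ring
    simp only [h1]
    rw [← Finset.mul_sum, L.sum_a, mul_one]
  simp only [this]
  rw [Finset.sum_comm]
  simp only [← Finset.mul_sum, L.sum_d, mul_one, L.sum_w]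

/-- The law with the given cell probabilities. -/
noncomputable def law : ProbabilityMeasure (Obs dz dw dx) :=
  ⟨E.mix L.prob, E.isProbabilityMeasure_mix L.prob_pos L.sum_prob⟩

theorem coe_law : (L.law : Measure (Obs dz dw dx)) = E.mix L.prob := rfl

end BaseLaw

/-- An empty family gives the zero step function, whose L¹ distance from a function with integral 1
is at least 1. -/
theorem pos_of_eLpNorm_sub_stepFun_le {V X : Type*} [MeasurableSpace V] [MeasurableSpace X]
    {μ : Measure (V × X)} {k k' : ℕ} {s : Fin k → Set V} {t : Fin k' → Set X}
    {c : Fin k → Fin k' → ℝ} {f : V × X → ℝ} (h1 : ∫ p, f p ∂μ = 1)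
    (h : eLpNorm (f - stepFun s t c) 1 μ ≤ 2⁻¹) : 0 < k ∧ 0 < k' := by
  rw [Nat.pos_iff_ne_zero, Nat.pos_iff_ne_zero, ← not_or]
  intro hk
  have h0 : stepFun s t c = 0 := by
    funext p
    obtain rfl | rfl := hk <;> simp [stepFun]
  rw [h0, sub_zero, eLpNorm_one_eq_lintegral_enorm] at h
  have h2 : ‖∫ p, f p ∂μ‖ₑ ≤ 2⁻¹ := (enorm_integral_le_lintegral_enorm f).trans h
  rw [h1, enorm_one] at h2
  exact absurd h2 (not_le.2 (by simp))

section Sequence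

variable {P : ProbabilityMeasure (Obs dz dw dx)}

theorem Dominated.mu_ne_zero (hdom : Dominated B P) : B.mu ≠ 0 := by
  intro h0
  rw [Dominated, h0, Measure.absolutelyContinuous_zero_iff] at hdom
  exact IsProbabilityMeasure.ne_zero (P : Measure (Obs dz dw dx)) hdom

/-- A conditionally independent law is approximated by conditionally independent laws that are
uniform on cells. -/
theorem exists_base_sequence (hB : B.Admissible) (hdom : Dominated B P)
    (hpos : ∀ᵐ x ∂B.muX, 0 < ((P : Measure (Obs dz dw dx)).map pX).rnDeriv B.muX x)
    (h1 : CondIndepFun (sigmaX dz dw dx) (sigmaX_le dz dw dx) pYW pZ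
      (P : Measure (Obs dz dw dx)))
    (h2 : CondIndepFun (sigmaX dz dw dx) (sigmaX_le dz dw dx) pY pW
      (P : Measure (Obs dz dw dx))) :
    ∃ (E : ℕ → Cells B) (L : ∀ n, BaseLaw (E n)),
      (∀ n, ∃ i j, (E n).meanY i ≠ (E n).meanY j) ∧
      ∀ᵐ o ∂B.mu, Tendsto (fun n => (E n).mixDensity (L n).prob o) atTop
        (𝓝 (density B P o).toReal) := by
  have := hB.sigmaFinite_muY
  have := hB.sigmaFinite_muX
  have := hB.sigmaFinite_muZ
  have := hB.sigmaFinite_muW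
  have hmu := hdom.mu_ne_zero
  have hY : B.muY ≠ 0 := by
    intro h; apply hmu; rw [BaseMeasures.mu, h, Measure.zero_prod]
  have hZ : B.muZ ≠ 0 := by
    intro h; apply hmu; rw [BaseMeasures.mu, h, Measure.zero_prod, Measure.prod_zero]
  have hW : B.muW ≠ 0 := by
    intro h; apply hmu
    rw [BaseMeasures.mu, h, Measure.zero_prod, Measure.prod_zero, Measure.prod_zero]
  set rY := ((P : Measure (Obs dz dw dx)).map fun o => (pY o, pX o)).rnDeriv (B.muY.prod B.muX)
    with hrY
  set rZ := ((P : Measure (Obs dz dw dx)).map pZX).rnDeriv (B.muZ.prod B.muX) with hrZ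
  set rW := ((P : Measure (Obs dz dw dx)).map pWX).rnDeriv (B.muW.prod B.muX) with hrW
  set rX := ((P : Measure (Obs dz dw dx)).map pX).rnDeriv B.muX with hrX
  have acX : (P : Measure (Obs dz dw dx)).map pX ≪ B.muX :=
    (hdom.map measurable_pX).trans quasiMeasurePreserving_pX.absolutelyContinuous
  have acY : (P : Measure (Obs dz dw dx)).map (fun o => (pY o, pX o)) ≪ B.muY.prod B.muX :=
    (hdom.map (measurable_pY.prodMk measurable_pX)).trans
      quasiMeasurePreserving_pYX.absolutelyContinuous
  have acZ : (P : Measure (Obs dz dw dx)).map pZX ≪ B.muZ.prod B.muX :=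
    (hdom.map measurable_pZX).trans quasiMeasurePreserving_pZX.absolutelyContinuous
  have acW : (P : Measure (Obs dz dw dx)).map pWX ≪ B.muW.prod B.muX :=
    (hdom.map measurable_pWX).trans quasiMeasurePreserving_pWX.absolutelyContinuous
  have pmX := Measure.isProbabilityMeasure_map (μ := (P : Measure (Obs dz dw dx)))
    (measurable_pX (dz := dz) (dw := dw) (dx := dx)).aemeasurable
  have pmY := Measure.isProbabilityMeasure_map (μ := (P : Measure (Obs dz dw dx)))
    ((measurable_pY (dz := dz) (dw := dw) (dx := dx)).prodMk measurable_pX).aemeasurable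
  have pmZ := Measure.isProbabilityMeasure_map (μ := (P : Measure (Obs dz dw dx)))
    (measurable_pZX (dz := dz) (dw := dw) (dx := dx)).aemeasurable
  have pmW := Measure.isProbabilityMeasure_map (μ := (P : Measure (Obs dz dw dx)))
    (measurable_pWX (dz := dz) (dw := dw) (dx := dx)).aemeasurable
  set fY : ℝ × Vec dx → ℝ := fun p => (rY p).toReal
  set fZ : Vec dz × Vec dx → ℝ := fun p => (rZ p).toReal
  set fW : Vec dw × Vec dx → ℝ := fun p => (rW p).toReal
  have mY : Measurable fY := (Measure.measurable_rnDeriv _ _).ennreal_toReal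
  have mZ : Measurable fZ := (Measure.measurable_rnDeriv _ _).ennreal_toReal
  have mW : Measurable fW := (Measure.measurable_rnDeriv _ _).ennreal_toReal
  have iY : Integrable fY (B.muY.prod B.muX) := Measure.integrable_toReal_rnDeriv
  have iZ : Integrable fZ (B.muZ.prod B.muX) := Measure.integrable_toReal_rnDeriv
  have iW : Integrable fW (B.muW.prod B.muX) := Measure.integrable_toReal_rnDeriv
  have tY : ∫ p, fY p ∂(B.muY.prod B.muX) = 1 := by
    rw [Measure.integral_toReal_rnDeriv acY]; simp
  have tZ : ∫ p, fZ p ∂(B.muZ.prod B.muX) = 1 := by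
    rw [Measure.integral_toReal_rnDeriv acZ]; simp
  -- The exponent n + 1 keeps the error at most 1/2 already for n = 0, which rules out empty
  -- families; the geometric rate yields a.e. convergence.
  have hε : ∀ n : ℕ, (2⁻¹ : ℝ≥0∞) ^ (n + 1) ≠ 0 := fun n => pow_ne_zero _ (by simp)
  have hε1 : ∀ n : ℕ, (2⁻¹ : ℝ≥0∞) ^ (n + 1) ≤ 2⁻¹ ^ n := fun n =>
    pow_le_pow_right_of_le_one' (by simp) (Nat.le_succ n)
  have hε2 : ∀ n : ℕ, (2⁻¹ : ℝ≥0∞) ^ (n + 1) ≤ 2⁻¹ := fun n => by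
    conv_rhs => rw [← pow_one (2⁻¹ : ℝ≥0∞)]
    exact pow_le_pow_right_of_le_one' (by simp) (by omega)
  choose E cY cZ cW posY posZ posW eY eZ eW hmean using fun n : ℕ =>
    hB.exists_cells hY hZ hW mY mZ mW (fun _ => ENNReal.toReal_nonneg)
      (fun _ => ENNReal.toReal_nonneg) (fun _ => ENNReal.toReal_nonneg) iY iZ iW (hε n)
  choose w a b d w0 a0 b0 d0 w1 a1 b1 d1 hform using fun n : ℕ =>
    (E n).exists_base_law (posY n) (posZ n) (posW n)
      (pos_of_eLpNorm_sub_stepFun_le tY ((eY n).trans (hε2 n))).1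
      (pos_of_eLpNorm_sub_stepFun_le tZ ((eZ n).trans (hε2 n))).1
      (pos_of_eLpNorm_sub_stepFun_le tZ ((eZ n).trans (hε2 n))).2
  refine ⟨E, fun n => ⟨w n, a n, b n, d n, w0 n, a0 n, b0 n, d0 n, w1 n, a1 n, b1 n, d1 n⟩, hmean,
    ?_⟩
  have msY : ∀ n, Measurable (stepFun (E n).sY (E n).sX (cY n)) := fun n =>
    measurable_stepFun (E n).hY.measurableSet (E n).hX.measurableSet
  have msZ : ∀ n, Measurable (stepFun (E n).sZ (E n).sX (cZ n)) := fun n =>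
    measurable_stepFun (E n).hZ.measurableSet (E n).hX.measurableSet
  have msW : ∀ n, Measurable (stepFun (E n).sW (E n).sX (cW n)) := fun n =>
    measurable_stepFun (E n).hW.measurableSet (E n).hX.measurableSet
  have isY : ∀ n, Integrable (stepFun (E n).sY (E n).sX (cY n)) (B.muY.prod B.muX) := fun n =>
    integrable_stepFun (E n).hY (E n).hX _
  have isZ : ∀ n, Integrable (stepFun (E n).sZ (E n).sX (cZ n)) (B.muZ.prod B.muX) := fun n =>
    integrable_stepFun (E n).hZ (E n).hX _
  have isW : ∀ n, Integrable (stepFun (E n).sW (E n).sX (cW n)) (B.muW.prod B.muX) := fun n =>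
    integrable_stepFun (E n).hW (E n).hX _
  have limC : Tendsto (fun n => ∫ p, stepFun (E n).sY (E n).sX (cY n) p ∂(B.muY.prod B.muX)) atTop
      (𝓝 1) := by
    rw [← tY]
    refine tendsto_integral_of_L1' fY iY.1 (Eventually.of_forall isY) ?_
    refine tendsto_of_tendsto_of_tendsto_of_le_of_le tendsto_const_nhds
      (ENNReal.tendsto_pow_atTop_nhds_zero_of_lt_one (by simp : (2⁻¹ : ℝ≥0∞) < 1))
      (fun _ => zero_le) fun n => ?_
    rw [← neg_sub, eLpNorm_neg]
    exact (eY n).trans (hε1 n)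
  have limY := quasiMeasurePreserving_pYX.ae (ae_tendsto_of_eLpNorm_sub_le iY.1
    (fun n => (isY n).1) fun n => (eY n).trans (hε1 n))
  have limZ := quasiMeasurePreserving_pZX.ae (ae_tendsto_of_eLpNorm_sub_le iZ.1
    (fun n => (isZ n).1) fun n => (eZ n).trans (hε1 n))
  have limW := quasiMeasurePreserving_pWX.ae (ae_tendsto_of_eLpNorm_sub_le iW.1
    (fun n => (isW n).1) fun n => (eW n).trans (hε1 n))
  -- The normalizing integrals converge at the same rate, since integrating out z contracts the L¹
  -- distance.
  have limZX := (quasiMeasurePreserving_pX (B := B)).ae (ae_tendsto_of_eLpNorm_sub_le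
    (f := fun x => ∫ z, fZ (z, x) ∂B.muZ)
    (g := fun n x => ∫ z, stepFun (E n).sZ (E n).sX (cZ n) (z, x) ∂B.muZ)
    iZ.integral_prod_right.1 (fun n => (isZ n).integral_prod_right.1)
    fun n => (eLpNorm_integral_sub_le iZ (isZ n)).trans ((eZ n).trans (hε1 n)))
  have limWX := (quasiMeasurePreserving_pX (B := B)).ae (ae_tendsto_of_eLpNorm_sub_le
    (f := fun x => ∫ z, fW (z, x) ∂B.muW)
    (g := fun n x => ∫ z, stepFun (E n).sW (E n).sX (cW n) (z, x) ∂B.muW)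
    iW.integral_prod_right.1 (fun n => (isW n).integral_prod_right.1)
    fun n => (eLpNorm_integral_sub_le iW (isW n)).trans ((eW n).trans (hε1 n)))
  have margZ := (quasiMeasurePreserving_pX (B := B)).ae
    (integral_toReal_rnDeriv_prod measurable_pZ measurable_pX B.muZ B.muX acX acZ)
  have margW := (quasiMeasurePreserving_pX (B := B)).ae
    (integral_toReal_rnDeriv_prod measurable_pW measurable_pX B.muW B.muX acX acW)
  filter_upwards [limY, limZ, limW, limZX, limWX, margZ, margW,
    (quasiMeasurePreserving_pX (B := B)).ae hpos,
    (quasiMeasurePreserving_pX (B := B)).ae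
      (Measure.rnDeriv_lt_top ((P : Measure (Obs dz dw dx)).map pX) B.muX),
    density_eq_of_condIndep hdom hpos h1 h2] with o lY lZ lW lZX lWX gZ gW hx0 hxt hdens
  change ∫ z, fZ (z, pX o) ∂B.muZ = (rX (pX o)).toReal at gZ
  change ∫ z, fW (z, pX o) ∂B.muW = (rX (pX o)).toReal at gW
  rw [gZ] at lZX
  rw [gW] at lWX
  have hx : (rX (pX o)).toReal ≠ 0 := (ENNReal.toReal_pos hx0.ne' hxt.ne).ne'
  rw [hdens]
  simp only [ENNReal.toReal_mul, ENNReal.toReal_div]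
  have hlim := (((lY.div limC one_ne_zero).mul (lZ.div lZX hx)).mul (lW.div lWX hx))
  rw [div_one] at hlim
  refine hlim.congr fun n => ?_
  exact (hform n o).symm

theorem densitiesConverge_of_tendsto_mixDensity [SigmaFinite B.muY] [SigmaFinite B.muZ]
    [SigmaFinite B.muW] [SigmaFinite B.muX] {E : ℕ → Cells B}
    {π : ∀ n, Fin (E n).kY → Fin (E n).K → Fin (E n).K → Fin (E n).kX → ℝ}
    (hπ : ∀ n h i j l, 0 < π n h i j l) {Q : ℕ → ProbabilityMeasure (Obs dz dw dx)}
    (hQ : ∀ n, (Q n : Measure (Obs dz dw dx)) = (E n).mix (π n))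
    (h : ∀ᵐ o ∂B.mu, Tendsto (fun n => (E n).mixDensity (π n) o) atTop
      (𝓝 (density B P o).toReal)) : DensitiesConverge B Q P := by
  filter_upwards [h, ae_all_iff.2 fun n => (E n).density_mix (hπ n) (hQ n),
    Measure.rnDeriv_lt_top (P : Measure (Obs dz dw dx)) B.mu] with o h1 h2 h3
  simp only [h2]
  have := (ENNReal.continuous_ofReal.tendsto _).comp h1
  have h3' : density B P o ≠ ∞ := h3.ne
  rw [ENNReal.ofReal_toReal h3'] at this
  exact this

/-- If the representer is asymptotically a function of `X`, then its conditional variance given `X`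
vanishes. -/
theorem condVar_eq_zero_of_tendsto {a : Vec dw × Vec dx → ℝ} (ha : IsL2WX P a)
    {u : ℕ → Vec dx → ℝ} (hu : ∀ n, Measurable (u n))
    (h : ∀ᵐ o ∂(P : Measure (Obs dz dw dx)), Tendsto (fun n => u n (pX o)) atTop (𝓝 (a (pWX o)))) :
    condVar (sigmaX dz dw dx) (fun o => a (pWX o)) (P : Measure (Obs dz dw dx))
      =ᵐ[(P : Measure (Obs dz dw dx))] 0 := by
  have hm : AEStronglyMeasurable[sigmaX dz dw dx] (fun o => a (pWX o))
      (P : Measure (Obs dz dw dx)) := by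
    -- The limsup is a function of X that is measurable everywhere, and it agrees with the limit
    -- wherever the limit exists.
    refine ⟨fun o => limsup (fun n => u n (pX o)) atTop,
      ((Measurable.limsup hu).comp (comap_measurable pX)).stronglyMeasurable, ?_⟩
    filter_upwards [h] with o ho using ho.limsup_eq.symm
  have hi : Integrable (fun o => a (pWX o)) (P : Measure (Obs dz dw dx)) :=
    ha.memLp_comp.integrable (by norm_num)
  have h1 := condExp_of_aestronglyMeasurable' (sigmaX_le dz dw dx) hm hi
  have h2 : ((fun o => a (pWX o)) - (P : Measure (Obs dz dw dx))[fun o => a (pWX o) |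
      sigmaX dz dw dx]) ^ 2 =ᵐ[(P : Measure (Obs dz dw dx))] 0 := by
    filter_upwards [h1] with o ho
    simp [ho]
  refine (condExp_congr_ae h2).trans ?_
  rw [condExp_zero]

variable {m : Obs dz dw dx → (Vec dw × Vec dx → ℝ) → ℝ}
  {R : Set (ProbabilityMeasure (Obs dz dw dx))}

/-- Along the approximating sequence, the representer depends on `W` infinitely often. -/
theorem exists_representer_depends_on_W [SigmaFinite B.muY] [SigmaFinite B.muZ]
    [SigmaFinite B.muW] [SigmaFinite B.muX] (hm_simple : SimpleRepresenterCondition B m)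
    (hm_cont : RepresenterContinuityCondition B m) (hdom : Dominated B P)
    (hP : IsConditionallyIndependentLaw B m R P) {E : ℕ → Cells B} {L : ∀ n, BaseLaw (E n)}
    (hconv : ∀ᵐ o ∂B.mu, Tendsto (fun n => (E n).mixDensity (L n).prob o) atTop
      (𝓝 (density B P o).toReal)) (N : ℕ) :
    ∃ n, N ≤ n ∧ ∃ t, IsRieszRepresenter m (L n).law (stepFun (E n).sW (E n).sX t) ∧
      ∃ l j₁ j₂, t j₁ l ≠ t j₂ l := by
  -- Otherwise all representers from N on are functions of X. The same then holds for their a.s.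
  -- limit, the representer at P, and its conditional variance given X vanishes.
  by_contra! hc
  have hstep := fun n => (E n).exists_step_representer hm_simple (L n).prob_pos (L n).coe_law
  have hconst : ∀ k, ∃ u : Vec dx → ℝ, Measurable u ∧
      IsRieszRepresenter m (L (N + k)).law fun p => u p.2 := by
    intro k
    obtain ⟨-, t, ht⟩ := hstep (N + k)
    have htc := hc (N + k) (Nat.le_add_right N k) t ht
    obtain ⟨τ, hτ⟩ : ∃ τ : Fin (E (N + k)).kX → ℝ, ∀ j l, t j l = τ l := by
      by_cases hK : Nonempty (Fin (E (N + k)).K)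
      · obtain ⟨j₀⟩ := hK
        exact ⟨fun l => t j₀ l, fun j l => htc l j j₀⟩
      · exact ⟨0, fun j => absurd ⟨j⟩ hK⟩
    let u : Vec dx → ℝ := fun x => ∑ l, ((E (N + k)).sX l).indicator (fun _ => τ l) x
    have hu : Measurable u := Finset.measurable_fun_sum _ fun l _ =>
      measurable_const.indicator ((E (N + k)).hX.measurableSet l)
    refine ⟨u, hu, ht.congr (hu.comp measurable_snd) ?_⟩
    rw [(L (N + k)).coe_law]
    refine (E (N + k)).ae_mix fun c => ?_
    filter_upwards [(E (N + k)).stepFun_pWX_ae t c, (E (N + k)).ae_part_mem_cell c] with o h1 h2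
    rw [h1, hτ]
    have h4 : pX o ∈ (E (N + k)).sX c.2.2.2 := h2.2.2.2
    change τ c.2.2.2 = ∑ l, ((E (N + k)).sX l).indicator (fun _ => τ l) (pX o)
    rw [Finset.sum_eq_single c.2.2.2, Set.indicator_of_mem h4]
    · exact fun l _ hl => Set.indicator_of_notMem
        (fun h => ((E (N + k)).hX.disjoint hl).le_bot ⟨h, h4⟩) _
    · simp
  choose u hu hrep using hconst
  obtain ⟨a, ha⟩ := hP.continuous.exists_representer
  have hdc : DensitiesConverge B (fun k => (L (N + k)).law) P := by
    refine densitiesConverge_of_tendsto_mixDensity (E := fun k => E (N + k))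
      (π := fun k => (L (N + k)).prob) (fun k => (L (N + k)).prob_pos) (fun k => rfl) ?_
    filter_upwards [hconv] with o ho
    exact ho.comp (tendsto_add_atTop_nat N |>.congr fun k => Nat.add_comm k N)
  -- A subsequence suffices, as only the measurability of the limit with respect to X matters.
  obtain ⟨q, -, hq⟩ := hm_cont P (fun k => (L (N + k)).law) a (fun k p => u k p.2) hdom
    hP.continuous ha (fun k => (E (N + k)).dominated_mix (L (N + k)).prob_pos rfl)
    (fun k => (hstep (N + k)).1) hrep hdc
  have h0 := condVar_eq_zero_of_tendsto ha.1 (u := fun k => u (q k)) (fun k => hu (q k)) hq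
  refine (hP.condVar_pos a ha).ne' ?_
  rw [measure_eq_zero_iff_ae_notMem]
  filter_upwards [h0] with o ho
  rw [ho]
  exact lt_irrefl _

/-- Every value of the parameter is attained by laws that satisfy the conditions of the model, up to
the additional restrictions, and whose densities converge to that of `P`. -/
theorem exists_approximating_sequence (hB : B.Admissible)
    (hm_simple : SimpleRepresenterCondition B m)
    (hm_cont : RepresenterContinuityCondition B m) (hdom : Dominated B P)
    (hP : IsConditionallyIndependentLaw B m R P) (θ : ℝ) :
    ∃ Q : ℕ → ProbabilityMeasure (Obs dz dw dx), (∀ n, Dominated B (Q n) ∧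
      IsContinuousFunctional m (Q n) ∧ RepresenterInRange m (Q n) ∧ OutcomeInRange (Q n) ∧
      phi m (Q n) = θ) ∧ DensitiesConverge B Q P := by
  have := hB.sigmaFinite_muY
  have := hB.sigmaFinite_muX
  have := hB.sigmaFinite_muZ
  have := hB.sigmaFinite_muW
  obtain ⟨E, L, hmean, hconv⟩ := exists_base_sequence hB hdom hP.density_pos hP.condIndep_YW_Z
    hP.condIndep_Y_W
  -- A diagonal choice: the grid of index N n ≥ n, on which the representer depends on W, and a
  -- perturbation that moves the density by at most 1 / (n + 1) uniformly. The limit of the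
  -- densities is unchanged.
  choose N hN t ht l j₁ j₂ hne using
    exists_representer_depends_on_W hm_simple hm_cont hdom hP hconv
  choose δ hδ hclose using fun n : ℕ =>
    (E (N n)).exists_forall_abs_mixDensity_sub_le (Nat.one_div_pos_of_nat (α := ℝ) (n := n))
  choose h₁ h₂ hh using hmean
  choose π Q hπ hπδ hQ hcont hrange hout hphi using fun n : ℕ =>
    (E (N n)).exists_near_with_phi_eq hm_simple (L (N n)).w_pos (L (N n)).a_pos (L (N n)).b_pos
      (L (N n)).d_pos (L (N n)).sum_w (L (N n)).sum_a (L (N n)).sum_b (L (N n)).sum_d (hh (N n))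
      (L (N n)).coe_law (ht n) (hne n) θ (hδ n)
  refine ⟨Q, fun n => ⟨(E (N n)).dominated_mix (hπ n) (hQ n), hcont n, hrange n, hout n, hphi n⟩,
    densitiesConverge_of_tendsto_mixDensity (E := fun n => E (N n)) hπ hQ ?_⟩
  filter_upwards [hconv] with o ho
  have h1 : Tendsto (fun n => (E (N n)).mixDensity (L (N n)).prob o) atTop
      (𝓝 (density B P o).toReal) := ho.comp (tendsto_atTop_mono hN tendsto_id)
  refine h1.congr_dist ?_
  refine squeeze_zero (fun _ => dist_nonneg) (fun n => ?_) (tendsto_one_div_add_atTop_nhds_zero_nat (𝕜 := ℝ))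
  rw [dist_comm, Real.dist_eq]
  exact hclose n _ _ (hπδ n) o

end Sequence

end IntegralEq

/-! ### Laws of samples and confidence sets -/

theorem lintegral_fin_prod_eq_prod {n : ℕ} {E : Type*} [MeasurableSpace E] {μ : Measure E}
    [SigmaFinite μ] {f : Fin n → E → ℝ≥0∞} (hf : ∀ i, Measurable (f i)) :
    ∫⁻ x : Fin n → E, ∏ i, f i (x i) ∂(Measure.pi fun _ => μ) = ∏ i, ∫⁻ x, f i x ∂μ := by
  induction n with
  | zero => simp
  | succ n ih =>
    have hmp := (measurePreserving_piFinSuccAbove (fun _ : Fin (n + 1) => μ) 0).symm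
    rw [← hmp.lintegral_comp_emb (MeasurableEquiv.measurableEmbedding _)]
    simp_rw [MeasurableEquiv.piFinSuccAbove_symm_apply, Fin.insertNthEquiv, Fin.prod_univ_succ,
      Fin.insertNth_zero]
    simp only [Equiv.coe_fn_mk, Fin.cons_zero, Fin.cons_succ]
    have hm : Measurable fun x : Fin n → E => ∏ i, f i.succ (x i) :=
      Finset.measurable_fun_prod _ fun i _ => (hf i.succ).comp (measurable_pi_apply i)
    refine (lintegral_prod_mul (hf 0).aemeasurable hm.aemeasurable).trans ?_
    rw [ih fun i => hf i.succ]

/-- Both measures agree on boxes, where the integral of a product factors. The samples thus get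
product densities, to which Fatou's lemma can be applied. -/
theorem pi_withDensity {n : ℕ} {E : Type*} [MeasurableSpace E] {μ : Measure E} [SigmaFinite μ]
    {f : E → ℝ≥0∞} (hf : Measurable f) [SigmaFinite (μ.withDensity f)] :
    (Measure.pi fun _ : Fin n => μ.withDensity f) =
      (Measure.pi fun _ : Fin n => μ).withDensity fun x => ∏ i, f (x i) := by
  refine Measure.pi_eq fun s hs => ?_
  rw [withDensity_apply _ (MeasurableSet.univ_pi hs),
    ← lintegral_indicator (MeasurableSet.univ_pi hs)]
  have h : ∀ x : Fin n → E, (Set.univ.pi s).indicator (fun x => ∏ i, f (x i)) x =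
      ∏ i, (s i).indicator f (x i) := by
    intro x
    by_cases hx : x ∈ Set.univ.pi s
    · rw [Set.indicator_of_mem hx]
      exact Finset.prod_congr rfl fun i _ => (Set.indicator_of_mem (hx i trivial) f).symm
    · rw [Set.indicator_of_notMem hx]
      obtain ⟨i, hi⟩ : ∃ i, x i ∉ s i := by simpa using hx
      exact (Finset.prod_eq_zero (Finset.mem_univ i) (Set.indicator_of_notMem hi f)).symm
  simp_rw [h]
  rw [lintegral_fin_prod_eq_prod fun i => hf.indicator (hs i)]
  exact Finset.prod_congr rfl fun i _ => by
    rw [lintegral_indicator (hs i), withDensity_apply _ (hs i)]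

theorem measurableSet_setOf_eventually {Ω : Type*} [MeasurableSpace Ω] {A : ℕ → Set Ω}
    (h : ∀ k, MeasurableSet (A k)) : MeasurableSet {o | ∀ᶠ k in atTop, o ∈ A k} := by
  have h1 : {o | ∀ᶠ k in atTop, o ∈ A k} = ⋃ N, ⋂ k ≥ N, A k := by
    ext o; simp [eventually_atTop]
  rw [h1]
  exact .iUnion fun N => .iInter fun k => .iInter fun _ => h k

/-- The event is the increasing union of the tail intersections, each of which lies in one of the
sets. -/
theorem measure_setOf_eventually_le {Ω : Type*} [MeasurableSpace Ω] {μ : Measure Ω}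
    {A : ℕ → Set Ω} {c : ℝ≥0∞} (h : ∀ k, μ (A k) ≤ c) : μ {o | ∀ᶠ k in atTop, o ∈ A k} ≤ c := by
  have h1 : {o | ∀ᶠ k in atTop, o ∈ A k} = ⋃ N, ⋂ k ≥ N, A k := by
    ext o; simp [eventually_atTop]
  have h2 : Monotone fun N => ⋂ k ≥ N, A k := fun M N hMN =>
    Set.iInter₂_mono' fun k hk => ⟨k, hMN.trans hk, le_rfl⟩
  rw [h1, h2.measure_iUnion]
  exact iSup_le fun N => (measure_mono (Set.iInter₂_subset N le_rfl)).trans (h N)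

namespace IntegralEq

theorem le_diameter {C : Set ℝ} {x y : ℝ} (hx : x ∈ C) (hy : y ∈ C) :
    ((x - y : ℝ) : EReal) ≤ diameter C :=
  le_iSup₂_of_le x hx (le_iSup₂_of_le y hy le_rfl)

/-- The diameter of a non-empty set is approached by pairs of its points. -/
theorem exists_seq_tendsto_diameter {S : Set ℝ} (hS : S.Nonempty) :
    ∃ x y : ℕ → ℝ, (∀ k, x k ∈ S) ∧ (∀ k, y k ∈ S) ∧
      Tendsto (fun k => ((x k - y k : ℝ) : EReal)) atTop (𝓝 (diameter S)) := by
  let T : Set EReal := {e | ∃ x ∈ S, ∃ y ∈ S, ((x - y : ℝ) : EReal) = e}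
  have hT : diameter S = sSup T := by
    refine le_antisymm (iSup₂_le fun x hx => iSup₂_le fun y hy => le_sSup ⟨x, hx, y, hy, rfl⟩)
      (sSup_le ?_)
    rintro _ ⟨x, hx, y, hy, rfl⟩
    exact le_diameter hx hy
  obtain ⟨s, hs⟩ := hS
  obtain ⟨u, -, hu, huT⟩ := exists_seq_tendsto_sSup (S := T) ⟨_, s, hs, s, hs, rfl⟩ (OrderTop.bddAbove T)
  choose x hx y hy hxy using huT
  refine ⟨x, y, hx, hy, ?_⟩
  simp only [hxy]
  rwa [hT]

variable {dz dw dx : ℕ} {B : BaseMeasures dz dw dx} {P : ProbabilityMeasure (Obs dz dw dx)}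

theorem sampleLaw_eq_withDensity [SigmaFinite B.mu] (hP : Dominated B P) (n : ℕ) :
    sampleLaw P n = (Measure.pi fun _ : Fin n => B.mu).withDensity
      fun o => ∏ i, density B P (o i) := by
  have h : B.mu.withDensity (density B P) = (P : Measure (Obs dz dw dx)) :=
    Measure.withDensity_rnDeriv_eq _ _ hP
  have : SigmaFinite (B.mu.withDensity (density B P)) := by rw [h]; infer_instance
  rw [← pi_withDensity (f := density B P) (Measure.measurable_rnDeriv _ _), h, sampleLaw]

/-- Bounds on probabilities are preserved by convergence of the densities. -/
theorem DensitiesConverge.sampleLaw_le [SigmaFinite B.mu] {Q : ℕ → ProbabilityMeasure (Obs dz dw dx)}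
    (h : DensitiesConverge B Q P) (hP : Dominated B P) (hQ : ∀ i, Dominated B (Q i)) {n : ℕ}
    {A : Set (Fin n → Obs dz dw dx)} (hA : MeasurableSet A) {c : ℝ≥0∞}
    (hc : ∀ i, sampleLaw (Q i) n A ≤ c) : sampleLaw P n A ≤ c := by
  have hm : ∀ P : ProbabilityMeasure (Obs dz dw dx),
      Measurable fun o : Fin n → Obs dz dw dx => ∏ i, density B P (o i) := fun P =>
    Finset.measurable_fun_prod _ fun i _ =>
      (Measure.measurable_rnDeriv _ _).comp (measurable_pi_apply i)
  have hlim : ∀ᵐ o ∂(Measure.pi fun _ : Fin n => B.mu),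
      liminf (fun k => ∏ i, density B (Q k) (o i)) atTop = ∏ i, density B P (o i) := by
    have h1 : ∀ᵐ o ∂B.mu, Tendsto (fun k => density B (Q k) o) atTop (𝓝 (density B P o)) ∧
        density B P o ≠ ∞ := by
      filter_upwards [h, Measure.rnDeriv_lt_top (P : Measure (Obs dz dw dx)) B.mu] with o h1 h2
      exact ⟨h1, h2.ne⟩
    filter_upwards [ae_all_iff.2 fun i => (Measure.quasiMeasurePreserving_eval
      (fun _ : Fin n => B.mu) i).ae h1] with o ho
    exact (ENNReal.tendsto_finsetProd_of_ne_top _ (fun i _ => (ho i).1)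
      fun i _ => (ho i).2).liminf_eq
  rw [sampleLaw_eq_withDensity hP, withDensity_apply _ hA,
    ← lintegral_congr_ae (ae_restrict_of_ae hlim)]
  -- Fatou's lemma: P has on A at most the lower limit of the masses, and the n-fold densities
  -- converge because their factors have finite limits.
  refine (lintegral_liminf_le fun k => hm (Q k)).trans ?_
  refine (liminf_le_liminf (v := fun _ => c) (Eventually.of_forall fun k => ?_)).trans
    (liminf_const c).le
  have := hc k
  rwa [sampleLaw_eq_withDensity (hQ k), withDensity_apply _ hA] at this

instance isProbabilityMeasure_sampleLaw {Ω : Type*} [MeasurableSpace Ω] (P : ProbabilityMeasure Ω)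
    (n : ℕ) : IsProbabilityMeasure (sampleLaw P n) := by
  unfold sampleLaw; infer_instance

variable {m : Obs dz dw dx → (Vec dw × Vec dx → ℝ) → ℝ}
  {R : Set (ProbabilityMeasure (Obs dz dw dx))} {S : Set ℝ}

/-- Each value of the parameter is attained arbitrarily close to a conditionally independent law. -/
theorem exists_model_sequence (hB : B.Admissible) (hm_simple : SimpleRepresenterCondition B m)
    (hm_cont : RepresenterContinuityCondition B m) (hR : RestrictionCondition B R)
    (hP : IsConditionallyIndependentLaw B m R P) {θ : ℝ} (hθ : θ ∈ S) :
    ∃ Q : ℕ → ProbabilityMeasure (Obs dz dw dx),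
      (∀ k, Q k ∈ model B m R S ∧ phi m (Q k) = θ) ∧ DensitiesConverge B Q P := by
  obtain ⟨Q, hQ, hconv⟩ := exists_approximating_sequence hB hm_simple hm_cont (hR.1 P hP.mem) hP θ
  obtain ⟨q, hq, hqR⟩ := hR.2 P hP.mem Q (fun i => (hQ i).1) hconv
  refine ⟨fun k => Q (q k), fun k => ?_, ?_⟩
  · obtain ⟨h1, h2, h3, h4, h5⟩ := hQ (q k)
    exact ⟨⟨h1, hqR k, h2, h3, h4, h5 ▸ hθ⟩, h5⟩
  · filter_upwards [hconv] with o ho using ho.comp hq.tendsto_atTop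

/-- A confidence set with large coverage probability over the model has, for some law of the model,
a diameter at least that of the parameter set with large probability. -/
theorem one_sub_le_iSup_sampleLaw_diameter (hB : B.Admissible)
    (hm_simple : SimpleRepresenterCondition B m)
    (hm_cont : RepresenterContinuityCondition B m) (hR : RestrictionCondition B R)
    (hP : IsConditionallyIndependentLaw B m R P) (hS : S.Nonempty) {n : ℕ}
    {C : (Fin n → Obs dz dw dx) → Set ℝ} (hC : ∀ θ ∈ S, MeasurableSet {o | θ ∈ C o}) :
    1 - 2 * (1 - ⨅ P ∈ model B m R S, sampleLaw P n {o | phi m P ∈ C o}) ≤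
      ⨆ P ∈ model B m R S, sampleLaw P n {o | diameter S ≤ diameter (C o)} := by
  have := hB.sigmaFinite_muY
  have := hB.sigmaFinite_muX
  have := hB.sigmaFinite_muZ
  have := hB.sigmaFinite_muW
  have hdom := hR.1 P hP.mem
  set v := ⨅ P ∈ model B m R S, sampleLaw P n {o | phi m P ∈ C o} with hv
  have hseq := fun θ (hθ : θ ∈ S) => exists_model_sequence hB hm_simple hm_cont hR hP hθ
  have hmiss : ∀ θ ∈ S, sampleLaw P n {o | θ ∈ C o}ᶜ ≤ 1 - v := by
    intro θ hθ
    obtain ⟨Q, hQ, hconv⟩ := hseq θ hθ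
    refine hconv.sampleLaw_le hdom (fun k => (hQ k).1.1) (hC θ hθ).compl fun k => ?_
    -- Along the sequence φ equals θ, so missing θ is non-coverage, and its probability is at most 1
    -- - v.
    rw [prob_compl_eq_one_sub (hC θ hθ)]
    refine tsub_le_tsub_left ((iInf₂_le (Q k) (hQ k).1).trans ?_) 1
    rw [(hQ k).2]
  obtain ⟨x, y, hx, hy, hxy⟩ := exists_seq_tendsto_diameter hS
  let D : ℕ → Set (Fin n → Obs dz dw dx) := fun k => {o | x k ∈ C o}ᶜ ∪ {o | y k ∈ C o}ᶜ
  have hD : ∀ k, MeasurableSet (D k) := fun k =>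
    (hC _ (hx k)).compl.union (hC _ (hy k)).compl
  have hDle : ∀ k, sampleLaw P n (D k) ≤ 2 * (1 - v) := fun k => by
    rw [two_mul]
    exact (measure_union_le _ _).trans (add_le_add (hmiss _ (hx k)) (hmiss _ (hy k)))
  let A : Set (Fin n → Obs dz dw dx) := {o | ∀ᶠ k in atTop, o ∈ D k}
  have hA : MeasurableSet A := measurableSet_setOf_eventually hD
  have hdiam : Aᶜ ⊆ {o | diameter S ≤ diameter (C o)} := by
    intro o ho
    -- Off A both points are covered for infinitely many k. That suffices, because x k - y k
    -- converges to the diameter of S, which may be infinite.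
    refine le_of_tendsto_of_frequently hxy ?_
    have h1 : ∃ᶠ k in atTop, o ∉ D k := not_eventually.1 ho
    refine h1.mono fun k hk => ?_
    have h2 : x k ∈ C o ∧ y k ∈ C o := by simpa [D] using hk
    exact le_diameter h2.1 h2.2
  have h1 : 1 - 2 * (1 - v) ≤ sampleLaw P n Aᶜ := by
    rw [prob_compl_eq_one_sub hA]
    exact tsub_le_tsub_left (measure_setOf_eventually_le hDle) 1
  obtain ⟨θ, hθ⟩ := hS
  obtain ⟨Q, hQ, hconv⟩ := hseq θ hθ
  -- The transfer is made for the measurable event Aᶜ; the event about the diameter need not be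
  -- measurable and enters only by monotonicity of outer measure.
  refine h1.trans (hconv.sampleLaw_le hdom (fun k => (hQ k).1.1) hA.compl fun k => ?_)
  exact (measure_mono hdiam).trans
    (le_iSup₂ (f := fun P (_ : P ∈ model B m R S) =>
      sampleLaw P n {o | diameter S ≤ diameter (C o)}) (Q k) (hQ k).1)

/-- The map t ↦ 1 - 2(1 - t), with truncated subtraction, is monotone and continuous on [0, ∞], so
it commutes with the lower limit. -/
theorem ofReal_le_liminf_of_forall_le {u v : ℕ → ℝ≥0∞} {α : ℝ} (hv : ∀ n, v n ≤ 1)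
    (h : ENNReal.ofReal (1 - α) ≤ liminf v atTop) (huv : ∀ n, 1 - 2 * (1 - v n) ≤ u n) :
    ENNReal.ofReal (1 - 2 * α) ≤ liminf u atTop := by
  -- Validity at level 1 - α forces this, since probabilities do not exceed 1.
  have hα : 0 ≤ α := by
    have h1 : liminf v atTop ≤ 1 :=
      (liminf_le_liminf (Eventually.of_forall hv)).trans (liminf_const (1 : ℝ≥0∞)).le
    have h2 := ENNReal.ofReal_le_one.1 (h.trans h1)
    linarith
  let F : ℝ≥0∞ → ℝ≥0∞ := fun t => 1 - 2 * (1 - t)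
  have hF : Monotone F := fun s t hst =>
    tsub_le_tsub_left (mul_le_mul_right (tsub_le_tsub_left hst 1) 2) 1
  have hFc : Continuous F := (ENNReal.continuous_sub_left ENNReal.one_ne_top).comp
    ((ENNReal.continuous_const_mul ENNReal.ofNat_ne_top).comp
      (ENNReal.continuous_sub_left ENNReal.one_ne_top))
  have h3 : F (liminf v atTop) = liminf (F ∘ v) atTop :=
    hF.map_liminf_of_continuousAt v hFc.continuousAt
  refine le_trans ?_ ((hF h).trans (h3.le.trans (liminf_le_liminf (Eventually.of_forall huv))))
  have h4 : 1 - ENNReal.ofReal (1 - α) ≤ ENNReal.ofReal α := by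
    rw [tsub_le_iff_right, ← ENNReal.ofReal_one]
    refine le_trans (le_of_eq ?_) ENNReal.ofReal_add_le
    congr 1; ring
  rw [ENNReal.ofReal_sub _ (by positivity), ENNReal.ofReal_one, ENNReal.ofReal_mul zero_le_two,
    ENNReal.ofReal_ofNat]
  exact tsub_le_tsub_left (mul_le_mul_right h4 2) 1

end IntegralEq

theorem corollary2 {dz dw dx : ℕ}
    (B : IntegralEq.BaseMeasures dz dw dx) (hB : B.Admissible)
    (m : IntegralEq.Obs dz dw dx → (IntegralEq.Vec dw × IntegralEq.Vec dx → ℝ) → ℝ)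
    (hm_simple : IntegralEq.SimpleRepresenterCondition B m)
    (hm_cont : IntegralEq.RepresenterContinuityCondition B m)
    (R : Set (ProbabilityMeasure (IntegralEq.Obs dz dw dx)))
    (hR : IntegralEq.RestrictionCondition B R)
    (hP : ∃ Pstar, IntegralEq.IsConditionallyIndependentLaw B m R Pstar)
    (S : Set ℝ) (hS : MeasurableSet S) (hS_ne : S.Nonempty)
    (α : ℝ)
    (C : ∀ n : ℕ, (Fin n → IntegralEq.Obs dz dw dx) → Set ℝ)
    (hC : ∀ n : ℕ, ∀ θ ∈ S, MeasurableSet {o | θ ∈ C n o}) :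
    (IntegralEq.AsympUniformlyValid (IntegralEq.model B m R S) (IntegralEq.phi m) α C →
      ENNReal.ofReal (1 - 2 * α) ≤
        liminf (fun n : ℕ => ⨆ P ∈ IntegralEq.model B m R S,
          IntegralEq.sampleLaw P n
            {o | IntegralEq.diameter S ≤ IntegralEq.diameter (C n o)}) atTop) ∧
    (α < 1 / 2 → 0 < IntegralEq.diameter S →
      (∀ ε : ℝ, 0 < ε →
        Tendsto (fun n : ℕ => ⨆ P ∈ IntegralEq.model B m R S,
          IntegralEq.sampleLaw P n {o | (ε : EReal) ≤ IntegralEq.diameter (C n o)})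
          atTop (𝓝 0)) →
      ¬ IntegralEq.AsympUniformlyValid (IntegralEq.model B m R S) (IntegralEq.phi m) α C) := by
  obtain ⟨P, hP⟩ := hP
  have hmain : IntegralEq.AsympUniformlyValid (IntegralEq.model B m R S) (IntegralEq.phi m) α C →
      ENNReal.ofReal (1 - 2 * α) ≤
        liminf (fun n : ℕ => ⨆ P ∈ IntegralEq.model B m R S,
          IntegralEq.sampleLaw P n
            {o | IntegralEq.diameter S ≤ IntegralEq.diameter (C n o)}) atTop := by
    intro hvalid
    obtain ⟨θ, hθ⟩ := hS_ne
    -- A law of the model is needed to bound the infimum of the coverage by 1: over an empty model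
    -- it would be ∞.
    obtain ⟨Q, hQ, -⟩ := IntegralEq.exists_model_sequence hB hm_simple hm_cont hR hP hθ
    exact IntegralEq.ofReal_le_liminf_of_forall_le
      (fun n => (iInf₂_le (Q 0) (hQ 0).1).trans prob_le_one) hvalid fun n =>
      IntegralEq.one_sub_le_iSup_sampleLaw_diameter hB hm_simple hm_cont hR hP ⟨θ, hθ⟩ (hC n)
  refine ⟨hmain, fun hα hdiam hlim hvalid => ?_⟩
  -- A real ε below the diameter of S, which may be infinite. A set as wide as S is wider than ε, so
  -- the lower limit in (i) would be 0, whereas 1 - 2α > 0.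
  obtain ⟨ε, hε, hεS⟩ := EReal.lt_iff_exists_real_btwn.1 hdiam
  have h1 : liminf (fun n : ℕ => ⨆ P ∈ IntegralEq.model B m R S, IntegralEq.sampleLaw P n
      {o | IntegralEq.diameter S ≤ IntegralEq.diameter (C n o)}) atTop ≤ 0 := by
    rw [← (hlim ε (EReal.coe_pos.1 hε)).liminf_eq]
    exact liminf_le_liminf (Eventually.of_forall fun n => iSup₂_mono fun P _ =>
      measure_mono fun o ho => hεS.le.trans ho)
  have h2 := (hmain hvalid).trans h1
  rw [nonpos_iff_eq_zero, ENNReal.ofReal_eq_zero] at h2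
  linarith
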